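/- Let $M$ be a connected smooth surface with a complete Riemannian metric of negative (possibly variable) Gaussian curvature, let $p:\tilde M\to M$ be its Riemannian universal covering, and let $\Gamma$ be the fundamental group of $M$, acting on $\tilde M$ by deck transformations. Write $d$ for the Riemannian distances, and for a unit tangent vector $\tilde v\in T^1\tilde M$ write $\tilde v(t)$, $t\in\mathbb R$, for the unit-speed geodesic with initial velocity $\tilde v$. The boundary at infinity $\partial_\infty\tilde M$ is the set of classes of $T^1\tilde M$ under the relation $\tilde v\sim\tilde v'$ iff $\sup_{t>0}d(\tilde v(t),\tilde v'(t))<\infty$; the class $\tilde v(\infty)$ of $\tilde v$ is called its endpoint. A sequence $x_n\in\tilde M$ converges to $\xi\in\partial_\infty\tilde M$ if, for a base point $q\in\tilde M$, there are unit vectors $u_n,u$ at $q$ and times $t_n\to\infty$ with $u_n(t_n)=x_n$, $u_n\to u$ and $u(\infty)=\xi$. The limit set $L(\Gamma)\subset\partial_\infty\tilde M$ is the set of accumulation points at infinity of an orbit $\Gamma z$, $z\in\tilde M$; its elements are called limit points. For $\xi\in\partial_\infty\tilde M$ and $y,z\in\tilde M$ let $$B_\xi(y,z)=\lim_{x\to\xi}\bigl(d(x,y)-d(x,z)\bigr)$$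 be the Busemann function, the limit being taken along a geodesic ray with endpoint $\xi$. Fix a reference point $o\in\tilde M$. A limit point $\xi$ is horocyclic if for every $z\in\tilde M$ and every $t\in\mathbb R$ there is $\gamma\in\Gamma$ with $B_\xi(o,\gamma z)>t$; otherwise it is a nonhorocyclic limit point. Proposition. Let $\xi\in L(\Gamma)$ and let $\tilde v\in T^1\tilde M$ satisfy $\tilde v(\infty)=\xi$. Put $v(t)=p(\tilde v(t))$. Then the projected geodesic ray $v[0,\infty)$ on $M$ is almost minimizing, that is, there is a real number $c>0$ such that $$d(v(t),v(0))\ge t-c\qquad\text{for all } t\ge 0,$$ if and only if $\xi$ is a nonhorocyclic limit point. -/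

import Mathlib

open Set Filter Topology Manifold Bundle
open scoped ContDiff

noncomputable section

namespace NegSurface

/-- The coordinate plane `ℝ²`. -/
abbrev Plane : Type := EuclideanSpace ℝ (Fin 2)

/-! ### Riemannian geometry in coordinates

`g y i j` are the coefficients `g_ij(y)` of a Riemannian metric on an open subset of the plane. -/

/-- The partial derivative `∂_i f` at `y`. -/
def partialDeriv (i : Fin 2) (f : Plane → ℝ) (y : Plane) : ℝ :=
  fderiv ℝ f y (EuclideanSpace.single i 1)

/-- The Christoffel symbol `Γ^k_ij = ½ ∑_l g^{kl} (∂_i g_jl + ∂_j g_il - ∂_l g_ij)` at `y`. -/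
def christoffel (g : Plane → Matrix (Fin 2) (Fin 2) ℝ) (k i j : Fin 2) (y : Plane) : ℝ :=
  (1 / 2) * ∑ l, (g y)⁻¹ k l *
    (partialDeriv i (fun z => g z j l) y + partialDeriv j (fun z => g z i l) y
      - partialDeriv l (fun z => g z i j) y)

/-- The component `R^l` of `R(∂_i, ∂_j) ∂_k`, where
`R(X, Y) Z = ∇_X ∇_Y Z - ∇_Y ∇_X Z - ∇_[X, Y] Z`. -/
def riemannTensor (g : Plane → Matrix (Fin 2) (Fin 2) ℝ) (l k i j : Fin 2) (y : Plane) : ℝ :=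
  partialDeriv i (christoffel g l j k) y - partialDeriv j (christoffel g l i k) y
    + ∑ m, (christoffel g l i m y * christoffel g m j k y
      - christoffel g l j m y * christoffel g m i k y)

/-- The Gaussian curvature `⟨R(∂₀, ∂₁) ∂₁, ∂₀⟩ / det g` at `y`. -/
def gaussCurvature (g : Plane → Matrix (Fin 2) (Fin 2) ℝ) (y : Plane) : ℝ :=
  (∑ l, g y 0 l * riemannTensor g l 1 0 1 y) / (g y).det

/-! ### Riemannian surfaces -/

section Surface

variable {M : Type*} [TopologicalSpace M] [ChartedSpace Plane M]
  [RiemannianBundle (fun x : M => TangentSpace (𝓡 2) x)]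

/-- The coefficients `g_ij(y) = ⟨∂_i, ∂_j⟩` of the Riemannian metric of `M` in a chart `e`. -/
def metricCoeff (e : OpenPartialHomeomorph M Plane) (y : Plane) : Matrix (Fin 2) (Fin 2) ℝ :=
  Matrix.of fun i j =>
    inner ℝ
      (mfderiv (𝓡 2) (𝓡 2) e.symm y (EuclideanSpace.single i 1 : Plane) :
        TangentSpace (𝓡 2) (e.symm y))
      (mfderiv (𝓡 2) (𝓡 2) e.symm y (EuclideanSpace.single j 1 : Plane) :
        TangentSpace (𝓡 2) (e.symm y))

variable (M) in
/-- The Gaussian curvature is negative at every point (computed in any smooth chart). -/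
def NegativelyCurved : Prop :=
  ∀ e ∈ IsManifold.maximalAtlas (𝓡 2) ∞ M, ∀ x ∈ e.source,
    gaussCurvature (metricCoeff e) (e x) < 0

/-- The velocity vector `c'(t)` of a curve. -/
def velocity (c : ℝ → M) (t : ℝ) : TangentSpace (𝓡 2) (c t) :=
  mfderiv 𝓘(ℝ, ℝ) (𝓡 2) c t (1 : ℝ)

/-- The geodesic equation `c_k'' + ∑ Γ^k_ij c_i' c_j' = 0`, in every smooth chart. -/
def SolvesGeodesicEq (c : ℝ → M) : Prop :=
  ∀ e ∈ IsManifold.maximalAtlas (𝓡 2) ∞ M, ∀ t : ℝ, c t ∈ e.source → ∀ k : Fin 2,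
    deriv (deriv fun s => e (c s) k) t
      + ∑ i, ∑ j, christoffel (metricCoeff e) k i j (e (c t))
          * deriv (fun s => e (c s) i) t * deriv (fun s => e (c s) j) t = 0

variable (M) in
/-- A unit-speed geodesic `u : ℝ → M`. On a complete surface, `u ↦ u'(0)` is a bijection from these
geodesics onto the unit tangent bundle `T¹M`, and we represent a unit tangent vector by the
geodesic that it directs. -/
structure UnitGeodesic where
  /-- the curve `t ↦ u(t)` -/
  curve : ℝ → M
  smooth : ContMDiff 𝓘(ℝ, ℝ) (𝓡 2) ∞ curve
  geodesic : SolvesGeodesicEq curve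
  unit_speed : ∀ t, ‖velocity curve t‖ = 1

/-- The vector `u'(0)`, as a point of the tangent bundle. -/
def UnitGeodesic.initialVector (u : UnitGeodesic M) : TangentBundle (𝓡 2) M :=
  ⟨u.curve 0, velocity u.curve 0⟩

end Surface

/-! ### The boundary at infinity and Busemann functions -/

section Boundary

variable {N : Type*} [MetricSpace N] [ChartedSpace Plane N]
  [RiemannianBundle (fun x : N => TangentSpace (𝓡 2) x)]

/-- Two unit-speed geodesics have the same endpoint: `sup_{t > 0} d(u(t), w(t)) < ∞`. -/
def SameEndpoint (u w : UnitGeodesic N) : Prop :=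
  ∃ C : ℝ, ∀ t : ℝ, 0 < t → dist (u.curve t) (w.curve t) ≤ C

variable (N) in
/-- Having the same endpoint is an equivalence relation. -/
def endpointSetoid : Setoid (UnitGeodesic N) where
  r := SameEndpoint
  iseqv :=
    { refl := fun _ => ⟨0, fun _ _ => (dist_self _).le⟩
      symm := fun ⟨C, h⟩ => ⟨C, fun t ht => by rw [dist_comm]; exact h t ht⟩
      trans := fun ⟨C, h⟩ ⟨D, k⟩ => ⟨C + D, fun t ht =>
        (dist_triangle _ _ _).trans (add_le_add (h t ht) (k t ht))⟩ }

variable (N) in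
/-- The boundary at infinity `∂_∞ N`. -/
def Boundary : Type _ := Quotient (endpointSetoid N)

/-- The endpoint `u(∞)`. -/
def UnitGeodesic.endpoint (u : UnitGeodesic N) : Boundary N := Quotient.mk (endpointSetoid N) u

/-- A unit-speed geodesic ending at `ξ`. -/
def Boundary.ray (ξ : Boundary N) : UnitGeodesic N := Quotient.out ξ

/-- The Busemann function `B_ξ(y, z) = lim_{x → ξ} (d(x, y) - d(x, z))`,
where `x` goes to `ξ` along a geodesic ray ending at `ξ`. -/
def busemann (ξ : Boundary N) (y z : N) : ℝ :=
  limUnder atTop fun t : ℝ => dist (ξ.ray.curve t) y - dist (ξ.ray.curve t) z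

/-- The sequence `x n` in `N` converges to `ξ ∈ ∂_∞ N`, as seen from `o`: it goes to infinity, and
the initial vectors of geodesic rays from `o` through `x n` converge to the initial vector of a
geodesic ray from `o` to `ξ`. -/
def ConvergesTo [IsManifold (𝓡 2) ∞ N] (o : N) (x : ℕ → N) (ξ : Boundary N) : Prop :=
  ∃ (u : ℕ → UnitGeodesic N) (t : ℕ → ℝ) (w : UnitGeodesic N),
    (∀ n, (u n).curve 0 = o ∧ 0 ≤ t n ∧ (u n).curve (t n) = x n) ∧
    w.curve 0 = o ∧ w.endpoint = ξ ∧
    Tendsto t atTop atTop ∧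
    Tendsto (fun n => (u n).initialVector) atTop (𝓝 w.initialVector)

end Boundary

/-! ### The universal covering of a surface -/

section Covering

variable {M N : Type*} [MetricSpace M] [ChartedSpace Plane M]
  [RiemannianBundle (fun x : M => TangentSpace (𝓡 2) x)]
  [MetricSpace N] [ChartedSpace Plane N]
  [RiemannianBundle (fun x : N => TangentSpace (𝓡 2) x)]

/-- `p : N → M` is the Riemannian universal covering of `M`: a smooth covering map from a simply
connected surface whose differentials are isometric. -/
structure IsRiemannianUniversalCovering (p : N → M) : Prop where
  simplyConnected : SimplyConnectedSpace N
  isCoveringMap : IsCoveringMap p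
  smooth : ContMDiff (𝓡 2) (𝓡 2) ∞ p
  isometric : ∀ (x : N) (v : TangentSpace (𝓡 2) x),
    ‖(mfderiv (𝓡 2) (𝓡 2) p x v : TangentSpace (𝓡 2) (p x))‖ = ‖v‖

/-- The group `Γ` of deck transformations of `p`, which is the fundamental group of `M` acting
on its universal covering. -/
def deckGroup (p : N → M) : Subgroup (N ≃ₜ N) where
  carrier := {γ | ∀ x, p (γ x) = p x}
  one_mem' := fun _ => rfl
  mul_mem' := fun {a b} ha hb x => (ha (b x)).trans (hb x)
  inv_mem' := fun {a} ha x => by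
    have h := ha (a.symm x)
    rw [a.apply_symm_apply] at h
    exact h.symm

/-- The limit set `L(Γ) ⊆ ∂_∞ N`: the accumulation points at infinity of an orbit `Γ z`. -/
def limitSet [IsManifold (𝓡 2) ∞ N] (p : N → M) : Set (Boundary N) :=
  {ξ | ∃ (o z : N) (γ : ℕ → deckGroup p), ConvergesTo o (fun n => (γ n : N ≃ₜ N) z) ξ}

/-- `ξ` is a horocyclic limit point (with reference point `o`): every horodisk
`{y | B_ξ(o, y) > t}` meets every orbit `Γ z`. -/
def IsHorocyclicLimitPoint [IsManifold (𝓡 2) ∞ N] (p : N → M) (o : N) (ξ : Boundary N) : Prop :=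
  ξ ∈ limitSet p ∧ ∀ (z : N) (t : ℝ), ∃ γ ∈ deckGroup p, t < busemann ξ o (γ z)

/-- `ξ` is a limit point that is not horocyclic. -/
def IsNonhorocyclicLimitPoint [IsManifold (𝓡 2) ∞ N] (p : N → M) (o : N) (ξ : Boundary N) : Prop :=
  ξ ∈ limitSet p ∧ ¬ IsHorocyclicLimitPoint p o ξ

/-- The ray `v[0, ∞)` is almost minimizing: `d(v(t), v(0)) ≥ t - c` for all `t ≥ 0`. -/
def AlmostMinimizing (v : ℝ → M) : Prop :=
  ∃ c : ℝ, 0 < c ∧ ∀ t : ℝ, 0 ≤ t → t - c ≤ dist (v t) (v 0)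

end Covering

end NegSurface

end

/-!
The projected ray stays within `c` of being minimizing exactly when the orbit of its starting point
stays out of some horodisk centred at `ξ`; the comparison rests on two facts.

*Distances.* The covering map `p` is isometric on tangent vectors, so it preserves lengths of
curves, and curves of the base lift. Since `N` is simply connected the deck group is transitive on
fibres (`exists_deck`), hence `d(p x, p y) = inf_γ d(x, γ y)` (`dist_le`, `exists_deck_dist_lt`).

*Busemann functions.* For a ray `w` with `t - K ≤ d(w(t), w(0))`, the function `d(w(t), y) - t` is
nonincreasing and bounded below, so it converges to some `β(y)`, and `B_ξ(o, y) = β(o) - β(y)`.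
If the projection of `v` is almost minimizing, then `d(v(t), γ v(0)) ≥ t - c` for all `γ`, which
bounds `B_ξ(o, γ v(0))` from above: `ξ` is not horocyclic (`AlmostMinimizing.exists_busemann_le`).
Conversely, if `B_ξ(o, γ z) ≤ B` for all `γ`, monotonicity gives `d(v(t), γ v(0)) ≥ t - c` for all
`γ` and `t`, and the infimum over `γ` is the distance in `M`
(`almostMinimizing_of_busemann_le`). The chosen ray with endpoint `ξ` and the ray `v` stay at
bounded distance, so either may be used.

For the converse, the limits must be known to exist, that is, geodesics of `N` have to be minimizing
(`IsRiemannianUniversalCovering.le_dist`). This is where the curvature enters, through a version of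
the Cartan-Hadamard theorem. On the complete surface `M`, geodesics exist for all times
(`exists_geodesic`) and depend in a `C¹` way on the initial velocity. A Jacobi field `J` along a
geodesic satisfies `(|J|²)'' = 2 (|J'|² - K |J ∧ c'|²)`, so `|J|` is convex when `K < 0`
(`IsCoordMetric.jacobi`, `le_sq_mul_of_sq_deriv_le`); therefore the exponential map from the
Euclidean plane does not shorten any vector (`IsGeodesicFamily.isExpanding`). Such a map from a
complete surface lifts curves of class `C¹`, and its lifts obey the monodromy principle
(`IsExpanding.hasUniformSections`, `HasUniformSections.lift_one_eq`). A curve of `N` shorter than a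
geodesic segment with the same ends projects to a curve of `M` homotopic to the projected
geodesic; both lift to the plane, where the second lift is a straight segment, with the same end
points and of the same length as the geodesic: a contradiction.

Geodesics are treated in charts, as integral curves of the field `(x, y) ↦ (y, -Γ(x)(y, y))`;
`IsCoordIsometry.hasDerivAt_geodField` is the transformation law that makes this independent of the
chart and shows that `p` maps geodesics to geodesics.
-/

set_option linter.unusedSectionVars false

noncomputable section

namespace NegSurface

/-! ### Differentiable dependence of solutions of an ODE on the initial value -/

section ODE

variable {E : Type*} [NormedAddCommGroup E] [NormedSpace ℝ E]

/-- Grönwall's inequality on a symmetric interval, for a function vanishing at `0`. -/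
theorem norm_le_of_norm_deriv_le_symm {y y' : ℝ → E} {K η δ : ℝ} (hK : 0 < K) (hη : 0 ≤ η)
    (h0 : y 0 = 0) (hy : ∀ s ∈ Ioo (-δ) δ, HasDerivAt y (y' s) s)
    (hb : ∀ s ∈ Ioo (-δ) δ, ‖y' s‖ ≤ K * ‖y s‖ + η) {s : ℝ} (hs : s ∈ Ioo (-δ) δ) :
    ‖y s‖ ≤ η / K * Real.exp (K * δ) := by
  have key : ∀ (w w' : ℝ → E), w 0 = 0 → (∀ s ∈ Ioo (-δ) δ, HasDerivAt w (w' s) s) →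
      (∀ s ∈ Ioo (-δ) δ, ‖w' s‖ ≤ K * ‖w s‖ + η) → ∀ s ∈ Ioo (-δ) δ, 0 ≤ s →
      ‖w s‖ ≤ η / K * Real.exp (K * δ) := by
    intro w w' hw0 hw hwb s hs hs0
    have hsub : ∀ x ∈ Icc 0 s, x ∈ Ioo (-δ) δ := fun x hx =>
      ⟨by linarith [hs.1, hs.2, hx.1], by linarith [hs.2, hx.2]⟩
    have h := norm_le_gronwallBound_of_norm_deriv_right_le (f := w) (f' := w') (δ := 0) (K := K)
      (ε := η) (a := 0) (b := s)
      (fun x hx => (hw x (hsub x hx)).continuousAt.continuousWithinAt)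
      (fun x hx => (hw x (hsub x (Ico_subset_Icc_self hx))).hasDerivWithinAt)
      (by simp [hw0]) (fun x hx => hwb x (hsub x (Ico_subset_Icc_self hx))) s ⟨hs0, le_rfl⟩
    rw [gronwallBound_of_K_ne_0 hK.ne'] at h
    refine h.trans ?_
    have h1 : Real.exp (K * (s - 0)) ≤ Real.exp (K * δ) :=
      Real.exp_le_exp.2 (by nlinarith [hs.2])
    have h2 : 0 ≤ η / K := by positivity
    simp only [zero_mul, zero_add]
    gcongr
    linarith
  rcases le_total 0 s with h | h
  · exact key y y' h0 hy hb s hs h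
  · have hneg : ∀ x ∈ Ioo (-δ) δ, -x ∈ Ioo (-δ) δ := fun x hx =>
      ⟨by linarith [hx.2], by linarith [hx.1]⟩
    have := key (fun x => y (-x)) (fun x => -y' (-x)) (by simpa using h0)
      (fun x hx => by
        have := (hy (-x) (hneg x hx)).scomp x (hasDerivAt_neg x)
        simpa [Function.comp_def] using this)
      (fun x hx => by simpa using hb (-x) (hneg x hx)) (-s) (hneg s hs) (by linarith)
    simpa using this

/-- First order Taylor estimate with a Lipschitz derivative. -/
theorem norm_image_sub_sub_fderiv_le {F : Type*} [NormedAddCommGroup F] [NormedSpace ℝ F]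
    {G : E → F} {U : Set E} {C : ℝ} (hU : Convex ℝ U)
    (hd : ∀ x ∈ U, DifferentiableAt ℝ G x)
    (hL : ∀ x ∈ U, ∀ y ∈ U, ‖fderiv ℝ G x - fderiv ℝ G y‖ ≤ C * ‖x - y‖) (hC : 0 ≤ C)
    {a b : E} (ha : a ∈ U) (hb : b ∈ U) :
    ‖G b - G a - fderiv ℝ G a (b - a)‖ ≤ C * ‖b - a‖ ^ 2 := by
  have hseg : segment ℝ a b ⊆ U := hU.segment_subset ha hb
  have := (convex_segment a b).norm_image_sub_le_of_norm_hasFDerivWithin_le' (𝕜 := ℝ)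
    (f := G) (f' := fderiv ℝ G) (φ := fderiv ℝ G a) (C := C * ‖b - a‖)
    (fun x hx => (hd x (hseg hx)).hasFDerivAt.hasFDerivWithinAt)
    (fun x hx => (hL x (hseg hx) a ha).trans (by
      gcongr
      obtain ⟨t, ht, rfl⟩ := (segment_eq_image' ℝ a b ▸ hx)
      simp only [add_sub_cancel_left, norm_smul, Real.norm_eq_abs, abs_of_nonneg ht.1]
      exact mul_le_of_le_one_left (norm_nonneg _) ht.2))
    (left_mem_segment ℝ a b) (right_mem_segment ℝ a b)
  linarith [this, (by ring : C * ‖b - a‖ * ‖b - a‖ = C * ‖b - a‖ ^ 2)]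

/-- A flow box of a vector field `G` on `ball z₀ r × (-δ, δ)`: the flow `Φ`, its derivative `A` in
the initial value, and the variational equation that `A` satisfies. -/
structure IsFlowBox (G : E → E) (z₀ : E) (r δ : ℝ) (Φ : E → ℝ → E) (A : E → ℝ → E →L[ℝ] E) :
    Prop where
  pos_r : 0 < r
  pos_δ : 0 < δ
  zero : ∀ z ∈ Metric.ball z₀ r, Φ z 0 = z
  hasDerivAt : ∀ z ∈ Metric.ball z₀ r, ∀ s ∈ Ioo (-δ) δ, HasDerivAt (Φ z) (G (Φ z s)) s
  hasFDerivAt : ∀ z ∈ Metric.ball z₀ r, ∀ s ∈ Ioo (-δ) δ,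
    HasFDerivAt (fun z => Φ z s) (A z s) z
  variational : ∀ z ∈ Metric.ball z₀ r, ∀ s ∈ Ioo (-δ) δ,
    HasDerivAt (A z) ((fderiv ℝ G (Φ z s)).comp (A z s)) s
  continuousOn : ContinuousOn (fun q : E × ℝ => A q.1 q.2) (Metric.ball z₀ r ×ˢ Ioo (-δ) δ)

/-- A `C²` vector field has a flow box at every point, inside any given neighbourhood. The flow and
its derivative are obtained together, by solving the equation `(z, A)' = (G z, G'(z) A)`. -/
theorem exists_isFlowBox [CompleteSpace E] {G : E → E} {z₀ : E} (hG : ContDiffAt ℝ 2 G z₀)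
    {V : Set E} (hV : V ∈ 𝓝 z₀) :
    ∃ r δ Φ A, IsFlowBox G z₀ r δ Φ A ∧
      ∀ z ∈ Metric.ball z₀ r, ∀ s ∈ Ioo (-δ) δ, Φ z s ∈ V := by
  classical
  -- The derivative of `G` is Lipschitz and bounded near `z₀`.
  have hG' : ContDiffAt ℝ 1 (fderiv ℝ G) z₀ := hG.fderiv_right (by norm_num)
  obtain ⟨C, U₁, hU₁, hLip⟩ := hG'.exists_lipschitzOnWith
  have hdiff : ∀ᶠ z in 𝓝 z₀, DifferentiableAt ℝ G z := by
    filter_upwards [hG.eventually (by simp)] with z hz using hz.differentiableAt (by norm_num)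
  have hbd : ∀ᶠ z in 𝓝 z₀, ‖fderiv ℝ G z‖ < ‖fderiv ℝ G z₀‖ + 1 :=
    hG'.continuousAt.norm.eventually_lt continuousAt_const (by linarith)
  obtain ⟨ρ, hρ, hρs⟩ := Metric.mem_nhds_iff.1 (inter_mem hV (inter_mem hU₁ (hdiff.and hbd)))
  set U := Metric.ball z₀ ρ
  set K := ‖fderiv ℝ G z₀‖ + 1
  have hK : 0 < K := by positivity
  -- The augmented vector field.
  let H : E × (E →L[ℝ] E) → E × (E →L[ℝ] E) := fun q => (G q.1, (fderiv ℝ G q.1).comp q.2)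
  have hH : ContDiffAt ℝ 1 H (z₀, ContinuousLinearMap.id ℝ E) := by
    refine ContDiffAt.prodMk ?_ ?_
    · exact ContDiffAt.comp (g := G) (z₀, ContinuousLinearMap.id ℝ E)
        (hG.of_le (by norm_num)) contDiffAt_fst
    · refine ContDiffAt.clm_comp ?_ contDiffAt_snd
      exact ContDiffAt.comp (g := fderiv ℝ G) (z₀, ContinuousLinearMap.id ℝ E) hG' contDiffAt_fst
  obtain ⟨ε, hε, a, r₁, L, K₁, hr₁, hpl⟩ := IsPicardLindelof.of_contDiffAt_one hH
  obtain ⟨α, hα, L', hαL⟩ :=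
    (hpl 0).exists_forall_mem_closedBall_eq_hasDerivWithinAt_lipschitzOnWith
  have hαc : ContinuousOn (Function.uncurry α)
      (Metric.closedBall (z₀, ContinuousLinearMap.id ℝ E) r₁ ×ˢ Icc (0 - ε) (0 + ε)) :=
    continuousOn_prod_of_continuousOn_lipschitzOnWith _ L'
      (fun x hx => HasDerivWithinAt.continuousOn (hα x hx).2) hαL
  simp only [zero_sub, zero_add] at hα hαL hαc
  let Φ : E → ℝ → E := fun z s => (α (z, ContinuousLinearMap.id ℝ E) s).1
  let A : E → ℝ → E →L[ℝ] E := fun z s => (α (z, ContinuousLinearMap.id ℝ E) s).2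
  have hmem : ∀ z ∈ Metric.ball z₀ r₁,
      (z, ContinuousLinearMap.id ℝ E) ∈ Metric.closedBall (z₀, ContinuousLinearMap.id ℝ E) r₁ := by
    intro z hz
    simpa [Prod.dist_eq] using (Metric.mem_ball.1 hz).le
  have hαc' : ContinuousOn (fun q : E × ℝ => α (q.1, ContinuousLinearMap.id ℝ E) q.2)
      (Metric.ball z₀ r₁ ×ˢ Ioo (-ε) ε) := by
    refine hαc.comp (f := fun q : E × ℝ => ((q.1, ContinuousLinearMap.id ℝ E), q.2))
      (by fun_prop) ?_
    rintro ⟨z, s⟩ ⟨hz, hs⟩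
    exact ⟨hmem z hz, Ioo_subset_Icc_self hs⟩
  -- Shrink the box so that the flow stays in `U`.
  have hnear : ∀ᶠ q : E × ℝ in 𝓝 (z₀, 0), Φ q.1 q.2 ∈ U := by
    have h1 : Metric.ball z₀ r₁ ×ˢ Ioo (-ε) ε ∈ 𝓝 (z₀, (0 : ℝ)) :=
      prod_mem_nhds (Metric.ball_mem_nhds _ hr₁) (Ioo_mem_nhds (by linarith) hε)
    have h2 : ContinuousAt (fun q : E × ℝ => Φ q.1 q.2) (z₀, 0) :=
      continuous_fst.continuousAt.comp (hαc'.continuousAt h1)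
    have h3 : Φ z₀ 0 = z₀ := by
      change (α (z₀, ContinuousLinearMap.id ℝ E) 0).1 = z₀
      rw [(hα _ (hmem z₀ (Metric.mem_ball_self hr₁))).1]
    refine h2 (Metric.isOpen_ball.mem_nhds ?_)
    change Φ z₀ 0 ∈ U
    rw [h3]; exact Metric.mem_ball_self hρ
  rw [nhds_prod_eq, Filter.eventually_prod_iff] at hnear
  obtain ⟨pz, hpz, ps, hps, hzs⟩ := hnear
  obtain ⟨r₂, hr₂, hr₂'⟩ := Metric.eventually_nhds_iff_ball.1 hpz
  obtain ⟨δ₂, hδ₂, hδ₂'⟩ := Metric.eventually_nhds_iff_ball.1 hps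
  have hr₁' : (0 : ℝ) < r₁ := hr₁
  set r : ℝ := min r₁ r₂
  set δ : ℝ := min ε δ₂
  have hr : 0 < r := lt_min hr₁' hr₂
  have hδ : 0 < δ := lt_min hε hδ₂
  have hzr : ∀ z ∈ Metric.ball z₀ r, z ∈ Metric.ball z₀ r₁ :=
    fun z hz => Metric.ball_subset_ball (min_le_left _ _) hz
  have hsδ : ∀ s ∈ Ioo (-δ) δ, s ∈ Ioo (-ε) ε := fun s hs =>
    ⟨by linarith [hs.1, min_le_left ε δ₂], by linarith [hs.2, min_le_left ε δ₂]⟩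
  have hΦU : ∀ z ∈ Metric.ball z₀ r, ∀ s ∈ Ioo (-δ) δ, Φ z s ∈ U := by
    intro z hz s hs
    refine hzs (hr₂' z (Metric.ball_subset_ball (min_le_right _ _) hz)) (hδ₂' s ?_)
    rw [Real.ball_eq_Ioo]
    exact ⟨by linarith [hs.1, min_le_right ε δ₂], by linarith [hs.2, min_le_right ε δ₂]⟩
  have hder : ∀ z ∈ Metric.ball z₀ r, ∀ s ∈ Ioo (-δ) δ,
      HasDerivAt (α (z, ContinuousLinearMap.id ℝ E))
        (H (α (z, ContinuousLinearMap.id ℝ E) s)) s := by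
    intro z hz s hs
    have hs' := hsδ s hs
    exact ((hα _ (hmem z (hzr z hz))).2 s (Ioo_subset_Icc_self hs')).hasDerivAt
      (Icc_mem_nhds hs'.1 hs'.2)
  have hΦ : ∀ z ∈ Metric.ball z₀ r, ∀ s ∈ Ioo (-δ) δ, HasDerivAt (Φ z) (G (Φ z s)) s :=
    fun z hz s hs => (hder z hz s hs).fst
  have hA : ∀ z ∈ Metric.ball z₀ r, ∀ s ∈ Ioo (-δ) δ,
      HasDerivAt (A z) ((fderiv ℝ G (Φ z s)).comp (A z s)) s :=
    fun z hz s hs => (hder z hz s hs).snd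
  have h0 : ∀ z ∈ Metric.ball z₀ r, Φ z 0 = z ∧ A z 0 = ContinuousLinearMap.id ℝ E := by
    intro z hz
    have := (hα _ (hmem z (hzr z hz))).1
    exact ⟨by change (α (z, ContinuousLinearMap.id ℝ E) 0).1 = z; rw [this],
      by change (α (z, ContinuousLinearMap.id ℝ E) 0).2 = _; rw [this]⟩
  have hsub : Metric.ball z₀ r ×ˢ Ioo (-δ) δ ⊆ Metric.ball z₀ r₁ ×ˢ Ioo (-ε) ε :=
    fun q hq => ⟨hzr _ hq.1, hsδ _ hq.2⟩
  have hρ' : ∀ x ∈ U, DifferentiableAt ℝ G x := fun x hx => (hρs hx).2.2.1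
  have hLip' : ∀ x ∈ U, ∀ y ∈ U, ‖fderiv ℝ G x - fderiv ℝ G y‖ ≤ C * ‖x - y‖ := fun x hx y hy =>
    hLip.norm_sub_le (hρs hx).2.1 (hρs hy).2.1
  refine ⟨r, δ, Φ, A, ⟨hr, hδ, fun z hz => (h0 z hz).1, hΦ, ?_, hA,
    continuous_snd.comp_continuousOn (hαc'.mono hsub)⟩,
    fun z hz s hs => (hρs (hΦU z hz s hs)).1⟩
  intro z hz s hs
  -- The error `Φ z' - Φ z - A z (z' - z)` satisfies a linear differential inequality.
  have hest : ∀ z' ∈ Metric.ball z₀ r, ‖Φ z' s - Φ z s - A z s (z' - z)‖ ≤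
      (C * L' ^ 2 / K * Real.exp (K * δ)) * ‖z' - z‖ ^ 2 := by
    intro z' hz'
    have hΦL : ∀ t ∈ Ioo (-δ) δ, ‖Φ z' t - Φ z t‖ ≤ L' * ‖z' - z‖ := by
      intro t ht
      have h1 := (hαL t (Ioo_subset_Icc_self (hsδ t ht))).dist_le_mul _ (hmem z' (hzr z' hz'))
        _ (hmem z (hzr z hz))
      rw [Prod.dist_eq, Prod.dist_eq] at h1
      simp only [dist_self, dist_nonneg, sup_of_le_left] at h1
      rw [← dist_eq_norm, ← dist_eq_norm]
      exact (le_max_left _ _).trans h1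
    have := norm_le_of_norm_deriv_le_symm (y := fun t => Φ z' t - Φ z t - A z t (z' - z))
      (y' := fun t => G (Φ z' t) - G (Φ z t) - ((fderiv ℝ G (Φ z t)).comp (A z t)) (z' - z))
      (K := K) (η := C * L' ^ 2 * ‖z' - z‖ ^ 2) (δ := δ) hK (by positivity)
      (by simp [(h0 z hz), (h0 z' hz')])
      (fun t ht => ((hΦ z' hz' t ht).sub (hΦ z hz t ht)).sub
        ((hA z hz t ht).clm_apply (hasDerivAt_const t (z' - z)) |>.congr_deriv (by simp)))
      (fun t ht => by
        have e : G (Φ z' t) - G (Φ z t) - ((fderiv ℝ G (Φ z t)).comp (A z t)) (z' - z) =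
            fderiv ℝ G (Φ z t) (Φ z' t - Φ z t - A z t (z' - z)) +
            (G (Φ z' t) - G (Φ z t) - fderiv ℝ G (Φ z t) (Φ z' t - Φ z t)) := by
          simp only [map_sub, ContinuousLinearMap.comp_apply]; abel
        rw [e]
        refine (norm_add_le _ _).trans (add_le_add ?_ ?_)
        · refine (ContinuousLinearMap.le_opNorm _ _).trans ?_
          gcongr
          exact (hρs (hΦU z hz t ht)).2.2.2.le
        · refine (norm_image_sub_sub_fderiv_le (convex_ball z₀ ρ) hρ' hLip' C.coe_nonneg
            (hΦU z hz t ht) (hΦU z' hz' t ht)).trans ?_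
          have := hΦL t ht
          calc C * ‖Φ z' t - Φ z t‖ ^ 2 ≤ C * (L' * ‖z' - z‖) ^ 2 := by gcongr
            _ = _ := by ring) hs
    refine this.trans (le_of_eq ?_)
    ring
  rw [hasFDerivAt_iff_isLittleO]
  have hO : (fun z' => Φ z' s - Φ z s - A z s (z' - z)) =O[𝓝 z] fun z' => ‖z' - z‖ ^ 2 := by
    refine Asymptotics.IsBigO.of_bound (C * L' ^ 2 / K * Real.exp (K * δ)) ?_
    filter_upwards [Metric.isOpen_ball.mem_nhds hz] with z' hz'
    simpa using hest z' hz'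
  refine hO.trans_isLittleO ?_
  have h1 : Tendsto (fun z' => z' - z) (𝓝 z) (𝓝 0) := by
    have : Tendsto (fun z' => z' - z) (𝓝 z) (𝓝 (z - z)) := tendsto_id.sub_const z
    simpa using this
  have := (Asymptotics.isLittleO_norm_pow_id (E' := E) one_lt_two).comp_tendsto h1
  simpa [Function.comp_def] using this

/-- The flow of a flow box is `C¹` in the initial value. -/
theorem IsFlowBox.contDiffAt {G : E → E} {z₀ : E} {r δ : ℝ} {Φ : E → ℝ → E}
    {A : E → ℝ → E →L[ℝ] E} (h : IsFlowBox G z₀ r δ Φ A) {z : E} (hz : z ∈ Metric.ball z₀ r)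
    {s : ℝ} (hs : s ∈ Ioo (-δ) δ) : ContDiffAt ℝ 1 (fun z => Φ z s) z := by
  have hopen : IsOpen (Metric.ball z₀ r) := Metric.isOpen_ball
  rw [contDiffAt_one_iff]
  refine ⟨fun z => A z s, Metric.ball z₀ r, hopen.mem_nhds hz, ?_, fun x hx =>
    h.hasFDerivAt x hx s hs⟩
  exact h.continuousOn.comp (f := fun z => (z, s)) (by fun_prop) fun x hx => ⟨hx, hs⟩

end ODE

/-! ### Local diffeomorphisms of surfaces -/

section LocalDiffeo

variable {X Y : Type*} [TopologicalSpace X] [ChartedSpace Plane X]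
  [TopologicalSpace Y] [ChartedSpace Plane Y]

/-- The inverse function theorem for maps between surfaces. -/
theorem exists_openPartialHomeomorph_of_injective_mfderiv {n : WithTop ℕ∞} (hn : 1 ≤ n)
    [IsManifold (𝓡 2) n X] [IsManifold (𝓡 2) n Y] {q : X → Y} (hq : ContMDiff (𝓡 2) (𝓡 2) n q)
    (hinj : ∀ x, Function.Injective (mfderiv (𝓡 2) (𝓡 2) q x)) (x : X) :
    ∃ f : OpenPartialHomeomorph X Y, x ∈ f.source ∧ EqOn q f f.source ∧
      ContMDiffOn (𝓡 2) (𝓡 2) n f.symm f.target := by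
  have hn0 : n ≠ 0 := by rintro rfl; simp at hn
  have : IsManifold (𝓡 2) 1 X := IsManifold.of_le hn
  have : IsManifold (𝓡 2) 1 Y := IsManifold.of_le hn
  set e := chartAt Plane x
  set e' := chartAt Plane (q x)
  have he : e ∈ IsManifold.maximalAtlas (𝓡 2) n X := IsManifold.chart_mem_maximalAtlas x
  have he' : e' ∈ IsManifold.maximalAtlas (𝓡 2) n Y := IsManifold.chart_mem_maximalAtlas (q x)
  have hed : e.MDifferentiable (𝓡 2) (𝓡 2) := mdifferentiable_chart x
  have hed' : e'.MDifferentiable (𝓡 2) (𝓡 2) := mdifferentiable_chart (q x)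
  -- `g` is `q` read in charts, defined on `W`; the inverse function theorem applies to `g`.
  let g : Plane → Plane := e' ∘ q ∘ e.symm
  let W : Set Plane := e.target ∩ e.symm ⁻¹' (q ⁻¹' e'.source)
  have hW : IsOpen W := e.symm.isOpen_inter_preimage (e'.open_source.preimage hq.continuous)
  have hxW : e x ∈ W := by
    refine ⟨e.map_source (mem_chart_source _ x), ?_⟩
    simp only [mem_preimage, e.left_inv (mem_chart_source _ x)]
    exact mem_chart_source _ _
  have hg : ∀ y ∈ W, ContDiffAt ℝ n g y := by
    intro y hy
    rw [← contMDiffAt_iff_contDiffAt]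
    exact (contMDiffAt_of_mem_maximalAtlas he' hy.2).comp y
      ((hq _).comp y (contMDiffAt_symm_of_mem_maximalAtlas he hy.1))
  have hginj : ∀ y ∈ W, Function.Injective (fderiv ℝ g y) := by
    intro y hy
    have h1 : MDifferentiableAt (𝓡 2) (𝓡 2) e.symm y := hed.mdifferentiableAt_symm hy.1
    have h2 : MDifferentiableAt (𝓡 2) (𝓡 2) q (e.symm y) := (hq _).mdifferentiableAt hn0
    have h3 : MDifferentiableAt (𝓡 2) (𝓡 2) e' (q (e.symm y)) := hed'.mdifferentiableAt hy.2
    rw [← mfderiv_eq_fderiv]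
    change Function.Injective (mfderiv (𝓡 2) (𝓡 2) (e' ∘ q ∘ e.symm) y)
    rw [mfderiv_comp y (I' := 𝓡 2) h3 (h2.comp y h1), mfderiv_comp y h2 h1]
    exact (hed'.mfderiv_injective hy.2).comp ((hinj _).comp (hed.symm.mfderiv_injective hy.1))
  have hequiv : ∀ y ∈ W, ∃ f' : Plane ≃L[ℝ] Plane, HasFDerivAt g (f' : Plane →L[ℝ] Plane) y := by
    intro y hy
    let f' : Plane ≃L[ℝ] Plane :=
      (LinearEquiv.ofInjectiveEndo (fderiv ℝ g y : Plane →ₗ[ℝ] Plane)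
        (hginj y hy)).toContinuousLinearEquiv
    refine ⟨f', ?_⟩
    have : (f' : Plane →L[ℝ] Plane) = fderiv ℝ g y := by ext1 v; rfl
    rw [this]
    exact ((hg y hy).differentiableAt hn0).hasFDerivAt
  obtain ⟨f', hf'⟩ := hequiv _ hxW
  let f₀ : OpenPartialHomeomorph Plane Plane := (hg _ hxW).toOpenPartialHomeomorph g hf' hn0
  have hf₀ : ⇑f₀ = g := ContDiffAt.toOpenPartialHomeomorph_coe _ _ _
  have hxf₀ : e x ∈ f₀.source := ContDiffAt.mem_toOpenPartialHomeomorph_source _ hf' hn0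
  -- Inside `W` the derivative of `g` is invertible, so the inverse is `C^n` on the whole target.
  let f₁ := f₀.restrOpen W hW
  have hf₁c : ⇑f₁ = g := hf₀
  have hf₁s : f₁.source = f₀.source ∩ W := OpenPartialHomeomorph.restrOpen_source _ _ _
  let f : OpenPartialHomeomorph X Y := (e.trans f₁).trans e'.symm
  have hfs : ∀ z ∈ f.source, z ∈ e.source ∧ e z ∈ f₁.source := by
    intro z hz
    simp only [f, OpenPartialHomeomorph.trans_source, mem_inter_iff, mem_preimage] at hz
    exact hz.1
  refine ⟨f, ?_, ?_, ?_⟩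
  · simp only [f, OpenPartialHomeomorph.trans_source, mem_inter_iff, mem_preimage,
      OpenPartialHomeomorph.coe_trans, Function.comp_apply, hf₁s, hf₁c,
      OpenPartialHomeomorph.symm_source]
    refine ⟨⟨mem_chart_source _ x, hxf₀, hxW⟩, ?_⟩
    simp only [g, Function.comp_apply, e.left_inv (mem_chart_source _ x)]
    exact e'.map_source (mem_chart_source _ _)
  · intro z hz
    obtain ⟨h1, h2⟩ := hfs z hz
    rw [hf₁s] at h2
    have h3 : q z ∈ e'.source := by
      have := h2.2.2
      simpa only [mem_preimage, e.left_inv h1] using this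
    simp only [f, OpenPartialHomeomorph.coe_trans, Function.comp_apply, hf₁c, g, e.left_inv h1,
      e'.left_inv h3]
  · intro z hz
    have hz' : z ∈ e'.source ∧ e' z ∈ f₁.target ∧ f₁.symm (e' z) ∈ e.target := by
      simp only [f, OpenPartialHomeomorph.trans_target, mem_inter_iff, mem_preimage,
        OpenPartialHomeomorph.symm_target, OpenPartialHomeomorph.symm_symm] at hz
      exact hz
    have hmem : f₁.symm (e' z) ∈ W := by
      have := f₁.map_target hz'.2.1
      rw [hf₁s] at this
      exact this.2
    obtain ⟨f'', hf''⟩ := hequiv _ hmem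
    have h1 : ContDiffAt ℝ n f₁.symm (e' z) :=
      f₁.contDiffAt_symm hz'.2.1 (f₀' := f'') (by rw [hf₁c]; exact hf'')
        (by rw [hf₁c]; exact hg _ hmem)
    refine ContMDiffAt.contMDiffWithinAt ?_
    exact ContMDiffAt.comp (g := e.symm) (f := f₁.symm ∘ e') z
      (contMDiffAt_symm_of_mem_maximalAtlas he hz'.2.2)
      ((contMDiffAt_iff_contDiffAt.2 h1).comp z (contMDiffAt_of_mem_maximalAtlas he' hz'.1))

end LocalDiffeo

/-! ### Curves and their lifts under expanding maps -/

section Lifts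

variable {X Y : Type*} [MetricSpace X] [ChartedSpace Plane X] [IsManifold (𝓡 2) 1 X]
  [RiemannianBundle (fun x : X => TangentSpace (𝓡 2) x)]
  [MetricSpace Y] [ChartedSpace Plane Y] [IsManifold (𝓡 2) 1 Y]
  [RiemannianBundle (fun x : Y => TangentSpace (𝓡 2) x)]

/-- The norm of a tangent vector at `y`, as a function on the model plane. -/
def tangentNorm (y : Y) (ξ : Plane) : ℝ := ‖(show TangentSpace (𝓡 2) y from ξ)‖

/-- The norm of the image of a vector under the derivative depends only on the germ of the map. -/
theorem norm_mfderiv_congr {A : Type*} [NormedAddCommGroup A] [NormedSpace ℝ A]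
    {f g : A → Y} {t : A}
    (h : f =ᶠ[𝓝 t] g) (ξ : A) :
    ‖(mfderiv 𝓘(ℝ, A) (𝓡 2) f t ξ : TangentSpace (𝓡 2) (f t))‖ =
      ‖(mfderiv 𝓘(ℝ, A) (𝓡 2) g t ξ : TangentSpace (𝓡 2) (g t))‖ := by
  have h1 : (mfderiv 𝓘(ℝ, A) (𝓡 2) f t : A →L[ℝ] Plane) = mfderiv 𝓘(ℝ, A) (𝓡 2) g t :=
    h.mfderiv_eq
  have h2 : f t = g t := h.eq_of_nhds
  change tangentNorm (f t) ((mfderiv 𝓘(ℝ, A) (𝓡 2) f t : A →L[ℝ] Plane) ξ) =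
    tangentNorm (g t) ((mfderiv 𝓘(ℝ, A) (𝓡 2) g t : A →L[ℝ] Plane) ξ)
  rw [h1, h2]

/-- A `C¹` map between Riemannian surfaces is expanding if it does not shorten any tangent
vector. -/
structure IsExpanding (q : X → Y) : Prop where
  contMDiff : ContMDiff (𝓡 2) (𝓡 2) 1 q
  norm_le : ∀ (x : X) (ξ : TangentSpace (𝓡 2) x),
    ‖ξ‖ ≤ ‖(mfderiv (𝓡 2) (𝓡 2) q x ξ : TangentSpace (𝓡 2) (q x))‖

theorem IsExpanding.injective_mfderiv {q : X → Y} (hq : IsExpanding q) (x : X) :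
    Function.Injective (mfderiv (𝓡 2) (𝓡 2) q x) := by
  refine (injective_iff_map_eq_zero _).2 fun ξ hξ => ?_
  have h := hq.norm_le x ξ
  rw [hξ] at h
  have h' : ‖ξ‖ ≤ 0 := h.trans (le_of_eq norm_zero)
  exact norm_le_zero_iff.1 h'

theorem IsExpanding.exists_openPartialHomeomorph {q : X → Y} (hq : IsExpanding q) (x : X) :
    ∃ f : OpenPartialHomeomorph X Y, x ∈ f.source ∧ EqOn q f f.source ∧
      ContMDiffOn (𝓡 2) (𝓡 2) 1 f.symm f.target :=
  exists_openPartialHomeomorph_of_injective_mfderiv le_rfl hq.contMDiff hq.injective_mfderiv x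

theorem IsExpanding.isLocalHomeomorph {q : X → Y} (hq : IsExpanding q) : IsLocalHomeomorph q :=
  IsLocalHomeomorph.mk q fun x =>
    let ⟨f, h1, h2, _⟩ := hq.exists_openPartialHomeomorph x
    ⟨f, h1, h2⟩

/-- A continuous lift of a `C¹` curve is `C¹`. -/
theorem IsExpanding.contMDiffOn_lift {q : X → Y} (hq : IsExpanding q) {γ : ℝ → Y} {Γ : ℝ → X}
    {s : Set ℝ} (hγ : ContMDiffOn 𝓘(ℝ, ℝ) (𝓡 2) 1 γ s) (hΓ : ContinuousOn Γ s)
    (h : EqOn (q ∘ Γ) γ s) : ContMDiffOn 𝓘(ℝ, ℝ) (𝓡 2) 1 Γ s := by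
  intro t ht
  obtain ⟨f, hf1, hf2, hf3⟩ := hq.exists_openPartialHomeomorph (Γ t)
  have hγt : γ t = f (Γ t) := by rw [← h ht, ← hf2 hf1]; rfl
  have hmem : γ t ∈ f.target := by rw [hγt]; exact f.map_source hf1
  have h1 : ContMDiffWithinAt 𝓘(ℝ, ℝ) (𝓡 2) 1 (f.symm ∘ γ) s t :=
    ((hf3 _ hmem).contMDiffAt (f.open_target.mem_nhds hmem)).comp_contMDiffWithinAt t (hγ t ht)
  have hloc : ∀ u ∈ s, Γ u ∈ f.source → Γ u = (f.symm ∘ γ) u := by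
    intro u hu hus
    rw [Function.comp_apply, ← h hu, Function.comp_apply, hf2 hus, f.left_inv hus]
  refine h1.congr_of_eventuallyEq ?_ (hloc t ht hf1)
  filter_upwards [self_mem_nhdsWithin, hΓ t ht (f.open_source.mem_nhds hf1)] with u hu hus
  exact hloc u hu hus

/-- Lifting under an expanding map does not increase the length. -/
theorem IsExpanding.pathELength_lift_le {q : X → Y} (hq : IsExpanding q) {γ : ℝ → Y} {Γ : ℝ → X}
    {a b : ℝ} (hγ : ContMDiffOn 𝓘(ℝ, ℝ) (𝓡 2) 1 γ (Icc a b)) (hΓ : ContinuousOn Γ (Icc a b))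
    (h : EqOn (q ∘ Γ) γ (Icc a b)) : pathELength (𝓡 2) Γ a b ≤ pathELength (𝓡 2) γ a b := by
  rw [pathELength_eq_lintegral_mfderiv_Ioo, pathELength_eq_lintegral_mfderiv_Ioo]
  refine MeasureTheory.setLIntegral_mono' measurableSet_Ioo fun t ht => ?_
  have hnhds : Icc a b ∈ 𝓝 t := Icc_mem_nhds ht.1 ht.2
  have h1 : MDifferentiableAt 𝓘(ℝ, ℝ) (𝓡 2) Γ t :=
    ((hq.contMDiffOn_lift hγ hΓ h t (Ioo_subset_Icc_self ht)).contMDiffAt hnhds).mdifferentiableAt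
      one_ne_zero
  have h2 : MDifferentiableAt (𝓡 2) (𝓡 2) q (Γ t) := (hq.contMDiff _).mdifferentiableAt one_ne_zero
  have heq : γ =ᶠ[𝓝 t] q ∘ Γ := by
    filter_upwards [hnhds] with u hu using (h hu).symm
  have h3 : mfderiv 𝓘(ℝ, ℝ) (𝓡 2) (q ∘ Γ) t 1 =
      mfderiv (𝓡 2) (𝓡 2) q (Γ t) (mfderiv 𝓘(ℝ, ℝ) (𝓡 2) Γ t 1) := by
    rw [mfderiv_comp t h2 h1]; rfl
  have hn : ‖mfderiv 𝓘(ℝ, ℝ) (𝓡 2) γ t 1‖ₑ = ‖mfderiv 𝓘(ℝ, ℝ) (𝓡 2) (q ∘ Γ) t 1‖ₑ := by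
    rw [← ofReal_norm, ← ofReal_norm]
    exact congrArg ENNReal.ofReal (norm_mfderiv_congr heq 1)
  rw [hn]
  have key := hq.norm_le (Γ t) (mfderiv 𝓘(ℝ, ℝ) (𝓡 2) Γ t 1)
  rw [← h3] at key
  exact enorm_le_iff_norm_le.2 key

/-- The distance between the endpoints of a lift is at most the length of the curve. -/
theorem IsExpanding.edist_lift_le [IsRiemannianManifold (𝓡 2) X] {q : X → Y} (hq : IsExpanding q)
    {γ : ℝ → Y} {Γ : ℝ → X} {a b : ℝ} (hab : a ≤ b)
    (hγ : ContMDiffOn 𝓘(ℝ, ℝ) (𝓡 2) 1 γ (Icc a b)) (hΓ : ContinuousOn Γ (Icc a b))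
    (h : EqOn (q ∘ Γ) γ (Icc a b)) : edist (Γ a) (Γ b) ≤ pathELength (𝓡 2) γ a b := by
  rw [IsRiemannianManifold.out (I := 𝓡 2) (Γ a) (Γ b)]
  exact (riemannianEDist_le_pathELength (hq.contMDiffOn_lift hγ hΓ h) rfl rfl hab).trans
    (hq.pathELength_lift_le hγ hΓ h)

/-- A `C¹` curve on `[a, b]` has bounded speed, so its length on subintervals is controlled. -/
theorem exists_pathELength_le
    [IsContinuousRiemannianBundle Plane (fun x : Y => TangentSpace (𝓡 2) x)]
    {γ : ℝ → Y} {a b : ℝ} (hab : a < b)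
    (hγ : ContMDiffOn 𝓘(ℝ, ℝ) (𝓡 2) 1 γ (Icc a b)) :
    ∃ C : ℝ, 0 ≤ C ∧ ∀ s ∈ Icc a b, ∀ t ∈ Icc a b, s ≤ t →
      pathELength (𝓡 2) γ s t ≤ ENNReal.ofReal (C * (t - s)) := by
  have huniq : UniqueMDiffOn 𝓘(ℝ, ℝ) (Icc a b) :=
    uniqueMDiffOn_iff_uniqueDiffOn.2 (uniqueDiffOn_Icc hab)
  have h1 := hγ.continuousOn_tangentMapWithin le_rfl huniq
  have h2 : ContinuousOn (fun t : ℝ => (⟨t, (1 : ℝ)⟩ : TangentBundle 𝓘(ℝ, ℝ) ℝ)) (Icc a b) := by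
    refine Continuous.continuousOn ?_
    have : Continuous ((tangentBundleModelSpaceHomeomorph 𝓘(ℝ, ℝ)).symm ∘
      fun t : ℝ => ((t, 1) : ModelProd ℝ ℝ)) :=
      (tangentBundleModelSpaceHomeomorph 𝓘(ℝ, ℝ)).symm.continuous.comp
        (Continuous.prodMk_left (1 : ℝ))
    exact this
  have h3 : ContinuousOn (fun t : ℝ => (⟨γ t, mfderivWithin 𝓘(ℝ, ℝ) (𝓡 2) γ (Icc a b) t (1 : ℝ)⟩ :
      TangentBundle (𝓡 2) Y)) (Icc a b) := h1.comp h2 fun t ht => ht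
  have h4 : ContinuousOn (fun t : ℝ => inner ℝ
      (mfderivWithin 𝓘(ℝ, ℝ) (𝓡 2) γ (Icc a b) t (1 : ℝ) : TangentSpace (𝓡 2) (γ t))
      (mfderivWithin 𝓘(ℝ, ℝ) (𝓡 2) γ (Icc a b) t (1 : ℝ) : TangentSpace (𝓡 2) (γ t)))
      (Icc a b) := h3.inner_bundle h3
  obtain ⟨D, hD⟩ := isCompact_Icc.bddAbove_image h4
  set C := Real.sqrt (max D 0)
  refine ⟨C, Real.sqrt_nonneg _, fun s hs t ht hst => ?_⟩
  rw [pathELength_eq_lintegral_mfderiv_Ioo]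
  have hb : ∀ u ∈ Ioo s t,
      ‖(mfderiv 𝓘(ℝ, ℝ) (𝓡 2) γ u (1 : ℝ) : TangentSpace (𝓡 2) (γ u))‖ₑ ≤ ENNReal.ofReal C := by
    intro u hu
    have hu' : u ∈ Ioo a b := ⟨hs.1.trans_lt hu.1, hu.2.trans_le ht.2⟩
    have h5 := hD ⟨u, Ioo_subset_Icc_self hu', rfl⟩
    simp only [mfderivWithin_of_mem_nhds (Icc_mem_nhds hu'.1 hu'.2)] at h5
    rw [← ofReal_norm]
    refine ENNReal.ofReal_le_ofReal (Real.le_sqrt_of_sq_le ?_)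
    rw [← real_inner_self_eq_norm_sq]
    exact h5.trans (le_max_left _ _)
  refine (MeasureTheory.setLIntegral_mono' measurableSet_Ioo hb).trans ?_
  rw [MeasureTheory.setLIntegral_const, Real.volume_Ioo, ENNReal.ofReal_mul (Real.sqrt_nonneg _)]

end Lifts

/-! ### Path lifting for expanding maps from a complete surface -/

section PathLifting

/-- A Lipschitz curve in a complete space has a limit at the end of its interval of definition. -/
theorem exists_tendsto_of_dist_le {X : Type*} [MetricSpace X] [CompleteSpace X] {f : ℝ → X}
    {a T C : ℝ} (haT : a < T)
    (hf : ∀ s ∈ Ioo a T, ∀ t ∈ Ioo a T, s ≤ t → dist (f s) (f t) ≤ C * (t - s)) :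
    ∃ L, Tendsto f (𝓝[<] T) (𝓝 L) := by
  have hf' : LipschitzOnWith (Real.toNNReal C) f (Ioo a T) := by
    refine LipschitzOnWith.of_dist_le_mul fun s hs t ht => ?_
    have hC : C ≤ (Real.toNNReal C : ℝ) := Real.le_coe_toNNReal C
    rcases le_total s t with h | h
    · refine (hf s hs t ht h).trans ?_
      rw [Real.dist_eq, abs_sub_comm, abs_of_nonneg (sub_nonneg.2 h)]
      exact mul_le_mul_of_nonneg_right hC (sub_nonneg.2 h)
    · rw [dist_comm]
      refine (hf t ht s hs h).trans ?_
      rw [Real.dist_eq, abs_of_nonneg (sub_nonneg.2 h)]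
      exact mul_le_mul_of_nonneg_right hC (sub_nonneg.2 h)
  have hc : Cauchy (map f (𝓝[<] T)) := by
    rw [← nhdsWithin_Ioo_eq_nhdsLT haT]
    have : (𝓝[Ioo a T] T).NeBot := by
      rw [nhdsWithin_Ioo_eq_nhdsLT haT]; infer_instance
    have h1 : Cauchy (𝓝[Ioo a T] T) := cauchy_nhds.mono nhdsWithin_le_nhds
    exact h1.map_of_le hf'.uniformContinuousOn inf_le_right
  exact CompleteSpace.complete hc

variable {X Y : Type*} [TopologicalSpace X] [TopologicalSpace Y]

/-- `Γ` lifts the curve `γ` through `q` on `[0, T]`, starting at `x₀`. -/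
def IsLiftOn (q : X → Y) (γ : ℝ → Y) (x₀ : X) (T : ℝ) (Γ : ℝ → X) : Prop :=
  ContinuousOn Γ (Icc 0 T) ∧ Γ 0 = x₀ ∧ EqOn (q ∘ Γ) γ (Icc 0 T)

variable {q : X → Y} {γ : ℝ → Y} {x₀ : X}

theorem IsLiftOn.mono {T T' : ℝ} {Γ : ℝ → X} (h : IsLiftOn q γ x₀ T Γ) (hT : T' ≤ T) :
    IsLiftOn q γ x₀ T' Γ :=
  ⟨h.1.mono (Icc_subset_Icc_right hT), h.2.1, h.2.2.mono (Icc_subset_Icc_right hT)⟩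

/-- A lift can be continued by a local section. -/
theorem IsLiftOn.extend {T T' : ℝ} {Γ : ℝ → X} (h : IsLiftOn q γ x₀ T Γ) (hT : 0 ≤ T)
    (hγ : ContinuousOn γ (Icc T T')) {U : Set Y} {S : Y → X} (hS : ContinuousOn S U)
    (hU : MapsTo γ (Icc T T') U) (hST : S (γ T) = Γ T) (hqS : ∀ y ∈ U, q (S y) = y) :
    ∃ Γ', IsLiftOn q γ x₀ T' Γ' := by
  classical
  rcases le_or_gt T' T with hTT | hTT
  · exact ⟨Γ, h.mono hTT⟩
  refine ⟨fun t => if t ≤ T then Γ t else S (γ t), ?_, ?_, ?_⟩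
  · refine ContinuousOn.if ?_ ?_ ?_
    · rintro t ⟨ht, ht'⟩
      have : t = T := by
        have := frontier_Iic_subset T ht'
        simpa using this
      rw [this, hST]
    · refine h.1.mono ?_
      rintro t ⟨ht, ht'⟩
      have : t ≤ T := by
        have h2 : closure {t | t ≤ T} = Iic T := isClosed_Iic.closure_eq
        rw [h2] at ht'; exact ht'
      exact ⟨ht.1, this⟩
    · have h2 : closure {t | ¬ t ≤ T} ⊆ Ici T := by
        refine closure_minimal (fun t ht => (not_le.1 ht).le) isClosed_Ici
      have h3 : Icc 0 T' ∩ closure {t | ¬ t ≤ T} ⊆ Icc T T' := fun t ht => ⟨h2 ht.2, ht.1.2⟩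
      exact (hS.comp hγ hU).mono h3
  · simp [hT, h.2.1]
  · intro t ht
    simp only [Function.comp_apply]
    split_ifs with h1
    · exact h.2.2 ⟨ht.1, h1⟩
    · exact hqS _ (hU ⟨(not_le.1 h1).le, ht.2⟩)

/-- Two lifts with the same starting point agree. -/
theorem IsLiftOn.eqOn [T2Space X] (hq : IsLocalHomeomorph q) {T : ℝ} {Γ Γ' : ℝ → X}
    (h : IsLiftOn q γ x₀ T Γ) (h' : IsLiftOn q γ x₀ T Γ') : EqOn Γ Γ' (Icc 0 T) := by
  rcases lt_or_ge T 0 with hT | hT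
  · simp [Icc_eq_empty (not_le.2 hT)]
  · have hsep : IsSeparatedMap q := T2Space.isSeparatedMap q
    exact hsep.eqOn_of_comp_eqOn hq.isLocallyInjective isPreconnected_Icc h.1 h'.1
      (h.2.2.trans h'.2.2.symm) (left_mem_Icc.2 hT) (h.2.1.trans h'.2.1.symm)

/-- If every initial lift of a continuous curve can be closed up, then the curve lifts. -/
theorem exists_isLiftOn_one (hq : IsLocalHomeomorph q)
    (hγ : ContinuousOn γ (Icc 0 1)) (h0 : q x₀ = γ 0)
    (hclose : ∀ T ∈ Ioc (0 : ℝ) 1, (∀ T' ∈ Ico 0 T, ∃ Γ, IsLiftOn q γ x₀ T' Γ) →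
      ∃ Γ, IsLiftOn q γ x₀ T Γ) :
    ∃ Γ, IsLiftOn q γ x₀ 1 Γ := by
  -- The times up to which `γ` lifts form a set that is closed, by `hclose`, and that contains the
  -- times slightly beyond any of its elements, because `q` has local inverses.
  let S : Set ℝ := {T | ∃ Γ, IsLiftOn q γ x₀ T Γ}
  have hS0 : (0 : ℝ) ∈ S := by
    refine ⟨fun _ => x₀, continuousOn_const, rfl, fun t ht => ?_⟩
    have : t = 0 := le_antisymm ht.2 ht.1
    simp [this, h0]
  have hmono : ∀ T ∈ S, ∀ T' ≤ T, T' ∈ S := fun T ⟨Γ, h⟩ T' hT => ⟨Γ, h.mono hT⟩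
  suffices Icc (0 : ℝ) 1 ⊆ S from this (right_mem_Icc.2 zero_le_one)
  refine IsClosed.Icc_subset_of_forall_exists_gt ?_ hS0 ?_
  · refine isClosed_of_closure_subset fun T hT => ?_
    have hT01 : T ∈ Icc (0 : ℝ) 1 :=
      closure_minimal inter_subset_right isClosed_Icc hT
    refine ⟨?_, hT01⟩
    rcases hT01.1.eq_or_lt with h | h
    · rw [← h]; exact hS0
    · refine hclose T ⟨h, hT01.2⟩ fun T' hT' => ?_
      obtain ⟨T'', h1, h2⟩ := mem_closure_iff.1 hT (Ioi T') isOpen_Ioi hT'.2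
      exact hmono T'' h2.1 T' (le_of_lt h1)
  · rintro T ⟨⟨Γ, hΓ⟩, hT⟩ T₁ hT₁
    obtain ⟨f, hf1, hf2⟩ := hq (Γ T)
    have hγT : γ T = f (Γ T) := by
      rw [← hΓ.2.2 (right_mem_Icc.2 hT.1)]; exact congrFun hf2 _
    have hmem : γ T ∈ f.target := by rw [hγT]; exact f.map_source hf1
    have hev : ∀ᶠ t in 𝓝[Icc 0 1] T, γ t ∈ f.target :=
      hγ T ⟨hT.1, hT.2.le⟩ (f.open_target.mem_nhds hmem)
    obtain ⟨ε, hε, hεs⟩ := Metric.mem_nhdsWithin_iff.1 hev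
    set T₂ := min T₁ (min 1 (T + ε / 2))
    have hT₂ : T < T₂ := lt_min hT₁ (lt_min hT.2 (by linarith))
    have hT₂1 : T₂ ≤ 1 := (min_le_right _ _).trans (min_le_left _ _)
    have hT₂ε : T₂ ≤ T + ε / 2 := (min_le_right _ _).trans (min_le_right _ _)
    refine ⟨T₂, ?_, hT₂, min_le_left _ _⟩
    refine hΓ.extend hT.1 (hγ.mono (Icc_subset_Icc hT.1 hT₂1)) f.continuousOn_symm
      (fun t ht => hεs ⟨?_, ⟨hT.1.trans ht.1, ht.2.trans hT₂1⟩⟩) ?_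
      (fun y hy => by rw [hf2]; exact f.right_inv hy)
    · rw [Metric.mem_ball, Real.dist_eq, abs_of_nonneg (by linarith [ht.1])]
      linarith [ht.2]
    · rw [hγT]; exact f.left_inv hf1

/-- `q` has continuous local sections, over neighbourhoods that do not depend on the preimage. -/
def HasUniformSections (q : X → Y) : Prop :=
  ∀ y : Y, ∃ U : Set Y, IsOpen U ∧ y ∈ U ∧ ∀ x, q x ∈ U →
    ∃ S : Y → X, ContinuousOn S U ∧ S (q x) = x ∧ ∀ u ∈ U, q (S u) = u

/-- A lift on `[0, T']`, for `T'` close to `T`, is continued to `T` by the section through its end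
point over a neighbourhood of `γ T`. -/
theorem HasUniformSections.exists_isLiftOn (hs : HasUniformSections q) (hq : IsLocalHomeomorph q)
    (hγ : ContinuousOn γ (Icc 0 1)) (h0 : q x₀ = γ 0) : ∃ Γ, IsLiftOn q γ x₀ 1 Γ := by
  refine exists_isLiftOn_one hq hγ h0 fun T hT h => ?_
  obtain ⟨U, hUo, hTU, hU⟩ := hs (γ T)
  have hev : ∀ᶠ t in 𝓝[Icc 0 1] T, γ t ∈ U := hγ T ⟨hT.1.le, hT.2⟩ (hUo.mem_nhds hTU)
  obtain ⟨ε, hε, hεs⟩ := Metric.mem_nhdsWithin_iff.1 hev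
  set T' := max 0 (T - ε / 2)
  have hT'0 : 0 ≤ T' := le_max_left _ _
  have hT'T : T' < T := max_lt hT.1 (by linarith)
  have hT'ε : T - ε / 2 ≤ T' := le_max_right _ _
  have hmaps : MapsTo γ (Icc T' T) U := fun t ht => by
    refine hεs ⟨?_, ⟨hT'0.trans ht.1, ht.2.trans hT.2⟩⟩
    rw [Metric.mem_ball, Real.dist_eq, abs_sub_comm, abs_of_nonneg (by linarith [ht.2])]
    linarith [ht.1]
  obtain ⟨Γ, hΓ⟩ := h T' ⟨hT'0, hT'T⟩
  have hqΓ : q (Γ T') = γ T' := hΓ.2.2 (right_mem_Icc.2 hT'0)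
  obtain ⟨S, hS1, hS2, hS3⟩ := hU (Γ T') (by rw [hqΓ]; exact hmaps (left_mem_Icc.2 hT'T.le))
  exact hΓ.extend hT'0 (hγ.mono (Icc_subset_Icc hT'0 hT.2)) hS1 hmaps (by rw [← hqΓ, hS2]) hS3

/-- Lifts of homotopic paths have the same endpoint. -/
theorem HasUniformSections.lift_one_eq [T2Space X] (hs : HasUniformSections q)
    (hq : IsLocalHomeomorph q) {γ₀ γ₁ : C(unitInterval, Y)} (H : γ₀.HomotopyRel γ₁ {0, 1})
    {Γ₀ Γ₁ : ℝ → X} (h₀ : IsLiftOn q (γ₀ ∘ projIcc 0 1 zero_le_one) x₀ 1 Γ₀)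
    (h₁ : IsLiftOn q (γ₁ ∘ projIcc 0 1 zero_le_one) x₀ 1 Γ₁) : Γ₀ 1 = Γ₁ 1 := by
  have hx : q x₀ = γ₀ 0 := by
    have := h₀.2.2 (left_mem_Icc.2 zero_le_one)
    simpa [h₀.2.1] using this
  -- Every stage of the homotopy lifts, so the monodromy theorem applies.
  have hlift : ∀ t : unitInterval, ∃ Γ,
      IsLiftOn q ((fun s => H (t, s)) ∘ projIcc 0 1 zero_le_one) x₀ 1 Γ := fun t => by
    refine hs.exists_isLiftOn hq ?_ ?_
    · refine Continuous.continuousOn ?_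
      have : Continuous fun s : unitInterval => H (t, s) := by fun_prop
      exact this.comp continuous_projIcc
    · rw [hx]
      have : H (t, 0) = γ₀ 0 := H.eq_fst t (by simp)
      simpa using this.symm
  choose Γ hΓ using hlift
  have hmono := IsLocalHomeomorph.monodromy_theorem hq (T2Space.isSeparatedMap q) H
    (fun t => ⟨fun s : unitInterval => Γ t s, (hΓ t).1.comp_continuous continuous_subtype_val
      fun s => s.2⟩)
    (fun t s => by simpa using (hΓ t).2.2 s.2)
    (fun t => by simp [(hΓ t).2.1, (hΓ 0).2.1]) 1
  have e0 : Γ₀ 1 = Γ 0 1 := by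
    refine IsLiftOn.eqOn hq h₀ ⟨(hΓ 0).1, (hΓ 0).2.1, fun s hs => ?_⟩ (right_mem_Icc.2 zero_le_one)
    rw [(hΓ 0).2.2 hs]; simp
  have e1 : Γ₁ 1 = Γ 1 1 := by
    refine IsLiftOn.eqOn hq h₁ ⟨(hΓ 1).1, (hΓ 1).2.1, fun s hs => ?_⟩ (right_mem_Icc.2 zero_le_one)
    rw [(hΓ 1).2.2 hs]; simp
  rw [e0, e1]
  simpa using hmono.symm

end PathLifting

section Expanding

variable {X Y : Type*} [MetricSpace X] [ChartedSpace Plane X] [IsManifold (𝓡 2) 1 X]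
  [RiemannianBundle (fun x : X => TangentSpace (𝓡 2) x)] [IsRiemannianManifold (𝓡 2) X]
  [MetricSpace Y] [ChartedSpace Plane Y] [IsManifold (𝓡 2) 1 Y]
  [RiemannianBundle (fun x : Y => TangentSpace (𝓡 2) x)]
  [IsContinuousRiemannianBundle Plane (fun x : Y => TangentSpace (𝓡 2) x)]

/-- Through an expanding map from a complete surface, `C¹` curves lift: a lift on `[0, T)` is
Lipschitz, because it is not longer than the curve. -/
theorem IsExpanding.exists_isLiftOn [CompleteSpace X] {q : X → Y} (hq : IsExpanding q) {γ : ℝ → Y}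
    (hγ : ContMDiffOn 𝓘(ℝ, ℝ) (𝓡 2) 1 γ (Icc 0 1)) {x₀ : X} (h0 : q x₀ = γ 0) :
    ∃ Γ, IsLiftOn q γ x₀ 1 Γ := by
  classical
  have hqh := hq.isLocalHomeomorph
  refine exists_isLiftOn_one hqh hγ.continuousOn h0 fun T hT h => ?_
  obtain ⟨C, hC0, hC⟩ := exists_pathELength_le zero_lt_one hγ
  have : Nonempty X := ⟨x₀⟩
  choose! G hG using h
  -- The lifts on `[0, T']`, `T' < T`, agree where they are both defined; they form one lift on
  -- `[0, T)`.
  let Γ : ℝ → X := fun t => G t t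
  have hΓG : ∀ T' ∈ Ico 0 T, ∀ t ∈ Icc 0 T', Γ t = G T' t := by
    intro T' hT' t ht
    exact IsLiftOn.eqOn hqh (hG t ⟨ht.1, ht.2.trans_lt hT'.2⟩) ((hG T' hT').mono ht.2)
      (right_mem_Icc.2 ht.1)
  have hqΓ : ∀ t ∈ Ico 0 T, q (Γ t) = γ t := fun t ht =>
    (hG t ht).2.2 (right_mem_Icc.2 ht.1)
  have hLip : ∀ s ∈ Ioo 0 T, ∀ t ∈ Ioo 0 T, s ≤ t → dist (Γ s) (Γ t) ≤ C * (t - s) := by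
    intro s hs t ht hst
    have ht' : t ∈ Ico 0 T := ⟨ht.1.le, ht.2⟩
    have hsub : Icc s t ⊆ Icc 0 t := Icc_subset_Icc_left hs.1.le
    have h1 := hq.edist_lift_le hst
      (hγ.mono (Icc_subset_Icc hs.1.le (ht.2.le.trans hT.2)))
      ((hG t ht').1.mono hsub) ((hG t ht').2.2.mono hsub)
    have h2 := h1.trans (hC s ⟨hs.1.le, hs.2.le.trans hT.2⟩ t ⟨ht.1.le, ht.2.le.trans hT.2⟩ hst)
    rw [← hΓG t ht' s ⟨hs.1.le, hst⟩] at h2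
    rw [edist_dist] at h2
    exact (ENNReal.ofReal_le_ofReal_iff (mul_nonneg hC0 (sub_nonneg.2 hst))).1 h2
  -- The value to be given to the lift at time `T`.
  obtain ⟨L, hL⟩ := exists_tendsto_of_dist_le hT.1 hLip
  have hcont : ContinuousOn Γ (Ico 0 T) := by
    intro t ht
    obtain ⟨t', ht1, ht2⟩ := exists_between ht.2
    have ht' : t' ∈ Ico 0 T := ⟨ht.1.trans ht1.le, ht2⟩
    have h1 : ContinuousWithinAt (G t') (Icc 0 t') t := (hG t' ht').1 t ⟨ht.1, ht1.le⟩
    have h2 : ContinuousWithinAt Γ (Icc 0 t') t :=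
      h1.congr (fun u hu => hΓG t' ht' u hu) (hΓG t' ht' t ⟨ht.1, ht1.le⟩)
    refine h2.mono_of_mem_nhdsWithin ?_
    rw [mem_nhdsWithin]
    exact ⟨Iio t', isOpen_Iio, ht1, fun u hu => ⟨hu.2.1, le_of_lt hu.1⟩⟩
  have hqL : q L = γ T := by
    have h1 : Tendsto (q ∘ Γ) (𝓝[<] T) (𝓝 (q L)) := (hqh.continuous.tendsto L).comp hL
    have h2 : Tendsto γ (𝓝[Ioo 0 T] T) (𝓝 (γ T)) :=
      (hγ.continuousOn T ⟨hT.1.le, hT.2⟩).mono_left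
        (nhdsWithin_mono _ fun t ht => ⟨ht.1.le, ht.2.le.trans hT.2⟩)
    rw [← nhdsWithin_Ioo_eq_nhdsLT hT.1] at h1
    have : (𝓝[Ioo 0 T] T).NeBot := by
      rw [nhdsWithin_Ioo_eq_nhdsLT hT.1]; infer_instance
    refine tendsto_nhds_unique h1 (h2.congr' ?_)
    filter_upwards [self_mem_nhdsWithin] with t ht
    exact (hqΓ t ⟨ht.1.le, ht.2⟩).symm
  refine ⟨Function.update Γ T L, ?_, ?_, ?_⟩
  · have hsdiff : Icc 0 T \ {T} = Ico 0 T := by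
      ext u; simp only [Set.mem_sdiff, mem_Icc, mem_singleton_iff, mem_Ico]; grind
    intro t ht
    rcases ht.2.eq_or_lt with h | h
    · subst h
      rw [continuousWithinAt_update_same, hsdiff]
      exact hL.mono_left (nhdsWithin_mono _ fun u hu => hu.2)
    · rw [continuousWithinAt_update_of_ne h.ne]
      have := hcont t ⟨ht.1, h⟩
      refine this.mono_of_mem_nhdsWithin ?_
      rw [mem_nhdsWithin]
      exact ⟨Iio T, isOpen_Iio, h, fun u hu => ⟨hu.2.1, hu.1⟩⟩
  · rw [Function.update_of_ne hT.1.ne]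
    exact (hG 0 ⟨le_rfl, hT.1⟩).2.1
  · intro t ht
    rcases ht.2.eq_or_lt with h | h
    · subst h; simp [hqL]
    · rw [Function.comp_apply, Function.update_of_ne h.ne]; exact hqΓ t ⟨ht.1, h⟩

/-- An expanding map from a complete surface has sections over chart balls, obtained by lifting the
segments that emanate from a given point. -/
theorem IsExpanding.hasUniformSections [CompleteSpace X] {q : X → Y} (hq : IsExpanding q) :
    HasUniformSections q := by
  classical
  have hqh := hq.isLocalHomeomorph
  intro y
  set e := chartAt Plane y
  obtain ⟨ρ, hρ, hρe⟩ := Metric.isOpen_iff.1 e.open_target (e y) (mem_chart_target Plane y)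
  let U : Set Y := e.source ∩ e ⁻¹' Metric.ball (e y) ρ
  have hUo : IsOpen U := e.isOpen_inter_preimage Metric.isOpen_ball
  refine ⟨U, hUo, ⟨mem_chart_source _ y, Metric.mem_ball_self hρ⟩, fun x hx => ?_⟩
  have hseg : ∀ u ∈ U, ∀ t ∈ Icc (0 : ℝ) 1,
      AffineMap.lineMap (e (q x)) (e u) t ∈ Metric.ball (e y) ρ := fun u hu t ht =>
    (convex_ball (e y) ρ).lineMap_mem hx.2 hu.2 ht
  -- `σ u` is the segment from `q x` to `u` in the chart; the section maps `u` to the end of the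
  -- lift of `σ u` from `x`.
  let σ : Y → ℝ → Y := fun u t => e.symm (AffineMap.lineMap (e (q x)) (e u) t)
  have hσ0 : ∀ u, σ u 0 = q x := fun u => by simp [σ, e.left_inv hx.1]
  have hσ1 : ∀ u ∈ U, σ u 1 = u := fun u hu => by simp [σ, e.left_inv hu.1]
  have hσd : ∀ u ∈ U, ContMDiffOn 𝓘(ℝ, ℝ) (𝓡 2) 1 (σ u) (Icc 0 1) := fun u hu => by
    have h1 : ContMDiffOn 𝓘(ℝ, ℝ) (𝓡 2) 1
        (fun t : ℝ => AffineMap.lineMap (e (q x)) (e u) t) (Icc 0 1) := by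
      refine ContMDiff.contMDiffOn (contMDiff_iff_contDiff.2 ?_)
      exact (ContinuousAffineMap.lineMap (R := ℝ) (e (q x)) (e u)).contDiff
    exact (contMDiffOn_symm_of_mem_maximalAtlas
      (IsManifold.chart_mem_maximalAtlas y)).comp h1 fun t ht => hρe (hseg u hu t ht)
  have hlift : ∀ u ∈ U, ∃ Γ, IsLiftOn q (σ u) x 1 Γ := fun u hu =>
    hq.exists_isLiftOn (hσd u hu) (hσ0 u).symm
  have : Nonempty X := ⟨x⟩
  choose! Γ hΓ using hlift
  refine ⟨fun u => Γ u 1, ?_, ?_, fun u hu => ?_⟩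
  · -- Joint continuity of the lifted segments.
    let f : C(unitInterval × U, Y) := ⟨fun tu => σ tu.2 tu.1, by
      have h1 : Continuous fun tu : unitInterval × U =>
          AffineMap.lineMap (e (q x)) (e (tu.2 : Y)) (tu.1 : ℝ) := by
        have h2 : Continuous fun u : U => e (u : Y) :=
          e.continuousOn.comp_continuous continuous_subtype_val fun u => u.2.1
        have h3 : Continuous fun tu : unitInterval × U => e (tu.2 : Y) := h2.comp continuous_snd
        have h4 : Continuous fun tu : unitInterval × U => (tu.1 : ℝ) :=
          continuous_subtype_val.comp continuous_fst
        simp only [AffineMap.lineMap_apply]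
        exact (h4.smul (h3.sub continuous_const)).add continuous_const
      exact e.continuousOn_symm.comp_continuous h1 fun tu => hρe (hseg _ tu.2.2 _ tu.1.2)⟩
    have hc := hqh.continuous_lift (T2Space.isSeparatedMap q) f
      (g := fun tu : unitInterval × U => Γ (tu.2 : Y) (tu.1 : ℝ))
      (by ext tu; exact (hΓ _ tu.2.2).2.2 tu.1.2)
      (by
        have : (fun u : U => Γ (u : Y) ((0 : unitInterval) : ℝ)) = fun _ => x := by
          funext u; exact (hΓ _ u.2).2.1
        exact this ▸ continuous_const)
      (fun u => (hΓ _ u.2).1.comp_continuous continuous_subtype_val fun s => s.2)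
    rw [continuousOn_iff_continuous_domRestrict]
    exact hc.comp (g := fun tu : unitInterval × U => Γ (tu.2 : Y) (tu.1 : ℝ))
      (f := fun u : U => ((1 : unitInterval), u)) (by fun_prop)
  · -- The segment `σ (q x)` is constant, and so is its lift.
    have hconst : IsLiftOn q (σ (q x)) x 1 fun _ => x :=
      ⟨continuousOn_const, rfl, fun t ht => by simp [σ, e.left_inv hx.1]⟩
    exact IsLiftOn.eqOn hqh (hΓ _ hx) hconst (right_mem_Icc.2 zero_le_one)
  · have := (hΓ u hu).2.2 (right_mem_Icc.2 zero_le_one)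
    exact this.trans (hσ1 u hu)

end Expanding

/-! ### Calculus in the coordinate plane -/

section PartialDeriv

/-- The standard basis vector `∂_i` of the plane. -/
abbrev basisVec (i : Fin 2) : Plane := EuclideanSpace.single i 1

theorem plane_eq_sum (v : Plane) : v = ∑ i, v i • basisVec i := by
  ext k; fin_cases k <;> simp [Fin.sum_univ_two]

theorem fderiv_apply_eq_sum (f : Plane → ℝ) (x v : Plane) :
    fderiv ℝ f x v = ∑ i, partialDeriv i f x * v i := by
  conv_lhs => rw [plane_eq_sum v]
  simp only [map_sum, map_smul, partialDeriv, smul_eq_mul, mul_comm]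

theorem hasDerivAt_comp_plane {f : Plane → ℝ} {x : ℝ → Plane} {y : Plane} {s : ℝ}
    (hf : DifferentiableAt ℝ f (x s)) (hx : HasDerivAt x y s) :
    HasDerivAt (fun σ => f (x σ)) (∑ i, partialDeriv i f (x s) * y i) s := by
  rw [← fderiv_apply_eq_sum]
  exact hf.hasFDerivAt.comp_hasDerivAt s hx

theorem hasDerivAt_apply {x : ℝ → Plane} {y : Plane} {s : ℝ} (hx : HasDerivAt x y s) (k : Fin 2) :
    HasDerivAt (fun σ => x σ k) (y k) s :=
  (EuclideanSpace.proj k : Plane →L[ℝ] ℝ).hasFDerivAt.comp_hasDerivAt s hx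

theorem hasDerivAt_plane {x : ℝ → Plane} {y : Plane} {s : ℝ}
    (h : ∀ k, HasDerivAt (fun σ => x σ k) (y k) s) : HasDerivAt x y s := by
  rw [hasDerivAt_iff_hasFDerivAt, ← hasFDerivWithinAt_univ, hasFDerivWithinAt_euclidean]
  intro k
  rw [hasFDerivWithinAt_univ]
  exact (h k).hasFDerivAt.congr_fderiv (by ext; simp)

theorem partialDeriv_congr {f f' : Plane → ℝ} {x : Plane} (h : f =ᶠ[𝓝 x] f') (i : Fin 2) :
    partialDeriv i f x = partialDeriv i f' x := by
  rw [partialDeriv, partialDeriv, h.fderiv_eq]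

theorem partialDeriv_mul {f f' : Plane → ℝ} {x : Plane} (hf : DifferentiableAt ℝ f x)
    (hf' : DifferentiableAt ℝ f' x) (i : Fin 2) :
    partialDeriv i (fun z => f z * f' z) x =
      partialDeriv i f x * f' x + f x * partialDeriv i f' x := by
  rw [partialDeriv, fderiv_fun_mul hf hf']
  simp [partialDeriv]; ring

theorem partialDeriv_sum {ι : Type*} (u : Finset ι) {f : ι → Plane → ℝ} {x : Plane}
    (hf : ∀ j ∈ u, DifferentiableAt ℝ (f j) x) (i : Fin 2) :
    partialDeriv i (fun z => ∑ j ∈ u, f j z) x = ∑ j ∈ u, partialDeriv i (f j) x := by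
  rw [partialDeriv, fderiv_fun_sum hf]
  simp [partialDeriv]

theorem partialDeriv_add {f f' : Plane → ℝ} {x : Plane} (hf : DifferentiableAt ℝ f x)
    (hf' : DifferentiableAt ℝ f' x) (i : Fin 2) :
    partialDeriv i (fun z => f z + f' z) x = partialDeriv i f x + partialDeriv i f' x := by
  rw [partialDeriv, fderiv_fun_add hf hf']
  simp [partialDeriv]

theorem contDiffAt_partialDeriv {f : Plane → ℝ} {x : Plane} (hf : ContDiffAt ℝ ∞ f x)
    (i : Fin 2) : ContDiffAt ℝ ∞ (partialDeriv i f) x :=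
  (hf.fderiv_right (m := ∞) (by simp)).clm_apply contDiffAt_const

theorem partialDeriv_comm {f : Plane → ℝ} {x : Plane} (hf : ContDiffAt ℝ ∞ f x) (i j : Fin 2) :
    partialDeriv i (partialDeriv j f) x = partialDeriv j (partialDeriv i f) x := by
  have hd : DifferentiableAt ℝ (fderiv ℝ f) x :=
    (hf.fderiv_right (m := ∞) (by simp)).differentiableAt (by simp)
  have key : ∀ i j, partialDeriv i (partialDeriv j f) x =
      fderiv ℝ (fderiv ℝ f) x (basisVec i) (basisVec j) := by
    intro i j
    change fderiv ℝ (fun z => fderiv ℝ f z (basisVec j)) x (basisVec i) = _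
    rw [fderiv_clm_apply hd (differentiableAt_const _)]
    simp
  rw [key, key]
  exact hf.isSymmSndFDerivAt (by simpa using ENat.LEInfty.out) _ _

end PartialDeriv

/-! ### Metrics in coordinates: Christoffel symbols and curvature -/

section CoordMetric

/-- `g` is a smooth Riemannian metric on the open set `V` of the plane. -/
structure IsCoordMetric (g : Plane → Matrix (Fin 2) (Fin 2) ℝ) (V : Set Plane) : Prop where
  isOpen : IsOpen V
  smooth : ∀ y ∈ V, ∀ i j, ContDiffAt ℝ ∞ (fun z => g z i j) y
  symm : ∀ y i j, g y i j = g y j i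
  pos : ∀ y ∈ V, ∀ a : Plane, a ≠ 0 → 0 < ∑ i, ∑ j, g y i j * a i * a j

variable {g : Plane → Matrix (Fin 2) (Fin 2) ℝ} {V : Set Plane}

/-- The bilinear form of the metric `g` at `y`. -/
def metricForm (g : Plane → Matrix (Fin 2) (Fin 2) ℝ) (y a b : Plane) : ℝ :=
  ∑ i, ∑ j, g y i j * a i * b j

theorem IsCoordMetric.metricForm_nonneg (hg : IsCoordMetric g V) {y : Plane} (hy : y ∈ V)
    (a : Plane) : 0 ≤ metricForm g y a a := by
  rcases eq_or_ne a 0 with rfl | h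
  · simp [metricForm]
  · exact (hg.pos y hy a h).le

theorem IsCoordMetric.det_pos (hg : IsCoordMetric g V) {y : Plane} (hy : y ∈ V) :
    0 < (g y).det := by
  rw [Matrix.det_fin_two]
  have h0 := hg.pos y hy (basisVec 0) (by simp)
  simp only [Fin.sum_univ_two, PiLp.single_apply] at h0
  simp at h0
  have h1 := hg.pos y hy (!₂[-(g y 0 1), g y 0 0]) (by
    intro h; have := congrArg (fun v : Plane => v 1) h; simp at this; exact h0.ne' this)
  simp only [Fin.sum_univ_two] at h1
  simp at h1
  have hs := hg.symm y 1 0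
  rw [hs] at h1 ⊢
  have : 0 < g y 0 0 * (g y 0 0 * g y 1 1 - g y 0 1 * g y 0 1) := by linarith [h1]
  exact (pos_iff_pos_of_mul_pos this).1 h0

/-- The Cauchy-Schwarz inequality for a metric in coordinates. -/
theorem IsCoordMetric.sq_metricForm_le (hg : IsCoordMetric g V) {y : Plane} (hy : y ∈ V)
    (a b : Plane) : metricForm g y a b ^ 2 ≤ metricForm g y a a * metricForm g y b b := by
  have hd := hg.det_pos hy
  rw [Matrix.det_fin_two] at hd
  have hs := hg.symm y 1 0
  have : metricForm g y a a * metricForm g y b b - metricForm g y a b ^ 2 =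
      (g y 0 0 * g y 1 1 - g y 0 1 * g y 1 0) * (a 0 * b 1 - a 1 * b 0) ^ 2 := by
    simp only [metricForm, Fin.sum_univ_two]; rw [hs]; ring
  nlinarith [mul_nonneg hd.le (sq_nonneg (a 0 * b 1 - a 1 * b 0))]

theorem IsCoordMetric.sum_mul_inv (hg : IsCoordMetric g V) {y : Plane} (hy : y ∈ V) (m l : Fin 2) :
    ∑ k, g y m k * (g y)⁻¹ k l = if m = l then 1 else 0 := by
  have h := Matrix.mul_nonsing_inv (g y) (isUnit_iff_ne_zero.2 (hg.det_pos hy).ne')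
  have := congrFun (congrFun h m) l
  rwa [Matrix.mul_apply, Matrix.one_apply] at this

/-- The Christoffel symbols with lowered index. -/
theorem IsCoordMetric.sum_mul_christoffel (hg : IsCoordMetric g V) {y : Plane} (hy : y ∈ V)
    (m i j : Fin 2) : ∑ k, g y m k * christoffel g k i j y =
      (1 / 2) * (partialDeriv i (fun z => g z j m) y + partialDeriv j (fun z => g z i m) y
        - partialDeriv m (fun z => g z i j) y) := by
  have h0 := hg.sum_mul_inv hy m 0
  have h1 := hg.sum_mul_inv hy m 1
  simp only [christoffel, Fin.sum_univ_two] at h0 h1 ⊢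
  set A0 := partialDeriv i (fun z => g z j 0) y + partialDeriv j (fun z => g z i 0) y
        - partialDeriv 0 (fun z => g z i j) y with hA0
  set A1 := partialDeriv i (fun z => g z j 1) y + partialDeriv j (fun z => g z i 1) y
        - partialDeriv 1 (fun z => g z i j) y with hA1
  have : g y m 0 * (1 / 2 * ((g y)⁻¹ 0 0 * A0 + (g y)⁻¹ 0 1 * A1)) +
      g y m 1 * (1 / 2 * ((g y)⁻¹ 1 0 * A0 + (g y)⁻¹ 1 1 * A1)) =
      1 / 2 * ((if m = 0 then 1 else 0) * A0 + (if m = 1 then 1 else 0) * A1) := by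
    rw [← h0, ← h1]; ring
  rw [this, hA0, hA1]
  fin_cases m <;> simp

theorem IsCoordMetric.christoffel_symm (hg : IsCoordMetric g V) (k i j : Fin 2) (y : Plane) :
    christoffel g k i j y = christoffel g k j i y := by
  have h : ∀ l, partialDeriv l (fun z => g z i j) y = partialDeriv l (fun z => g z j i) y := by
    intro l
    have : (fun z => g z i j) = fun z => g z j i := funext fun z => hg.symm z i j
    rw [this]
  simp only [christoffel, h]
  congr 1
  refine Finset.sum_congr rfl fun l _ => ?_
  ring

/-- Compatibility of the Levi-Civita connection with the metric. -/
theorem IsCoordMetric.partialDeriv_eq (hg : IsCoordMetric g V) {y : Plane} (hy : y ∈ V)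
    (k i j : Fin 2) : partialDeriv k (fun z => g z i j) y =
      ∑ l, (g y j l * christoffel g l k i y + g y i l * christoffel g l k j y) := by
  have hs : ∀ a b c, partialDeriv a (fun z => g z b c) y = partialDeriv a (fun z => g z c b) y := by
    intro a b c
    have : (fun z => g z b c) = fun z => g z c b := funext fun z => hg.symm z b c
    rw [this]
  rw [Finset.sum_add_distrib, hg.sum_mul_christoffel hy, hg.sum_mul_christoffel hy]
  rw [hs k j i, hs j k i, hs i k j]
  ring

theorem IsCoordMetric.contDiffAt_inv (hg : IsCoordMetric g V) {y : Plane} (hy : y ∈ V)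
    (i j : Fin 2) : ContDiffAt ℝ ∞ (fun z => (g z)⁻¹ i j) y := by
  have h : ∀ z, (g z)⁻¹ i j = (g z 0 0 * g z 1 1 - g z 0 1 * g z 1 0)⁻¹ *
      (!![g z 1 1, -g z 0 1; -g z 1 0, g z 0 0] i j) := by
    intro z
    rw [Matrix.inv_def, Matrix.adjugate_fin_two, Matrix.det_fin_two, Ring.inverse_eq_inv',
      Matrix.smul_apply, smul_eq_mul]
  simp only [h]
  have hs := hg.smooth y hy
  have hd := (hg.det_pos hy).ne'
  rw [Matrix.det_fin_two] at hd
  refine ContDiffAt.mul (ContDiffAt.inv ?_ hd) ?_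
  · exact ((hs 0 0).mul (hs 1 1)).sub ((hs 0 1).mul (hs 1 0))
  · fin_cases i <;> fin_cases j
    · simpa using hs 1 1
    · simpa using (hs 0 1).neg
    · simpa using (hs 1 0).neg
    · simpa using hs 0 0

theorem IsCoordMetric.contDiffAt_christoffel (hg : IsCoordMetric g V) {y : Plane} (hy : y ∈ V)
    (k i j : Fin 2) : ContDiffAt ℝ ∞ (christoffel g k i j) y := by
  refine contDiffAt_const.mul (ContDiffAt.sum fun l _ => (hg.contDiffAt_inv hy k l).mul ?_)
  exact ((contDiffAt_partialDeriv (hg.smooth y hy j l) i).add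
    (contDiffAt_partialDeriv (hg.smooth y hy i l) j)).sub
    (contDiffAt_partialDeriv (hg.smooth y hy i j) l)

/-- The curvature tensor with lowered index. -/
def loweredRiemann (g : Plane → Matrix (Fin 2) (Fin 2) ℝ) (m l : Fin 2) (y : Plane) : ℝ :=
  ∑ a, g y m a * riemannTensor g a l 0 1 y

/-- The curvature operator `R(∂₀, ∂₁)` is skew-symmetric: apply `[∂₀, ∂₁] = 0` to the coefficients
of the metric and use the compatibility of the connection. -/
theorem IsCoordMetric.loweredRiemann_skew (hg : IsCoordMetric g V) {y : Plane} (hy : y ∈ V)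
    (m l : Fin 2) : loweredRiemann g m l y + loweredRiemann g l m y = 0 := by
  have hΓ : ∀ k i j, DifferentiableAt ℝ (christoffel g k i j) y := fun k i j =>
    (hg.contDiffAt_christoffel hy k i j).differentiableAt (by simp)
  have hgd : ∀ i j, DifferentiableAt ℝ (fun z => g z i j) y := fun i j =>
    (hg.smooth y hy i j).differentiableAt (by simp)
  have hsecond : ∀ b a, partialDeriv b (partialDeriv a (fun z => g z m l)) y =
      ∑ c, ((partialDeriv b (fun z => g z l c) y * christoffel g c a m y +
          g y l c * partialDeriv b (christoffel g c a m) y) +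
        (partialDeriv b (fun z => g z m c) y * christoffel g c a l y +
          g y m c * partialDeriv b (christoffel g c a l) y)) := by
    intro b a
    have hcongr : partialDeriv a (fun z => g z m l) =ᶠ[𝓝 y] fun z =>
        ∑ c, (g z l c * christoffel g c a m z + g z m c * christoffel g c a l z) := by
      filter_upwards [hg.isOpen.mem_nhds hy] with z hz using hg.partialDeriv_eq hz a m l
    rw [partialDeriv_congr hcongr, partialDeriv_sum]
    · refine Finset.sum_congr rfl fun c _ => ?_
      rw [partialDeriv_add (f := fun z => g z l c * christoffel g c a m z)
          (f' := fun z => g z m c * christoffel g c a l z) ((hgd l c).mul (hΓ c a m))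
          ((hgd m c).mul (hΓ c a l)),
        partialDeriv_mul (hgd l c) (hΓ c a m), partialDeriv_mul (hgd m c) (hΓ c a l)]
    · intro c _
      exact ((hgd l c).mul (hΓ c a m)).add ((hgd m c).mul (hΓ c a l))
  have hcomm := partialDeriv_comm (hg.smooth y hy m l) 0 1
  rw [hsecond, hsecond] at hcomm
  simp only [hg.partialDeriv_eq hy] at hcomm
  simp only [loweredRiemann, riemannTensor]
  have hs := hg.symm y 1 0
  have hc : ∀ k, christoffel g k 1 0 y = christoffel g k 0 1 y := fun k =>
    hg.christoffel_symm k 1 0 y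
  simp only [Fin.sum_univ_two] at hcomm ⊢
  fin_cases m <;> fin_cases l <;>
    simp only [Fin.zero_eta, Fin.mk_one, Fin.isValue, hs, hc] at hcomm ⊢ <;>
    linear_combination hcomm

/-- `⟨R(∂₀, ∂₁) Y, J⟩` is the curvature times the area forms. -/
theorem IsCoordMetric.sum_loweredRiemann (hg : IsCoordMetric g V) {y : Plane} (hy : y ∈ V)
    (J Y : Plane) : ∑ m, ∑ l, loweredRiemann g m l y * J m * Y l =
      gaussCurvature g y * (g y).det * (J 0 * Y 1 - J 1 * Y 0) := by
  have h00 := hg.loweredRiemann_skew hy 0 0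
  have h11 := hg.loweredRiemann_skew hy 1 1
  have h01 := hg.loweredRiemann_skew hy 0 1
  have hK : gaussCurvature g y * (g y).det = loweredRiemann g 0 1 y := by
    rw [gaussCurvature, div_mul_cancel₀ _ (hg.det_pos hy).ne']; rfl
  rw [hK]
  simp only [Fin.sum_univ_two]
  linear_combination (J 0 * Y 0 / 2) * h00 + (J 1 * Y 1 / 2) * h11 + J 1 * Y 0 * h01

end CoordMetric

/-! ### Geodesics and Jacobi fields in coordinates -/

section CoordGeodesic

variable {g : Plane → Matrix (Fin 2) (Fin 2) ℝ} {V : Set Plane}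

/-- The geodesic vector field `(x, y) ↦ (y, -Γ(x)(y, y))` on position-velocity pairs. -/
def geodField (g : Plane → Matrix (Fin 2) (Fin 2) ℝ) (z : Plane × Plane) : Plane × Plane :=
  (z.2, WithLp.toLp 2 fun k => -∑ i, ∑ j, christoffel g k i j z.1 * z.2 i * z.2 j)

/-- The covariant derivative, along a curve through `x` with velocity `y`, of a field with value
`a` and coordinate derivative `a'`. -/
def covDeriv (g : Plane → Matrix (Fin 2) (Fin 2) ℝ) (x y a a' : Plane) : Plane :=
  WithLp.toLp 2 fun k => a' k + ∑ i, ∑ j, christoffel g k i j x * y i * a j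

theorem contDiffAt_coord (k : Fin 2) (v : Plane) : ContDiffAt ℝ ∞ (fun v : Plane => v k) v :=
  (EuclideanSpace.proj k : Plane →L[ℝ] ℝ).contDiff.contDiffAt

theorem IsCoordMetric.contDiffAt_geodField (hg : IsCoordMetric g V) {z : Plane × Plane}
    (hz : z.1 ∈ V) : ContDiffAt ℝ ∞ (geodField g) z := by
  refine contDiffAt_snd.prodMk (contDiffAt_euclidean.2 fun k => ?_)
  refine ContDiffAt.neg (ContDiffAt.sum fun i _ => ContDiffAt.sum fun j _ => ?_)
  have h1 : ContDiffAt ℝ ∞ (fun z : Plane × Plane => christoffel g k i j z.1) z :=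
    ContDiffAt.comp (g := christoffel g k i j) z (hg.contDiffAt_christoffel hz k i j) contDiffAt_fst
  have h2 : ∀ l, ContDiffAt ℝ ∞ (fun z : Plane × Plane => z.2 l) z := fun l =>
    ContDiffAt.comp (g := fun v : Plane => v l) z (contDiffAt_coord l z.2) contDiffAt_snd
  exact (h1.mul (h2 i)).mul (h2 j)

/-- The product rule for the metric along a curve. -/
theorem IsCoordMetric.hasDerivAt_metricForm (hg : IsCoordMetric g V) {x a b : ℝ → Plane}
    {y a' b' : Plane} {s : ℝ} (hx : x s ∈ V) (hxd : HasDerivAt x y s) (ha : HasDerivAt a a' s)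
    (hb : HasDerivAt b b' s) :
    HasDerivAt (fun σ => metricForm g (x σ) (a σ) (b σ))
      (metricForm g (x s) (covDeriv g (x s) y (a s) a') (b s) +
        metricForm g (x s) (a s) (covDeriv g (x s) y (b s) b')) s := by
  have hgd : ∀ i j, HasDerivAt (fun σ => g (x σ) i j)
      (∑ k, partialDeriv k (fun z => g z i j) (x s) * y k) s := fun i j =>
    hasDerivAt_comp_plane ((hg.smooth _ hx i j).differentiableAt (by simp)) hxd
  have h : HasDerivAt (fun σ => metricForm g (x σ) (a σ) (b σ))
      (∑ i, ∑ j, (((∑ k, partialDeriv k (fun z => g z i j) (x s) * y k) * a s i +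
        g (x s) i j * a' i) * b s j + g (x s) i j * a s i * b' j)) s := by
    refine HasDerivAt.fun_sum fun i _ => HasDerivAt.fun_sum fun j _ => ?_
    exact ((hgd i j).mul (hasDerivAt_apply ha i)).mul (hasDerivAt_apply hb j)
  refine h.congr_deriv ?_
  simp only [hg.partialDeriv_eq hx, metricForm, covDeriv, Fin.sum_univ_two]
  rw [hg.symm (x s) 1 0]
  ring

theorem IsCoordMetric.fderiv_geodField_fst (hg : IsCoordMetric g V) {z : Plane × Plane}
    (hz : z.1 ∈ V) (w : Plane × Plane) : (fderiv ℝ (geodField g) z w).1 = w.2 := by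
  have h1 := ((hg.contDiffAt_geodField hz).differentiableAt (by simp)).hasFDerivAt.fst
  have h2 : HasFDerivAt (fun z => (geodField g z).1) (ContinuousLinearMap.snd ℝ Plane Plane) z :=
    hasFDerivAt_snd
  exact congrArg (fun L : Plane × Plane →L[ℝ] Plane => L w) (h1.unique h2)

theorem IsCoordMetric.fderiv_geodField_snd (hg : IsCoordMetric g V) {z : Plane × Plane}
    (hz : z.1 ∈ V) (w : Plane × Plane) (k : Fin 2) : (fderiv ℝ (geodField g) z w).2 k =
      -∑ i, ∑ j, (((∑ m, partialDeriv m (christoffel g k i j) z.1 * w.1 m) * z.2 i +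
        christoffel g k i j z.1 * w.2 i) * z.2 j + christoffel g k i j z.1 * z.2 i * w.2 j) := by
  -- Differentiate along the line `z + σ w`.
  have hl : HasDerivAt (fun σ : ℝ => z + σ • w) w 0 := by
    simpa using ((hasDerivAt_id (0 : ℝ)).smul_const w).const_add z
  have h0 : z + (0 : ℝ) • w = z := by simp
  have hF : HasFDerivAt (geodField g) (fderiv ℝ (geodField g) z) (z + (0 : ℝ) • w) := by
    rw [h0]; exact ((hg.contDiffAt_geodField hz).differentiableAt (by simp)).hasFDerivAt
  have hc : HasDerivAt (fun σ : ℝ => geodField g (z + σ • w)) (fderiv ℝ (geodField g) z w) 0 :=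
    HasFDerivAt.comp_hasDerivAt (f := fun σ : ℝ => z + σ • w) (0 : ℝ) hF hl
  have hc2 : HasDerivAt (fun σ : ℝ => (geodField g (z + σ • w)).2)
    (fderiv ℝ (geodField g) z w).2 0 := hc.snd
  have h1 := hasDerivAt_apply hc2 k
  have hx : HasDerivAt (fun σ : ℝ => (z + σ • w).1) w.1 0 := hl.fst
  have hy : HasDerivAt (fun σ : ℝ => (z + σ • w).2) w.2 0 := hl.snd
  have hΓ : ∀ i j, HasDerivAt (fun σ : ℝ => christoffel g k i j (z + σ • w).1)
      (∑ m, partialDeriv m (christoffel g k i j) (z + (0 : ℝ) • w).1 * w.1 m) 0 := fun i j =>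
    hasDerivAt_comp_plane (by
      rw [h0]; exact (hg.contDiffAt_christoffel hz k i j).differentiableAt (by simp)) hx
  have h2 := HasDerivAt.fun_neg (HasDerivAt.fun_sum (u := Finset.univ) fun i _ =>
    HasDerivAt.fun_sum (u := Finset.univ) fun j _ =>
      ((hΓ i j).mul (hasDerivAt_apply hy i)).mul (hasDerivAt_apply hy j))
  have := h1.unique h2
  simp only [h0, Pi.mul_apply] at this
  exact this

/-- Local form of the second variation: along a geodesic, the squared norm `h` of a Jacobi field
satisfies `h' = 2P` and `P' = Q` with `0 ≤ Q` and `P² ≤ h Q`, when the curvature is negative.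
Here `P = ⟨J, ∇J⟩` and `Q = |∇J|² - K |J ∧ x'|²`. -/
theorem IsCoordMetric.jacobi (hg : IsCoordMetric g V) (hK : ∀ y ∈ V, gaussCurvature g y < 0)
    {z w : ℝ → Plane × Plane} {s : ℝ}
    (hz : ∀ᶠ σ in 𝓝 s, (z σ).1 ∈ V ∧ HasDerivAt z (geodField g (z σ)) σ ∧
      HasDerivAt w (fderiv ℝ (geodField g) (z σ) (w σ)) σ) :
    ∃ (P : ℝ → ℝ) (Q : ℝ),
      (∀ᶠ σ in 𝓝 s, HasDerivAt (fun σ => metricForm g (z σ).1 (w σ).1 (w σ).1) (2 * P σ) σ) ∧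
      HasDerivAt P Q s ∧ 0 ≤ Q ∧ P s ^ 2 ≤ metricForm g (z s).1 (w s).1 (w s).1 * Q := by
  -- `J = w.1` is a Jacobi field along `x = z.1`, and `W = ∇J` is its covariant derivative; then
  -- `P = ⟨J, ∇J⟩` and `Q = ⟨∇J, ∇J⟩ + ⟨J, ∇∇J⟩`.
  let W : ℝ → Plane := fun σ => covDeriv g (z σ).1 (z σ).2 (w σ).1 (w σ).2
  have hw1 : ∀ᶠ σ in 𝓝 s, HasDerivAt (fun σ => (w σ).1) (w σ).2 σ := by
    filter_upwards [hz] with σ hσ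
    have : HasDerivAt (fun σ => (w σ).1) (fderiv ℝ (geodField g) (z σ) (w σ)).1 σ := hσ.2.2.fst
    rwa [hg.fderiv_geodField_fst hσ.1] at this
  obtain ⟨hzV, hzd, hwd⟩ := hz.self_of_nhds
  have hxd : HasDerivAt (fun σ => (z σ).1) (z s).2 s := hzd.fst
  have hyd : ∀ k, HasDerivAt (fun σ => (z σ).2 k)
      (-∑ i, ∑ j, christoffel g k i j (z s).1 * (z s).2 i * (z s).2 j) s := fun k =>
    hasDerivAt_apply hzd.snd k
  have hJd := hw1.self_of_nhds
  have hKd : ∀ k, HasDerivAt (fun σ => (w σ).2 k) _ s := fun k =>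
    (hasDerivAt_apply hwd.snd k).congr_deriv (hg.fderiv_geodField_snd hzV (w s) k)
  have hΓd : ∀ k i j, HasDerivAt (fun σ => christoffel g k i j (z σ).1)
      (∑ m, partialDeriv m (christoffel g k i j) (z s).1 * (z s).2 m) s := fun k i j =>
    hasDerivAt_comp_plane ((hg.contDiffAt_christoffel hzV k i j).differentiableAt (by simp)) hxd
  have hWk := fun k => (hKd k).add (HasDerivAt.fun_sum (u := Finset.univ) fun i _ =>
    HasDerivAt.fun_sum (u := Finset.univ) fun j _ =>
      ((hΓd k i j).mul (hyd i)).mul (hasDerivAt_apply hJd j))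
  let W' : Plane := WithLp.toLp 2 fun k =>
    -(∑ i, ∑ j, (((∑ m, partialDeriv m (christoffel g k i j) (z s).1 * (w s).1 m) * (z s).2 i +
        christoffel g k i j (z s).1 * (w s).2 i) * (z s).2 j +
        christoffel g k i j (z s).1 * (z s).2 i * (w s).2 j)) +
      ∑ i, ∑ j, (((∑ m, partialDeriv m (christoffel g k i j) (z s).1 * (z s).2 m) * (z s).2 i +
        christoffel g k i j (z s).1 *
          (-∑ a, ∑ b, christoffel g i a b (z s).1 * (z s).2 a * (z s).2 b)) * (w s).1 j +
        christoffel g k i j (z s).1 * (z s).2 i * (w s).2 j)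
  have hWd : HasDerivAt W W' s := hasDerivAt_plane fun k => hWk k
  have hP := hg.hasDerivAt_metricForm hzV hxd hJd hWd
  -- The Jacobi equation `∇∇J = -R(J, x') x'`.
  have hJac : ∀ k, covDeriv g (z s).1 (z s).2 (W s) W' k =
      -((w s).1 0 * (z s).2 1 - (w s).1 1 * (z s).2 0) *
        ∑ l, riemannTensor g k l 0 1 (z s).1 * (z s).2 l := by
    intro k
    have hc : ∀ k, christoffel g k 1 0 = christoffel g k 0 1 := fun k =>
      funext fun y => hg.christoffel_symm k 1 0 y
    simp only [covDeriv, W', W, riemannTensor, Fin.sum_univ_two, hc]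
    ring
  have hcurv : metricForm g (z s).1 (w s).1 (covDeriv g (z s).1 (z s).2 (W s) W') =
      -((w s).1 0 * (z s).2 1 - (w s).1 1 * (z s).2 0) ^ 2 *
        (gaussCurvature g (z s).1 * (g (z s).1).det) := by
    have h := hg.sum_loweredRiemann hzV (w s).1 (z s).2
    simp only [metricForm, hJac]
    simp only [loweredRiemann, Fin.sum_univ_two] at h ⊢
    linear_combination (-((w s).1 0 * (z s).2 1 - (w s).1 1 * (z s).2 0)) * h
  have hneg : gaussCurvature g (z s).1 * (g (z s).1).det < 0 :=
    mul_neg_of_neg_of_pos (hK _ hzV) (hg.det_pos hzV)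
  refine ⟨fun σ => metricForm g (z σ).1 (w σ).1 (W σ), _, ?_, hP, ?_, ?_⟩
  · filter_upwards [hz, hw1] with σ hσ hσ1
    refine (hg.hasDerivAt_metricForm hσ.1 hσ.2.1.fst hσ1 hσ1).congr_deriv ?_
    simp only [metricForm, W, Fin.sum_univ_two]
    rw [hg.symm (z σ).1 1 0]
    simp only [geodField]
    ring
  · have h1 := hg.metricForm_nonneg hzV (W s)
    have h2 := sq_nonneg ((w s).1 0 * (z s).2 1 - (w s).1 1 * (z s).2 0)
    rw [hcurv]
    have : metricForm g (z s).1 (covDeriv g (z s).1 (z s).2 (w s).1 (w s).2) (W s) =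
      metricForm g (z s).1 (W s) (W s) := rfl
    rw [this]
    nlinarith
  · have h1 := hg.sq_metricForm_le hzV (w s).1 (W s)
    have h2 := sq_nonneg ((w s).1 0 * (z s).2 1 - (w s).1 1 * (z s).2 0)
    refine h1.trans (mul_le_mul_of_nonneg_left ?_ (hg.metricForm_nonneg hzV _))
    rw [hcurv]
    have : metricForm g (z s).1 (covDeriv g (z s).1 (z s).2 (w s).1 (w s).2) (W s) =
      metricForm g (z s).1 (W s) (W s) := rfl
    rw [this]
    nlinarith

/-- Geodesics have constant speed. -/
theorem IsCoordMetric.hasDerivAt_speed (hg : IsCoordMetric g V) {z : ℝ → Plane × Plane} {s : ℝ}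
    (hzV : (z s).1 ∈ V) (hz : HasDerivAt z (geodField g (z s)) s) :
    HasDerivAt (fun σ => metricForm g (z σ).1 (z σ).2 (z σ).2) 0 s := by
  refine (hg.hasDerivAt_metricForm hzV hz.fst hz.snd hz.snd).congr_deriv ?_
  have : covDeriv g (z s).1 (geodField g (z s)).1 (z s).2 (geodField g (z s)).2 = 0 := by
    ext k; simp [covDeriv, geodField]; ring
  rw [this]; simp [metricForm]

end CoordGeodesic

/-! ### Changes of coordinates -/

section CoordChange

/-- `φ` is a smooth isometry, in coordinates, from the open set `W` with the metric `g` to the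
metric `h`. -/
structure IsCoordIsometry (φ : Plane → Plane) (W : Set Plane)
    (g h : Plane → Matrix (Fin 2) (Fin 2) ℝ) : Prop where
  isOpen : IsOpen W
  smooth : ∀ y ∈ W, ContDiffAt ℝ ∞ φ y
  isometric : ∀ y ∈ W, ∀ a b : Plane,
    metricForm h (φ y) (fderiv ℝ φ y a) (fderiv ℝ φ y b) = metricForm g y a b

variable {φ : Plane → Plane} {W V V' : Set Plane} {g h : Plane → Matrix (Fin 2) (Fin 2) ℝ}

theorem IsCoordIsometry.contDiffAt_apply (hφ : IsCoordIsometry φ W g h) {y : Plane} (hy : y ∈ W)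
    (a : Fin 2) : ContDiffAt ℝ ∞ (fun z => φ z a) y :=
  contDiffAt_euclidean.1 (hφ.smooth y hy) a

theorem IsCoordIsometry.fderiv_apply (hφ : IsCoordIsometry φ W g h) {y : Plane} (hy : y ∈ W)
    (v : Plane) (a : Fin 2) :
    fderiv ℝ φ y v a = ∑ i, partialDeriv i (fun z => φ z a) y * v i := by
  have h1 : HasFDerivAt (fun z => φ z a) ((EuclideanSpace.proj a).comp (fderiv ℝ φ y)) y :=
    (EuclideanSpace.proj a : Plane →L[ℝ] ℝ).hasFDerivAt.comp y
      ((hφ.smooth y hy).differentiableAt (by simp)).hasFDerivAt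
  have h2 := fderiv_apply_eq_sum (fun z => φ z a) y v
  rw [h1.fderiv] at h2
  have h3 : fderiv ℝ φ y v a = (EuclideanSpace.proj a).comp (fderiv ℝ φ y) v := rfl
  rw [h3, h2]

/-- `g` is the pullback of `h` in terms of coefficients: `g = Dφᵀ h Dφ`. -/
theorem IsCoordIsometry.coeff_eq (hφ : IsCoordIsometry φ W g h) {y : Plane} (hy : y ∈ W)
    (i j : Fin 2) : g y i j = ∑ a, ∑ b, h (φ y) a b * partialDeriv i (fun z => φ z a) y *
      partialDeriv j (fun z => φ z b) y := by
  have := hφ.isometric y hy (basisVec i) (basisVec j)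
  simp only [metricForm] at this
  have h1 : ∀ (k a : Fin 2), fderiv ℝ φ y (basisVec k) a = partialDeriv k (fun z => φ z a) y := by
    intro k a
    rw [hφ.fderiv_apply hy]
    simp only [Fin.sum_univ_two, PiLp.single_apply]
    fin_cases k <;> simp
  simp only [h1] at this
  rw [this]
  simp only [Fin.sum_univ_two, PiLp.single_apply]
  fin_cases i <;> fin_cases j <;> simp

/-- The derivative of the relation `g = Dφᵀ h Dφ`. -/
theorem IsCoordIsometry.partialDeriv_coeff (hφ : IsCoordIsometry φ W g h) (hh : IsCoordMetric h V')
    {y : Plane} (hy : y ∈ W) (hy' : φ y ∈ V') (k i j : Fin 2) :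
    partialDeriv k (fun z => g z i j) y = ∑ a, ∑ b,
      (((∑ c, partialDeriv c (fun z => h z a b) (φ y) * partialDeriv k (fun z => φ z c) y) *
          partialDeriv i (fun z => φ z a) y +
        h (φ y) a b * partialDeriv k (partialDeriv i (fun z => φ z a)) y) *
          partialDeriv j (fun z => φ z b) y +
        h (φ y) a b * partialDeriv i (fun z => φ z a) y *
          partialDeriv k (partialDeriv j (fun z => φ z b)) y) := by
  have hD : ∀ a i, DifferentiableAt ℝ (fun z => partialDeriv i (fun z => φ z a) z) y := fun a i =>
    (contDiffAt_partialDeriv (hφ.contDiffAt_apply hy a) i).differentiableAt (by simp)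
  have hhd : ∀ a b, DifferentiableAt ℝ (fun z => h (φ z) a b) y := fun a b =>
    DifferentiableAt.comp y (g := fun z => h z a b)
      ((hh.smooth _ hy' a b).differentiableAt (by simp))
      ((hφ.smooth y hy).differentiableAt (by simp))
  have hchain : ∀ a b, partialDeriv k (fun z => h (φ z) a b) y =
      ∑ c, partialDeriv c (fun z => h z a b) (φ y) * partialDeriv k (fun z => φ z c) y := by
    intro a b
    have h1 : HasFDerivAt (fun z => h (φ z) a b)
        ((fderiv ℝ (fun z => h z a b) (φ y)).comp (fderiv ℝ φ y)) y :=
      HasFDerivAt.comp y (g := fun z => h z a b)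
        ((hh.smooth _ hy' a b).differentiableAt (by simp)).hasFDerivAt
        ((hφ.smooth y hy).differentiableAt (by simp)).hasFDerivAt
    rw [partialDeriv, h1.fderiv, ContinuousLinearMap.comp_apply, fderiv_apply_eq_sum]
    refine Finset.sum_congr rfl fun c _ => ?_
    rw [hφ.fderiv_apply hy]
    simp only [Fin.sum_univ_two, PiLp.single_apply]
    fin_cases k <;> simp
  have hloc : (fun z => g z i j) =ᶠ[𝓝 y] fun z => ∑ a, ∑ b, h (φ z) a b *
      partialDeriv i (fun z => φ z a) z * partialDeriv j (fun z => φ z b) z := by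
    filter_upwards [hφ.isOpen.mem_nhds hy] with z hz using hφ.coeff_eq hz i j
  rw [partialDeriv_congr hloc, partialDeriv_sum]
  · refine Finset.sum_congr rfl fun a _ => ?_
    rw [partialDeriv_sum]
    · refine Finset.sum_congr rfl fun b _ => ?_
      rw [partialDeriv_mul (f := fun z => h (φ z) a b * partialDeriv i (fun z => φ z a) z)
        (f' := partialDeriv j (fun z => φ z b)) ((hhd a b).mul (hD a i)) (hD b j),
        partialDeriv_mul (f := fun z => h (φ z) a b) (f' := partialDeriv i (fun z => φ z a))
        (hhd a b) (hD a i), hchain]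
    · exact fun b _ => ((hhd a b).mul (hD a i)).mul (hD b j)
  · exact fun a _ => DifferentiableAt.fun_sum fun b _ => ((hhd a b).mul (hD a i)).mul (hD b j)

/-- The transformation law of the Christoffel symbols, contracted with a velocity `y`. -/
theorem IsCoordIsometry.sum_christoffel (hφ : IsCoordIsometry φ W g h)
    (hg : IsCoordMetric g V) (hh : IsCoordMetric h V') {x : Plane}
    (hW : x ∈ W) (hV : x ∈ V) (hV' : φ x ∈ V') (y : Plane) (a : Fin 2) :
    ∑ i, ((∑ m, partialDeriv m (partialDeriv i (fun y => φ y a)) x * y m) * y i +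
      partialDeriv i (fun y => φ y a) x * (-∑ k, ∑ j, christoffel g i k j x * y k * y j)) +
    ∑ b, ∑ c, christoffel h a b c (φ x) * fderiv ℝ φ x y b * fderiv ℝ φ x y c = 0 := by
  let A : Fin 2 → ℝ := fun a =>
    ∑ i, (∑ m, partialDeriv m (partialDeriv i (fun y => φ y a)) x * y m) * y i
  let B : Fin 2 → ℝ := fun i => ∑ k, ∑ j, christoffel g i k j x * y k * y j
  let C : Fin 2 → ℝ := fun a =>
    ∑ b, ∑ c, christoffel h a b c (φ x) * fderiv ℝ φ x y b * fderiv ℝ φ x y c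
  -- `T` is the covariant acceleration of the image curve.
  let T : Fin 2 → ℝ := fun a => A a - (∑ i, partialDeriv i (fun y => φ y a) x * B i) + C a
  suffices hT0 : ∀ a, T a = 0 by
    rw [← hT0 a]
    simp only [T, A, B, C, Fin.sum_univ_two]
    ring
  have hsymm : ∀ a, partialDeriv 1 (partialDeriv 0 (fun y => φ y a)) x =
      partialDeriv 0 (partialDeriv 1 (fun y => φ y a)) x := fun a =>
    partialDeriv_comm (hφ.contDiffAt_apply hW a) 1 0
  have hh10 : h (φ x) 1 0 = h (φ x) 0 1 := hh.symm _ 1 0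
  have hh10' : (fun z => h z 1 0) = fun z => h z 0 1 := funext fun z => hh.symm z 1 0
  have hg1 : ∀ l, ∑ k, g x l k * B k =
      ∑ i, ∑ j, (1 / 2) * (partialDeriv i (fun z => g z j l) x + partialDeriv j (fun z => g z i l) x
        - partialDeriv l (fun z => g z i j) x) * y i * y j := by
    intro l
    simp only [B]
    have e := fun i j => hg.sum_mul_christoffel hV l i j
    simp only [Fin.sum_univ_two] at e ⊢
    linear_combination y 0 * y 0 * e 0 0 + y 0 * y 1 * e 0 1 + y 1 * y 0 * e 1 0 +
      y 1 * y 1 * e 1 1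
  have hh1 : ∀ l, ∑ k, h (φ x) l k * C k =
      ∑ i, ∑ j, (1 / 2) * (partialDeriv i (fun z => h z j l) (φ x) +
        partialDeriv j (fun z => h z i l) (φ x) - partialDeriv l (fun z => h z i j) (φ x)) *
          fderiv ℝ φ x y i * fderiv ℝ φ x y j := by
    intro l
    simp only [C]
    have e := fun i j => hh.sum_mul_christoffel hV' l i j
    set v := fderiv ℝ φ x y
    simp only [Fin.sum_univ_two] at e ⊢
    linear_combination v 0 * v 0 * e 0 0 + v 0 * v 1 * e 0 1 + v 1 * v 0 * e 1 0 +
      v 1 * v 1 * e 1 1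
  -- `Dφᵀ h T = 0`: with all indices lowered, only first derivatives of `g` and `h` occur, and they
  -- are related by differentiating `g = Dφᵀ h Dφ`.
  have key : ∀ l, ∑ b, partialDeriv l (fun y => φ y b) x * ∑ a, h (φ x) b a * T a = 0 := by
    intro l
    have e1 : ∑ b, partialDeriv l (fun y => φ y b) x * ∑ a, h (φ x) b a * T a =
        ∑ b, partialDeriv l (fun y => φ y b) x * ∑ a, h (φ x) b a * A a -
        ∑ k, g x l k * B k +
        ∑ b, partialDeriv l (fun y => φ y b) x * ∑ k, h (φ x) b k * C k := by
      simp only [hφ.coeff_eq hW, T]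
      simp only [Fin.sum_univ_two]
      ring
    rw [e1, hg1]
    simp only [hh1, A]
    simp only [hφ.partialDeriv_coeff hh hW hV', hφ.fderiv_apply hW]
    simp only [Fin.sum_univ_two, hsymm, hh10, hh10']
    fin_cases l
    · simp only [Fin.zero_eta, hsymm]; ring
    · simp only [Fin.mk_one, hsymm]; ring
  -- It remains to invert `Dφ` and `h`; for the former, `det g = det h (det Dφ)²`.
  have hdet : partialDeriv 0 (fun z => φ z 0) x * partialDeriv 1 (fun z => φ z 1) x -
      partialDeriv 1 (fun z => φ z 0) x * partialDeriv 0 (fun z => φ z 1) x ≠ 0 := by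
    intro h0
    have hgd := hg.det_pos hV
    rw [Matrix.det_fin_two] at hgd
    simp only [hφ.coeff_eq hW, Fin.sum_univ_two] at hgd
    have : ∀ A B C D p q r s : ℝ,
      (A * p * p + B * p * r + (C * r * p + D * r * r)) *
        (A * q * q + B * q * s + (C * s * q + D * s * s)) -
      (A * p * q + B * p * s + (C * r * q + D * r * s)) *
        (A * q * p + B * q * r + (C * s * p + D * s * r)) =
          (A * D - B * C) * (p * s - q * r) ^ 2 := by
      intros; ring
    rw [this, h0] at hgd
    simp at hgd
  have hu : ∀ b, ∑ a, h (φ x) b a * T a = 0 := by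
    have k0 := key 0
    have k1 := key 1
    rw [Fin.sum_univ_two] at k0 k1
    intro b
    refine (mul_eq_zero.1 ?_).resolve_left hdet
    fin_cases b
    · simp only [Fin.zero_eta]
      linear_combination partialDeriv 1 (fun z => φ z 1) x * k0 -
        partialDeriv 0 (fun z => φ z 1) x * k1
    · simp only [Fin.mk_one]
      linear_combination -partialDeriv 1 (fun z => φ z 0) x * k0 +
        partialDeriv 0 (fun z => φ z 0) x * k1
  have hhd := hh.det_pos hV'
  rw [Matrix.det_fin_two] at hhd
  have u0 := hu 0
  have u1 := hu 1
  rw [Fin.sum_univ_two] at u0 u1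
  intro b
  refine (mul_eq_zero.1 ?_).resolve_left hhd.ne'
  fin_cases b
  · simp only [Fin.zero_eta]
    linear_combination h (φ x) 1 1 * u0 - h (φ x) 0 1 * u1
  · simp only [Fin.mk_one]
    linear_combination -h (φ x) 1 0 * u0 + h (φ x) 0 0 * u1

/-- Isometries map geodesics to geodesics. -/
theorem IsCoordIsometry.hasDerivAt_geodField (hφ : IsCoordIsometry φ W g h)
    (hg : IsCoordMetric g V) (hh : IsCoordMetric h V') {z : ℝ → Plane × Plane} {s : ℝ}
    (hW : (z s).1 ∈ W) (hV : (z s).1 ∈ V) (hV' : φ (z s).1 ∈ V')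
    (hz : HasDerivAt z (geodField g (z s)) s) :
    HasDerivAt (fun σ => (φ (z σ).1, fderiv ℝ φ (z σ).1 (z σ).2))
      (geodField h (φ (z s).1, fderiv ℝ φ (z s).1 (z s).2)) s := by
  have hx : HasDerivAt (fun σ => (z σ).1) (z s).2 s := hz.fst
  have hy : ∀ k, HasDerivAt (fun σ => (z σ).2 k)
      (-∑ i, ∑ j, christoffel g k i j (z s).1 * (z s).2 i * (z s).2 j) s := fun k =>
    hasDerivAt_apply hz.snd k
  have h1 : HasDerivAt (fun σ => φ (z σ).1) (fderiv ℝ φ (z s).1 (z s).2) s :=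
    ((hφ.smooth _ hW).differentiableAt (by simp)).hasFDerivAt.comp_hasDerivAt s hx
  refine HasDerivAt.prodMk h1 (hasDerivAt_plane fun a => ?_)
  have hev : (fun σ => fderiv ℝ φ (z σ).1 (z σ).2 a) =ᶠ[𝓝 s] fun σ =>
      ∑ i, partialDeriv i (fun y => φ y a) (z σ).1 * (z σ).2 i := by
    filter_upwards [hx.continuousAt.preimage_mem_nhds (hφ.isOpen.mem_nhds hW)] with σ hσ
      using hφ.fderiv_apply hσ _ a
  have hD : ∀ a i, HasDerivAt (fun σ => partialDeriv i (fun y => φ y a) (z σ).1)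
      (∑ m, partialDeriv m (partialDeriv i (fun y => φ y a)) (z s).1 * (z s).2 m) s := fun a i =>
    hasDerivAt_comp_plane
      ((contDiffAt_partialDeriv (hφ.contDiffAt_apply hW a) i).differentiableAt (by simp)) hx
  have h2 := (HasDerivAt.fun_sum (u := Finset.univ) fun i _ =>
    (hD a i).mul (hy i)).congr_of_eventuallyEq hev
  refine h2.congr_deriv ?_
  have h3 := hφ.sum_christoffel hg hh hW hV hV' (z s).2 a
  exact eq_neg_of_add_eq_zero_left h3

end CoordChange

/-! ### The metric coefficients of a surface -/

section MetricCoeff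

variable {X : Type*} [MetricSpace X] [ChartedSpace Plane X] [IsManifold (𝓡 2) ∞ X]
  [RiemannianBundle (fun x : X => TangentSpace (𝓡 2) x)]
  [IsContMDiffRiemannianBundle (𝓡 2) ∞ Plane (fun x : X => TangentSpace (𝓡 2) x)]

theorem mdifferentiableAt_chart_symm {e : OpenPartialHomeomorph X Plane}
    (he : e ∈ IsManifold.maximalAtlas (𝓡 2) ∞ X) {y : Plane} (hy : y ∈ e.target) :
    MDifferentiableAt (𝓡 2) (𝓡 2) e.symm y :=
  (contMDiffAt_symm_of_mem_maximalAtlas he hy).mdifferentiableAt (by simp)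

theorem mdifferentiableAt_chart {e : OpenPartialHomeomorph X Plane}
    (he : e ∈ IsManifold.maximalAtlas (𝓡 2) ∞ X) {x : X} (hx : x ∈ e.source) :
    MDifferentiableAt (𝓡 2) (𝓡 2) e x :=
  (contMDiffAt_of_mem_maximalAtlas he hx).mdifferentiableAt (by simp)

theorem metricForm_metricCoeff (e : OpenPartialHomeomorph X Plane) (y a b : Plane) :
    metricForm (metricCoeff e) y a b =
      inner ℝ (mfderiv (𝓡 2) (𝓡 2) e.symm y a : TangentSpace (𝓡 2) (e.symm y))
        (mfderiv (𝓡 2) (𝓡 2) e.symm y b : TangentSpace (𝓡 2) (e.symm y)) := by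
  have key : ∀ (E : Type _) [NormedAddCommGroup E] [InnerProductSpace ℝ E] (L : Plane →ₗ[ℝ] E),
      ∑ i, ∑ j, inner ℝ (L (basisVec i)) (L (basisVec j)) * a i * b j = inner ℝ (L a) (L b) := by
    intro E _ _ L
    conv_rhs => rw [plane_eq_sum a, plane_eq_sum b]
    simp only [Fin.sum_univ_two, map_add, map_smul, inner_add_left, inner_add_right,
      inner_smul_left, inner_smul_right, conj_trivial]
    ring
  exact key (TangentSpace (𝓡 2) (e.symm y)) (mfderiv (𝓡 2) (𝓡 2) e.symm y).toLinearMap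

theorem metricForm_metricCoeff_self (e : OpenPartialHomeomorph X Plane) (y a : Plane) :
    metricForm (metricCoeff e) y a a =
      ‖(mfderiv (𝓡 2) (𝓡 2) e.symm y a : TangentSpace (𝓡 2) (e.symm y))‖ ^ 2 := by
  rw [metricForm_metricCoeff]
  exact real_inner_self_eq_norm_sq _

theorem injective_mfderiv_chart_symm {e : OpenPartialHomeomorph X Plane}
    (he : e ∈ IsManifold.maximalAtlas (𝓡 2) ∞ X) {y : Plane} (hy : y ∈ e.target) :
    Function.Injective (mfderiv (𝓡 2) (𝓡 2) e.symm y) := by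
  have h1 : HasMFDerivAt (𝓡 2) (𝓡 2) (e ∘ e.symm) y
      ((mfderiv (𝓡 2) (𝓡 2) e (e.symm y)).comp (mfderiv (𝓡 2) (𝓡 2) e.symm y)) :=
    HasMFDerivAt.comp y (mdifferentiableAt_chart he (e.map_target hy)).hasMFDerivAt
      (mdifferentiableAt_chart_symm he hy).hasMFDerivAt
  have h2 : HasMFDerivAt (𝓡 2) (𝓡 2) (e ∘ e.symm) y (ContinuousLinearMap.id ℝ Plane) := by
    refine (hasMFDerivAt_id y).congr_of_eventuallyEq ?_
    filter_upwards [e.open_target.mem_nhds hy] with z hz using e.right_inv hz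
  have h3 : (mfderiv (𝓡 2) (𝓡 2) e (e.symm y) : Plane →L[ℝ] Plane).comp
      (mfderiv (𝓡 2) (𝓡 2) e.symm y : Plane →L[ℝ] Plane) = ContinuousLinearMap.id ℝ Plane :=
    hasMFDerivAt_unique h1 h2
  intro a b hab
  have h4 := congrArg (mfderiv (𝓡 2) (𝓡 2) e (e.symm y) : Plane →L[ℝ] Plane) hab
  have h5 := fun c : Plane => congrArg (fun L : Plane →L[ℝ] Plane => L c) h3
  exact (h5 a).symm.trans (h4.trans (h5 b))

theorem isCoordMetric_metricCoeff {e : OpenPartialHomeomorph X Plane}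
    (he : e ∈ IsManifold.maximalAtlas (𝓡 2) ∞ X) : IsCoordMetric (metricCoeff e) e.target where
  isOpen := e.open_target
  smooth y hy i j := by
    have hsec : ∀ i : Fin 2, ContMDiffOn (𝓡 2) ((𝓡 2).prod 𝓘(ℝ, Plane)) ∞
        (fun z => (⟨e.symm z, mfderiv (𝓡 2) (𝓡 2) e.symm z (basisVec i)⟩ :
          TangentBundle (𝓡 2) X)) e.target := by
      intro i
      have h1 : ContMDiffOn (𝓡 2).tangent (𝓡 2).tangent ∞
          (tangentMapWithin (𝓡 2) (𝓡 2) e.symm e.target)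
          (π Plane (TangentSpace (𝓡 2)) ⁻¹' e.target) :=
        (contMDiffOn_symm_of_mem_maximalAtlas he).contMDiffOn_tangentMapWithin (by simp)
          e.open_target.uniqueMDiffOn
      have h2 : ContMDiff (𝓡 2) (𝓡 2).tangent ∞
          (fun z : Plane => (⟨z, basisVec i⟩ : TangentBundle (𝓡 2) Plane)) := fun z =>
        contMDiffAt_vectorSpace_iff_contDiffAt.2 contDiffAt_const
      refine (h1.comp h2.contMDiffOn fun z hz => hz).congr fun z hz => ?_
      simp only [Function.comp, tangentMapWithin]
      rw [mfderivWithin_of_isOpen e.open_target hz]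
    have := ((hsec i).inner_bundle (hsec j)).contMDiffAt (e.open_target.mem_nhds hy)
    exact this.contDiffAt
  symm y i j := by
    simp only [metricCoeff, Matrix.of_apply]
    exact real_inner_comm _ _
  pos y hy a ha := by
    have h := metricForm_metricCoeff_self e y a
    rw [metricForm] at h
    rw [h]
    have h0 : mfderiv (𝓡 2) (𝓡 2) e.symm y a ≠ 0 := fun h0 =>
      ha ((injective_iff_map_eq_zero _).1 (injective_mfderiv_chart_symm he hy) a h0)
    have := norm_pos_iff.2 h0
    positivity

/-- The norm of the derivative of a map into a surface, read in a chart. -/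
theorem norm_mfderiv_sq {A : Type*} [NormedAddCommGroup A] [NormedSpace ℝ A]
    {e : OpenPartialHomeomorph X Plane} (he : e ∈ IsManifold.maximalAtlas (𝓡 2) ∞ X)
    {f : A → X} {t : A} (hf : ∀ᶠ s in 𝓝 t, f s ∈ e.source)
    (hd : DifferentiableAt ℝ (fun s => e (f s)) t) (ξ : A) :
    ‖(mfderiv 𝓘(ℝ, A) (𝓡 2) f t ξ : TangentSpace (𝓡 2) (f t))‖ ^ 2 =
      metricForm (metricCoeff e) (e (f t)) (fderiv ℝ (fun s => e (f s)) t ξ)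
        (fderiv ℝ (fun s => e (f s)) t ξ) := by
  have h1 : f =ᶠ[𝓝 t] e.symm ∘ fun s => e (f s) := by
    filter_upwards [hf] with s hs using (e.left_inv hs).symm
  have ht : e (f t) ∈ e.target := e.map_source hf.self_of_nhds
  have h2 : HasMFDerivAt 𝓘(ℝ, A) (𝓡 2) (e.symm ∘ fun s => e (f s)) t
      ((mfderiv (𝓡 2) (𝓡 2) e.symm (e (f t))).comp (fderiv ℝ (fun s => e (f s)) t)) :=
    HasMFDerivAt.comp t (mdifferentiableAt_chart_symm he ht).hasMFDerivAt
      hd.hasFDerivAt.hasMFDerivAt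
  rw [norm_mfderiv_congr h1, metricForm_metricCoeff_self, h2.mfderiv]
  rfl

theorem contMDiffAt_of_contDiffAt_chart {A : Type*} [NormedAddCommGroup A] [NormedSpace ℝ A]
    {e : OpenPartialHomeomorph X Plane} (he : e ∈ IsManifold.maximalAtlas (𝓡 2) ∞ X)
    {f : A → X} {t : A} (hf : ∀ᶠ s in 𝓝 t, f s ∈ e.source)
    (hd : ContDiffAt ℝ 1 (fun s => e (f s)) t) : ContMDiffAt 𝓘(ℝ, A) (𝓡 2) 1 f t := by
  have h1 : f =ᶠ[𝓝 t] e.symm ∘ fun s => e (f s) := by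
    filter_upwards [hf] with s hs using (e.left_inv hs).symm
  have ht : e (f t) ∈ e.target := e.map_source hf.self_of_nhds
  refine ContMDiffAt.congr_of_eventuallyEq ?_ h1
  exact ContMDiffAt.comp t ((contMDiffAt_symm_of_mem_maximalAtlas he ht).of_le (by simp))
    hd.contMDiffAt

end MetricCoeff

/-! ### Geodesics on a surface -/

section Geodesic

variable {X : Type*} [MetricSpace X] [ChartedSpace Plane X] [IsManifold (𝓡 2) ∞ X]
  [RiemannianBundle (fun x : X => TangentSpace (𝓡 2) x)]
  [IsContMDiffRiemannianBundle (𝓡 2) ∞ Plane (fun x : X => TangentSpace (𝓡 2) x)]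
  {Y : Type*} [MetricSpace Y] [ChartedSpace Plane Y] [IsManifold (𝓡 2) ∞ Y]
  [RiemannianBundle (fun x : Y => TangentSpace (𝓡 2) x)]
  [IsContMDiffRiemannianBundle (𝓡 2) ∞ Plane (fun x : Y => TangentSpace (𝓡 2) x)]

/-- The position and the velocity of a curve, read in the chart `e`. -/
def coordState (e : OpenPartialHomeomorph X Plane) (c : ℝ → X) (s : ℝ) : Plane × Plane :=
  (e (c s), deriv (fun σ => e (c σ)) s)

/-- Near the time `s`, the curve `c` stays in the chart `e` and is a geodesic there. -/
def IsGeodesicIn (e : OpenPartialHomeomorph X Plane) (c : ℝ → X) (s : ℝ) : Prop :=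
  ∀ᶠ σ in 𝓝 s, c σ ∈ e.source ∧
    HasDerivAt (coordState e c) (geodField (metricCoeff e) (coordState e c σ)) σ

/-- The curve `c` is a geodesic near the time `s`. -/
def IsGeodesicAt (c : ℝ → X) (s : ℝ) : Prop :=
  ∃ e ∈ IsManifold.maximalAtlas (𝓡 2) ∞ X, IsGeodesicIn e c s

theorem IsGeodesicIn.mem_source {e : OpenPartialHomeomorph X Plane} {c : ℝ → X} {s : ℝ}
    (h : IsGeodesicIn e c s) : c s ∈ e.source := h.self_of_nhds.1

theorem IsGeodesicIn.hasDerivAt {e : OpenPartialHomeomorph X Plane} {c : ℝ → X} {s : ℝ}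
    (h : IsGeodesicIn e c s) :
    HasDerivAt (coordState e c) (geodField (metricCoeff e) (coordState e c s)) s :=
  h.self_of_nhds.2

theorem IsGeodesicIn.hasDerivAt_chart {e : OpenPartialHomeomorph X Plane} {c : ℝ → X} {s : ℝ}
    (h : IsGeodesicIn e c s) : HasDerivAt (fun σ => e (c σ)) (coordState e c s).2 s :=
  h.hasDerivAt.fst

theorem coordState_congr (e : OpenPartialHomeomorph X Plane) {c c' : ℝ → X} {s : ℝ}
    (h : c =ᶠ[𝓝 s] c') : coordState e c =ᶠ[𝓝 s] coordState e c' := by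
  filter_upwards [h.eventuallyEq_nhds] with σ hσ
  have h1 : (fun τ => e (c τ)) =ᶠ[𝓝 σ] fun τ => e (c' τ) := hσ.fun_comp e
  rw [coordState, coordState, h1.deriv_eq, hσ.eq_of_nhds]

theorem IsGeodesicIn.congr {e : OpenPartialHomeomorph X Plane} {c c' : ℝ → X} {s : ℝ}
    (h : IsGeodesicIn e c s) (hc : c =ᶠ[𝓝 s] c') : IsGeodesicIn e c' s := by
  filter_upwards [h, hc.eventuallyEq_nhds, (coordState_congr e hc).eventuallyEq_nhds]
    with σ h1 h2 h3
  refine ⟨h2.eq_of_nhds ▸ h1.1, ?_⟩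
  rw [← h3.eq_of_nhds]
  exact h1.2.congr_of_eventuallyEq h3.symm

theorem IsGeodesicAt.congr {c c' : ℝ → X} {s : ℝ} (h : IsGeodesicAt c s) (hc : c =ᶠ[𝓝 s] c') :
    IsGeodesicAt c' s := by
  obtain ⟨e, he, h⟩ := h
  exact ⟨e, he, h.congr hc⟩

theorem IsGeodesicIn.eventually_eq {e : OpenPartialHomeomorph X Plane} {c : ℝ → X} {s : ℝ}
    (h : IsGeodesicIn e c s) : c =ᶠ[𝓝 s] fun σ => e.symm (e (c σ)) := by
  filter_upwards [h] with σ hσ using (e.left_inv hσ.1).symm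

theorem IsGeodesicIn.continuousAt {e : OpenPartialHomeomorph X Plane} {c : ℝ → X} {s : ℝ}
    (h : IsGeodesicIn e c s) : ContinuousAt c s := by
  refine ContinuousAt.congr ?_ h.eventually_eq.symm
  exact ContinuousAt.comp (g := e.symm) (f := fun σ => e (c σ))
    (e.continuousAt_symm (e.map_source h.mem_source)) h.hasDerivAt_chart.continuousAt

theorem IsGeodesicAt.continuousAt {c : ℝ → X} {s : ℝ} (h : IsGeodesicAt c s) :
    ContinuousAt c s := by
  obtain ⟨e, he, h⟩ := h
  exact h.continuousAt

theorem IsGeodesicIn.eventually {e : OpenPartialHomeomorph X Plane} {c : ℝ → X} {s : ℝ}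
    (h : IsGeodesicIn e c s) : ∀ᶠ σ in 𝓝 s, IsGeodesicIn e c σ :=
  Filter.Eventually.eventually_nhds h

/-- The curve in `X` described by an integral curve of the geodesic field in a chart. -/
theorem isGeodesicIn_of_hasDerivAt {e : OpenPartialHomeomorph X Plane} {z : ℝ → Plane × Plane}
    {s : ℝ} (hz : ∀ᶠ σ in 𝓝 s, (z σ).1 ∈ e.target ∧
      HasDerivAt z (geodField (metricCoeff e) (z σ)) σ) :
    IsGeodesicIn e (fun σ => e.symm (z σ).1) s ∧
      coordState e (fun σ => e.symm (z σ).1) =ᶠ[𝓝 s] z := by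
  have h1 : coordState e (fun σ => e.symm (z σ).1) =ᶠ[𝓝 s] z := by
    filter_upwards [hz.eventually_nhds] with σ hσ
    have h2 : (fun τ => e (e.symm (z τ).1)) =ᶠ[𝓝 σ] fun τ => (z τ).1 := by
      filter_upwards [hσ] with τ hτ using e.right_inv hτ.1
    have h3 : HasDerivAt (fun τ => (z τ).1) (z σ).2 σ := hσ.self_of_nhds.2.fst
    refine Prod.ext h2.eq_of_nhds ?_
    change deriv (fun τ => e (e.symm (z τ).1)) σ = _
    rw [h2.deriv_eq, h3.deriv]
  refine ⟨?_, h1⟩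
  filter_upwards [hz, h1.eventuallyEq_nhds] with σ hσ h2
  refine ⟨e.map_target hσ.1, ?_⟩
  rw [h2.eq_of_nhds]
  exact hσ.2.congr_of_eventuallyEq h2

/-! ### Local isometries -/

/-- Read in charts, a smooth map with isometric differentials is an isometry of coordinate
metrics. -/
theorem isCoordIsometry_chart {q : X → Y} (hq : ContMDiff (𝓡 2) (𝓡 2) ∞ q)
    (hiso : ∀ (x : X) (v : TangentSpace (𝓡 2) x),
      ‖(mfderiv (𝓡 2) (𝓡 2) q x v : TangentSpace (𝓡 2) (q x))‖ = ‖v‖)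
    {e : OpenPartialHomeomorph X Plane} (he : e ∈ IsManifold.maximalAtlas (𝓡 2) ∞ X)
    {e' : OpenPartialHomeomorph Y Plane} (he' : e' ∈ IsManifold.maximalAtlas (𝓡 2) ∞ Y) :
    IsCoordIsometry (fun y => e' (q (e.symm y))) (e.target ∩ e.symm ⁻¹' (q ⁻¹' e'.source))
      (metricCoeff e) (metricCoeff e') := by
  have hsm : ∀ y ∈ e.target ∩ e.symm ⁻¹' (q ⁻¹' e'.source),
      ContDiffAt ℝ ∞ (fun y => e' (q (e.symm y))) y := by
    intro y hy
    have h1 : ContMDiffAt (𝓡 2) (𝓡 2) ∞ (e' ∘ q ∘ e.symm) y :=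
      ContMDiffAt.comp y (contMDiffAt_of_mem_maximalAtlas he' hy.2)
        (ContMDiffAt.comp y hq.contMDiffAt (contMDiffAt_symm_of_mem_maximalAtlas he hy.1))
    exact h1.contDiffAt
  have hopen : IsOpen (e.target ∩ e.symm ⁻¹' (q ⁻¹' e'.source)) :=
    e.symm.isOpen_inter_preimage (e'.open_source.preimage hq.continuous)
  have hquad : ∀ y ∈ e.target ∩ e.symm ⁻¹' (q ⁻¹' e'.source), ∀ a : Plane,
      metricForm (metricCoeff e') (e' (q (e.symm y)))
        (fderiv ℝ (fun y => e' (q (e.symm y))) y a) (fderiv ℝ (fun y => e' (q (e.symm y))) y a) =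
      metricForm (metricCoeff e) y a a := by
    intro y hy a
    have h1 := norm_mfderiv_sq (A := Plane) he' (f := fun y => q (e.symm y)) (t := y)
      (by filter_upwards [hopen.mem_nhds hy] with z hz using hz.2)
      ((hsm y hy).differentiableAt (by simp)) a
    rw [← h1, metricForm_metricCoeff_self]
    have h2 : HasMFDerivAt (𝓡 2) (𝓡 2) (fun y => q (e.symm y)) y
        ((mfderiv (𝓡 2) (𝓡 2) q (e.symm y)).comp (mfderiv (𝓡 2) (𝓡 2) e.symm y)) :=
      HasMFDerivAt.comp y ((hq _).mdifferentiableAt (by simp)).hasMFDerivAt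
        (mdifferentiableAt_chart_symm he hy.1).hasMFDerivAt
    rw [h2.mfderiv]
    exact congrArg (· ^ 2) (hiso (e.symm y) (mfderiv (𝓡 2) (𝓡 2) e.symm y a))
  refine ⟨hopen, hsm, fun y hy a b => ?_⟩
  -- Polarization.
  have ha := hquad y hy a
  have hb := hquad y hy b
  have hab := hquad y hy (a + b)
  have hs := (isCoordMetric_metricCoeff he).symm y 1 0
  have hs' := (isCoordMetric_metricCoeff he').symm (e' (q (e.symm y))) 1 0
  simp only [map_add] at hab
  simp only [metricForm, Fin.sum_univ_two, PiLp.add_apply, hs, hs'] at ha hb hab ⊢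
  linear_combination (1 / 2) * hab - (1 / 2) * ha - (1 / 2) * hb

/-- The coordinates of the image of a curve. -/
theorem coordState_comp {q : X → Y} (hq : ContMDiff (𝓡 2) (𝓡 2) ∞ q)
    {e : OpenPartialHomeomorph X Plane} (he : e ∈ IsManifold.maximalAtlas (𝓡 2) ∞ X)
    {e' : OpenPartialHomeomorph Y Plane} (he' : e' ∈ IsManifold.maximalAtlas (𝓡 2) ∞ Y)
    {c : ℝ → X} {s : ℝ} (hc : IsGeodesicIn e c s) (hs : q (c s) ∈ e'.source) :
    coordState e' (q ∘ c) s = (e' (q (e.symm (coordState e c s).1)),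
      fderiv ℝ (fun y => e' (q (e.symm y))) (coordState e c s).1 (coordState e c s).2) := by
  have hx : e.symm (e (c s)) = c s := e.left_inv hc.mem_source
  have h1 : ContMDiffAt (𝓡 2) (𝓡 2) ∞ (e' ∘ q ∘ e.symm) (e (c s)) :=
    ContMDiffAt.comp _ (contMDiffAt_of_mem_maximalAtlas he' (by simpa [hx] using hs))
      (ContMDiffAt.comp _ hq.contMDiffAt
        (contMDiffAt_symm_of_mem_maximalAtlas he (e.map_source hc.mem_source)))
  have h2 : HasDerivAt (fun σ => e' (q (e.symm (e (c σ)))))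
      (fderiv ℝ (fun y => e' (q (e.symm y))) (e (c s)) (coordState e c s).2) s :=
    HasFDerivAt.comp_hasDerivAt (l := fun y => e' (q (e.symm y))) s
      (h1.contDiffAt.differentiableAt (by simp)).hasFDerivAt hc.hasDerivAt_chart
  have h3 : (fun σ => e' (q (c σ))) =ᶠ[𝓝 s] fun σ => e' (q (e.symm (e (c σ)))) := by
    filter_upwards [hc.eventually_eq] with σ hσ
    rw [← hσ]
  refine Prod.ext ?_ ?_
  · exact h3.eq_of_nhds
  · change deriv (fun σ => e' (q (c σ))) s = _
    rw [h3.deriv_eq, h2.deriv]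
    rfl

/-- A local isometry maps geodesics to geodesics. -/
theorem IsGeodesicIn.comp_isometric {q : X → Y} (hq : ContMDiff (𝓡 2) (𝓡 2) ∞ q)
    (hiso : ∀ (x : X) (v : TangentSpace (𝓡 2) x),
      ‖(mfderiv (𝓡 2) (𝓡 2) q x v : TangentSpace (𝓡 2) (q x))‖ = ‖v‖)
    {e : OpenPartialHomeomorph X Plane} (he : e ∈ IsManifold.maximalAtlas (𝓡 2) ∞ X)
    {e' : OpenPartialHomeomorph Y Plane} (he' : e' ∈ IsManifold.maximalAtlas (𝓡 2) ∞ Y)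
    {c : ℝ → X} {s : ℝ} (hc : IsGeodesicIn e c s) (hs : q (c s) ∈ e'.source) :
    IsGeodesicIn e' (q ∘ c) s := by
  have hcont : ContinuousAt (q ∘ c) s := hq.continuous.continuousAt.comp hc.continuousAt
  have hev : ∀ᶠ σ in 𝓝 s, IsGeodesicIn e c σ ∧ q (c σ) ∈ e'.source :=
    hc.eventually.and (hcont.preimage_mem_nhds (e'.open_source.mem_nhds hs))
  filter_upwards [hev.eventually_nhds] with σ hσ
  obtain ⟨hcσ, hsσ⟩ := hσ.self_of_nhds
  refine ⟨hsσ, ?_⟩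
  have h1 : coordState e' (q ∘ c) =ᶠ[𝓝 σ] fun σ => (e' (q (e.symm (coordState e c σ).1)),
      fderiv ℝ (fun y => e' (q (e.symm y))) (coordState e c σ).1 (coordState e c σ).2) := by
    filter_upwards [hσ] with τ hτ using coordState_comp hq he he' hτ.1 hτ.2
  rw [h1.eq_of_nhds]
  refine HasDerivAt.congr_of_eventuallyEq ?_ h1
  have hx : e.symm (e (c σ)) = c σ := e.left_inv hcσ.mem_source
  have hW : (coordState e c σ).1 ∈ e.target ∩ e.symm ⁻¹' (q ⁻¹' e'.source) :=
    ⟨e.map_source hcσ.mem_source, by simpa [coordState, hx] using hsσ⟩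
  exact (isCoordIsometry_chart hq hiso he he').hasDerivAt_geodField (isCoordMetric_metricCoeff he)
    (isCoordMetric_metricCoeff he') hW hW.1 (e'.map_source hW.2) hcσ.hasDerivAt

theorem norm_mfderiv_id (x : X) (v : TangentSpace (𝓡 2) x) :
    ‖(mfderiv (𝓡 2) (𝓡 2) (id : X → X) x v : TangentSpace (𝓡 2) (id x))‖ = ‖v‖ := by
  rw [mfderiv_id]; rfl

/-- Being a geodesic does not depend on the chart. -/
theorem IsGeodesicAt.isGeodesicIn {c : ℝ → X} {s : ℝ} (hc : IsGeodesicAt c s)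
    {e : OpenPartialHomeomorph X Plane} (he : e ∈ IsManifold.maximalAtlas (𝓡 2) ∞ X)
    (hs : c s ∈ e.source) : IsGeodesicIn e c s := by
  obtain ⟨e₀, he₀, h⟩ := hc
  exact h.comp_isometric (q := id) contMDiff_id norm_mfderiv_id he₀ he hs

theorem IsGeodesicAt.comp_isometric {q : X → Y} (hq : ContMDiff (𝓡 2) (𝓡 2) ∞ q)
    (hiso : ∀ (x : X) (v : TangentSpace (𝓡 2) x),
      ‖(mfderiv (𝓡 2) (𝓡 2) q x v : TangentSpace (𝓡 2) (q x))‖ = ‖v‖)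
    {c : ℝ → X} {s : ℝ} (hc : IsGeodesicAt c s) : IsGeodesicAt (q ∘ c) s := by
  obtain ⟨e, he, h⟩ := hc
  exact ⟨chartAt Plane (q (c s)), IsManifold.chart_mem_maximalAtlas _,
    h.comp_isometric hq hiso he (IsManifold.chart_mem_maximalAtlas _) (mem_chart_source _ _)⟩

/-- Affine reparametrizations of geodesics. -/
theorem IsGeodesicIn.comp_mul {e : OpenPartialHomeomorph X Plane} {c : ℝ → X} {a s : ℝ}
    (hc : IsGeodesicIn e c (a * s)) : IsGeodesicIn e (fun σ => c (a * σ)) s ∧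
      coordState e (fun σ => c (a * σ)) s =
        ((coordState e c (a * s)).1, a • (coordState e c (a * s)).2) := by
  have hlin : ∀ σ : ℝ, HasDerivAt (fun σ : ℝ => a * σ) a σ := fun σ => by
    simpa using (hasDerivAt_id σ).const_mul a
  have hev : ∀ᶠ σ in 𝓝 s, IsGeodesicIn e c (a * σ) :=
    (hlin s).continuousAt.eventually hc.eventually
  have hst : ∀ σ, IsGeodesicIn e c (a * σ) → coordState e (fun σ => c (a * σ)) σ =
      ((coordState e c (a * σ)).1, a • (coordState e c (a * σ)).2) := by
    intro σ hσ
    have h1 : HasDerivAt (fun τ => e (c (a * τ))) (a • (coordState e c (a * σ)).2) σ :=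
      HasDerivAt.scomp (g₁ := fun τ => e (c τ)) σ hσ.hasDerivAt_chart (hlin σ)
    exact Prod.ext rfl h1.deriv
  refine ⟨?_, hst s hc⟩
  filter_upwards [hev.eventually_nhds] with σ hσ
  have h0 := hσ.self_of_nhds
  refine ⟨h0.mem_source, ?_⟩
  have h1 : coordState e (fun σ => c (a * σ)) =ᶠ[𝓝 σ] fun σ =>
      ((coordState e c (a * σ)).1, a • (coordState e c (a * σ)).2) := by
    filter_upwards [hσ] with τ hτ using hst τ hτ
  rw [h1.eq_of_nhds]
  refine HasDerivAt.congr_of_eventuallyEq ?_ h1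
  have h2 : HasDerivAt (fun τ => coordState e c (a * τ))
      (a • geodField (metricCoeff e) (coordState e c (a * σ))) σ :=
    HasDerivAt.scomp (g₁ := coordState e c) σ h0.hasDerivAt (hlin σ)
  have h3 : HasDerivAt (fun τ => (coordState e c (a * τ)).1)
    (a • geodField (metricCoeff e) (coordState e c (a * σ))).1 σ := h2.fst
  have h4 : HasDerivAt (fun τ => (coordState e c (a * τ)).2)
    (a • geodField (metricCoeff e) (coordState e c (a * σ))).2 σ := h2.snd
  refine (h3.prodMk (h4.const_smul a)).congr_deriv (Prod.ext rfl ?_)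
  ext k
  simp only [geodField, Prod.smul_snd, PiLp.smul_apply, smul_eq_mul, Fin.sum_univ_two]
  ring

theorem IsGeodesicAt.comp_mul {c : ℝ → X} {a s : ℝ} (hc : IsGeodesicAt c (a * s)) :
    IsGeodesicAt (fun σ => c (a * σ)) s := by
  obtain ⟨e, he, h⟩ := hc
  exact ⟨e, he, h.comp_mul.1⟩

end Geodesic

/-! ### Uniqueness, speed and existence of geodesics -/

section GeodesicExistence

variable {X : Type*} [MetricSpace X] [ChartedSpace Plane X] [IsManifold (𝓡 2) ∞ X]
  [RiemannianBundle (fun x : X => TangentSpace (𝓡 2) x)]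
  [IsContMDiffRiemannianBundle (𝓡 2) ∞ Plane (fun x : X => TangentSpace (𝓡 2) x)]

/-- A geodesic is determined, locally, by its position and its velocity at one time. -/
theorem IsGeodesicAt.eventuallyEq {c c' : ℝ → X} {s : ℝ} (hc : IsGeodesicAt c s)
    (hc' : IsGeodesicAt c' s) {e : OpenPartialHomeomorph X Plane}
    (he : e ∈ IsManifold.maximalAtlas (𝓡 2) ∞ X) (hs : c s ∈ e.source) (h0 : c s = c' s)
    (h1 : coordState e c s = coordState e c' s) : c =ᶠ[𝓝 s] c' := by
  have h := hc.isGeodesicIn he hs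
  have h' := hc'.isGeodesicIn he (h0 ▸ hs)
  obtain ⟨K, t, ht, hK⟩ := (((isCoordMetric_metricCoeff he).contDiffAt_geodField
    (z := coordState e c s) (e.map_source hs)).of_le (m := 1) (by simp)).exists_lipschitzOnWith
  have key : coordState e c =ᶠ[𝓝 s] coordState e c' := by
    refine ODE_solution_unique_of_eventually (v := fun _ => geodField (metricCoeff e))
      (s := fun _ => t) (K := K) (Eventually.of_forall fun _ => hK) ?_ ?_ h1
    · filter_upwards [h, h.hasDerivAt.continuousAt.preimage_mem_nhds ht] with σ h2 h3
        using ⟨h2.2, h3⟩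
    · filter_upwards [h', h'.hasDerivAt.continuousAt.preimage_mem_nhds (h1 ▸ ht)] with σ h2 h3
        using ⟨h2.2, h3⟩
  filter_upwards [key, h, h'] with σ h2 h3 h4
  exact e.injOn h3.1 h4.1 (congrArg Prod.fst h2)

/-- Two geodesics on an interval that agree near one time agree. -/
theorem eventuallyEq_of_isGeodesicAt {c c' : ℝ → X} {I : Set ℝ} (hI : IsPreconnected I)
    (hc : ∀ s ∈ I, IsGeodesicAt c s) (hc' : ∀ s ∈ I, IsGeodesicAt c' s) {s₀ : ℝ} (hs₀ : s₀ ∈ I)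
    (h0 : c =ᶠ[𝓝 s₀] c') : ∀ s ∈ I, c =ᶠ[𝓝 s] c' := by
  have hopen : IsOpen {s | c =ᶠ[𝓝 s] c'} :=
    isOpen_iff_mem_nhds.2 fun s (hs : c =ᶠ[𝓝 s] c') => hs.eventuallyEq_nhds
  refine hI.subset_of_closure_inter_subset hopen ⟨s₀, hs₀, h0⟩ ?_
  rintro s ⟨hcl, hs⟩
  have hfreq : ∃ᶠ σ in 𝓝 s, c =ᶠ[𝓝 σ] c' := mem_closure_iff_frequently.1 hcl
  have hcs := (hc s hs).continuousAt
  have hcs' := (hc' s hs).continuousAt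
  have e0 : c s = c' s := tendsto_nhds_unique_of_frequently_eq hcs hcs'
    (hfreq.mono fun σ hσ => hσ.eq_of_nhds)
  have he := IsManifold.chart_mem_maximalAtlas (I := 𝓡 2) (n := ∞) (c s)
  have hin := (hc s hs).isGeodesicIn he (mem_chart_source _ _)
  have hin' := (hc' s hs).isGeodesicIn he (by rw [← e0]; exact mem_chart_source _ _)
  refine (hc s hs).eventuallyEq (hc' s hs) he (mem_chart_source _ _) e0 ?_
  exact tendsto_nhds_unique_of_frequently_eq hin.hasDerivAt.continuousAt
    hin'.hasDerivAt.continuousAt (hfreq.mono fun σ hσ => (coordState_congr _ hσ).eq_of_nhds)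

theorem IsGeodesicIn.contDiffAt_chart {e : OpenPartialHomeomorph X Plane} {c : ℝ → X} {s : ℝ}
    (h : IsGeodesicIn e c s) : ContDiffAt ℝ 1 (fun σ => e (c σ)) s := by
  refine contDiffAt_one_iff.2
    ⟨fun σ => ContinuousLinearMap.toSpanSingleton ℝ (coordState e c σ).2, _, h.eventually, ?_, ?_⟩
  · intro σ hσ
    have h1 : ContinuousAt (fun σ => (coordState e c σ).2) σ :=
      (IsGeodesicIn.hasDerivAt hσ).continuousAt.snd
    exact ((ContinuousLinearMap.toSpanSingletonCLE (𝕜 := ℝ)).continuous.continuousAt.comp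
      h1).continuousWithinAt
  · intro σ hσ
    exact (IsGeodesicIn.hasDerivAt_chart hσ).hasFDerivAt

theorem IsGeodesicAt.contMDiffAt {c : ℝ → X} {s : ℝ} (h : IsGeodesicAt c s) :
    ContMDiffAt 𝓘(ℝ, ℝ) (𝓡 2) 1 c s := by
  obtain ⟨e, he, h⟩ := h
  exact contMDiffAt_of_contDiffAt_chart he (h.mono fun _ hσ => hσ.1) h.contDiffAt_chart

theorem IsGeodesicIn.norm_velocity_sq {e : OpenPartialHomeomorph X Plane}
    (he : e ∈ IsManifold.maximalAtlas (𝓡 2) ∞ X) {c : ℝ → X} {s : ℝ} (h : IsGeodesicIn e c s) :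
    ‖velocity c s‖ ^ 2 = metricForm (metricCoeff e) (coordState e c s).1 (coordState e c s).2
      (coordState e c s).2 :=
  norm_mfderiv_sq he (h.mono fun _ hσ => hσ.1) h.hasDerivAt_chart.differentiableAt (1 : ℝ)

theorem IsGeodesicAt.hasDerivAt_speed {c : ℝ → X} {s : ℝ} (h : IsGeodesicAt c s) :
    HasDerivAt (fun σ => ‖velocity c σ‖ ^ 2) 0 s := by
  obtain ⟨e, he, h⟩ := h
  refine ((isCoordMetric_metricCoeff he).hasDerivAt_speed (e.map_source h.mem_source)
    h.hasDerivAt).congr_of_eventuallyEq ?_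
  filter_upwards [h.eventually] with σ hσ using hσ.norm_velocity_sq he

/-- Geodesics have constant speed. -/
theorem norm_velocity_eq {c : ℝ → X} {a b : ℝ} (hc : ∀ s ∈ Ioo a b, IsGeodesicAt c s) {s t : ℝ}
    (hs : s ∈ Ioo a b) (ht : t ∈ Ioo a b) : ‖velocity c s‖ = ‖velocity c t‖ := by
  have h := isOpen_Ioo.is_const_of_deriv_eq_zero isPreconnected_Ioo
    (fun σ hσ => ((hc σ hσ).hasDerivAt_speed).differentiableAt.differentiableWithinAt)
    (fun σ hσ => ((hc σ hσ).hasDerivAt_speed).deriv) hs ht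
  exact (pow_left_inj₀ (norm_nonneg _) (norm_nonneg _) two_ne_zero).1 h

/-- A curve whose speed is at most `l` is Lipschitz. -/
theorem dist_le_of_norm_velocity_le [IsRiemannianManifold (𝓡 2) X] {c : ℝ → X} {s t l : ℝ}
    (hst : s ≤ t) (hl : 0 ≤ l) (hc : ContMDiffOn 𝓘(ℝ, ℝ) (𝓡 2) 1 c (Icc s t))
    (hv : ∀ σ ∈ Ioo s t, ‖velocity c σ‖ ≤ l) : dist (c s) (c t) ≤ l * (t - s) := by
  have h1 : edist (c s) (c t) ≤ pathELength (𝓡 2) c s t := by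
    rw [IsRiemannianManifold.out (I := 𝓡 2) (c s) (c t)]
    exact riemannianEDist_le_pathELength hc rfl rfl hst
  have h2 : pathELength (𝓡 2) c s t ≤ ENNReal.ofReal (l * (t - s)) := by
    rw [pathELength_eq_lintegral_mfderiv_Ioo]
    calc _ ≤ ∫⁻ _ in Ioo s t, ENNReal.ofReal l := by
          refine MeasureTheory.setLIntegral_mono measurable_const fun σ hσ => ?_
          rw [← ofReal_norm]
          exact ENNReal.ofReal_le_ofReal (hv σ hσ)
      _ = _ := by
          rw [MeasureTheory.setLIntegral_const, Real.volume_Ioo, ENNReal.ofReal_mul hl]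
  have h3 := h1.trans h2
  rw [edist_dist] at h3
  exact (ENNReal.ofReal_le_ofReal_iff (mul_nonneg hl (sub_nonneg.2 hst))).1 h3

/-- A metric in coordinates bounds the Euclidean norm. -/
theorem IsCoordMetric.norm_sq_le {g : Plane → Matrix (Fin 2) (Fin 2) ℝ} {V : Set Plane}
    (hg : IsCoordMetric g V) {y : Plane} (hy : y ∈ V) (a : Plane) :
    ‖a‖ ^ 2 ≤ (g y 0 0 + g y 1 1) / (g y).det * metricForm g y a a := by
  have hd := hg.det_pos hy
  rw [div_mul_eq_mul_div, le_div_iff₀ hd, EuclideanSpace.real_norm_sq_eq]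
  rw [Matrix.det_fin_two]
  have hs := hg.symm y 1 0
  simp only [metricForm, Fin.sum_univ_two, hs]
  nlinarith [sq_nonneg (g y 0 0 * a 0 + g y 0 1 * a 1), sq_nonneg (g y 0 1 * a 0 + g y 1 1 * a 1)]

/-- A flow box of the geodesic field of a chart. -/
theorem exists_isFlowBox_geodField {e : OpenPartialHomeomorph X Plane}
    (he : e ∈ IsManifold.maximalAtlas (𝓡 2) ∞ X) {z₀ : Plane × Plane} (hz₀ : z₀.1 ∈ e.target) :
    ∃ r δ Φ A, IsFlowBox (geodField (metricCoeff e)) z₀ r δ Φ A ∧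
      ∀ z ∈ Metric.ball z₀ r, ∀ s ∈ Ioo (-δ) δ, (Φ z s).1 ∈ e.target :=
  exists_isFlowBox (V := Prod.fst ⁻¹' e.target)
    (((isCoordMetric_metricCoeff he).contDiffAt_geodField hz₀).of_le ENat.LEInfty.out)
    (continuous_fst.continuousAt.preimage_mem_nhds (e.open_target.mem_nhds hz₀))

/-- The geodesics described by a flow box. -/
theorem IsFlowBox.isGeodesicIn {e : OpenPartialHomeomorph X Plane}
    {z₀ z : Plane × Plane} {r δ : ℝ} {Φ A} (h : IsFlowBox (geodField (metricCoeff e)) z₀ r δ Φ A)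
    (hV : ∀ z ∈ Metric.ball z₀ r, ∀ s ∈ Ioo (-δ) δ, (Φ z s).1 ∈ e.target)
    (hz : z ∈ Metric.ball z₀ r) {s₁ s : ℝ} (hs : s - s₁ ∈ Ioo (-δ) δ) :
    IsGeodesicIn e (fun σ => e.symm (Φ z (σ - s₁)).1) s ∧
      coordState e (fun σ => e.symm (Φ z (σ - s₁)).1) =ᶠ[𝓝 s] fun σ => Φ z (σ - s₁) := by
  refine isGeodesicIn_of_hasDerivAt (z := fun σ => Φ z (σ - s₁)) ?_
  have hcont : ContinuousAt (fun σ : ℝ => σ - s₁) s := by fun_prop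
  filter_upwards [hcont.preimage_mem_nhds (isOpen_Ioo.mem_nhds hs)] with σ hσ
  exact ⟨hV z hz _ hσ, (h.hasDerivAt z hz _ hσ).comp_sub_const σ s₁⟩

/-- On a complete surface, a geodesic defined on a bounded interval extends beyond its end. -/
theorem exists_extension [IsRiemannianManifold (𝓡 2) X] [CompleteSpace X] {c : ℝ → X}
    {a T s₀ : ℝ} (hc : ∀ s ∈ Ioo a T, IsGeodesicAt c s) (hs₀ : s₀ ∈ Ioo a T) :
    ∃ T' > T, ∃ c' : ℝ → X, (∀ s ∈ Ioo a T', IsGeodesicAt c' s) ∧ c' =ᶠ[𝓝 s₀] c := by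
  have haT : a < T := hs₀.1.trans hs₀.2
  set l := ‖velocity c s₀‖ with hl
  have hvel : ∀ s ∈ Ioo a T, ‖velocity c s‖ = l := fun s hs => norm_velocity_eq hc hs hs₀
  -- The geodesic is Lipschitz, so `c s` converges to a point `x` as `s` tends to `T`.
  obtain ⟨x, hx⟩ := exists_tendsto_of_dist_le (f := c) (C := l) haT fun s hs t ht hst => by
    have hsub : Icc s t ⊆ Ioo a T := fun σ hσ => ⟨hs.1.trans_le hσ.1, hσ.2.trans_lt ht.2⟩
    exact dist_le_of_norm_velocity_le hst (norm_nonneg _)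
      (fun σ hσ => (hc σ (hsub hσ)).contMDiffAt.contMDiffWithinAt)
      fun σ hσ => (hvel σ (hsub (Ioo_subset_Icc_self hσ))).le
  set e := chartAt Plane x with he_def
  have he : e ∈ IsManifold.maximalAtlas (𝓡 2) ∞ X := IsManifold.chart_mem_maximalAtlas x
  have hxe : x ∈ e.source := mem_chart_source _ x
  have hg := isCoordMetric_metricCoeff he
  have hex : e x ∈ e.target := e.map_source hxe
  have hIoo : Ioo a T ∈ 𝓝[<] T := Ioo_mem_nhdsLT haT
  have hgeo : ∀ᶠ s in 𝓝[<] T, IsGeodesicIn e c s := by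
    filter_upwards [hIoo, hx.eventually (e.open_source.mem_nhds hxe)] with s h1 h2
      using (hc s h1).isGeodesicIn he h2
  have hpos : Tendsto (fun s => e (c s)) (𝓝[<] T) (𝓝 (e x)) :=
    (e.continuousAt hxe).tendsto.comp hx
  -- The coordinate velocities stay bounded, because the speed is constant.
  let B : Plane → ℝ := fun y => (metricCoeff e y 0 0 + metricCoeff e y 1 1) / (metricCoeff e y).det
  have hB : ContinuousAt B (e x) := by
    have h1 := fun i j => (hg.smooth _ hex i j).continuousAt
    refine ((h1 0 0).add (h1 1 1)).div ?_ (hg.det_pos hex).ne'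
    simp only [Matrix.det_fin_two]
    exact ((h1 0 0).mul (h1 1 1)).sub ((h1 0 1).mul (h1 1 0))
  have hbdd : ∀ᶠ s in 𝓝[<] T,
      (coordState e c s).2 ∈ Metric.closedBall (0 : Plane) (√((B (e x) + 1) * l ^ 2)) := by
    filter_upwards [hgeo, hIoo, hpos.eventually (hB.eventually_lt_const (lt_add_one _))]
      with s h1 h2 h3
    rw [mem_closedBall_zero_iff]
    refine Real.le_sqrt_of_sq_le ((hg.norm_sq_le (e.map_source h1.mem_source) _).trans ?_)
    have h4 := h1.norm_velocity_sq he
    rw [hvel s h2] at h4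
    have h5 : metricForm (metricCoeff e) (e (c s)) (coordState e c s).2 (coordState e c s).2 =
      l ^ 2 := h4.symm
    rw [h5]
    exact mul_le_mul_of_nonneg_right h3.le (sq_nonneg l)
  -- They have a cluster point `y`. A flow box around `(e x, y)` contains the state of `c` at some
  -- time `s₁` closer to `T` than the duration `δ` of the box; its flow continues `c` up to
  -- `s₁ + δ`.
  obtain ⟨y, -, hy⟩ := (isCompact_closedBall (0 : Plane)
    (√((B (e x) + 1) * l ^ 2))).exists_mapClusterPt (f := 𝓝[<] T)
      (u := fun s => (coordState e c s).2) (le_principal_iff.2 hbdd)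
  obtain ⟨r, δ, Φ, A, hΦ, hV⟩ := exists_isFlowBox_geodField he (z₀ := (e x, y)) hex
  have hev : ∀ᶠ s in 𝓝[<] T, IsGeodesicIn e c s ∧ s ∈ Ioo (max s₀ (T - δ)) T ∧
      e (c s) ∈ Metric.ball (e x) r :=
    hgeo.and ((eventually_mem_set.2
      (Ioo_mem_nhdsLT (max_lt hs₀.2 (by linarith [hΦ.pos_δ] : T - δ < T)))).and
      (hpos.eventually (Metric.ball_mem_nhds _ hΦ.pos_r)))
  obtain ⟨s₁, hs1y, hs1g, hs1, hs1x⟩ : ∃ s₁, (coordState e c s₁).2 ∈ Metric.ball y r ∧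
      IsGeodesicIn e c s₁ ∧ s₁ ∈ Ioo (max s₀ (T - δ)) T ∧ e (c s₁) ∈ Metric.ball (e x) r :=
    ((mapClusterPt_iff_frequently.1 hy _ (Metric.ball_mem_nhds y hΦ.pos_r)).and_eventually
      hev).exists
  have hs1a : IsGeodesicAt c s₁ := ⟨e, he, hs1g⟩
  have hs1s0 : s₀ < s₁ := (le_max_left _ _).trans_lt hs1.1
  have hs1T : T - δ < s₁ := (le_max_right _ _).trans_lt hs1.1
  have hz : coordState e c s₁ ∈ Metric.ball (e x, y) r := by
    rw [← ball_prod_same]; exact ⟨hs1x, hs1y⟩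
  let d : ℝ → X := fun σ => e.symm (Φ (coordState e c s₁) (σ - s₁)).1
  have hd : ∀ s, s - s₁ ∈ Ioo (-δ) δ → IsGeodesicAt d s := fun s hs =>
    ⟨e, he, (hΦ.isGeodesicIn hV hz hs).1⟩
  have h0 : s₁ - s₁ ∈ Ioo (-δ) δ := by rw [sub_self]; exact ⟨by linarith [hΦ.pos_δ], hΦ.pos_δ⟩
  have hcd : c =ᶠ[𝓝 s₁] d := by
    have h2 : coordState e d s₁ = coordState e c s₁ := by
      have := (hΦ.isGeodesicIn hV hz h0).2.eq_of_nhds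
      rw [sub_self, hΦ.zero _ hz] at this
      exact this
    refine hs1a.eventuallyEq (hd s₁ h0) he hs1g.mem_source ?_ h2.symm
    change c s₁ = e.symm (Φ (coordState e c s₁) (s₁ - s₁)).1
    rw [sub_self, hΦ.zero _ hz]
    exact (e.left_inv hs1g.mem_source).symm
  refine ⟨s₁ + δ, by linarith, fun σ => if σ ≤ s₁ then c σ else d σ, fun s hs => ?_, ?_⟩
  · rcases lt_trichotomy s s₁ with h | h | h
    · refine (hc s ⟨hs.1, h.trans hs1.2⟩).congr ?_
      filter_upwards [Iio_mem_nhds h] with σ hσ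
      simp [(show σ < s₁ from hσ).le]
    · subst h
      refine hs1a.congr ?_
      filter_upwards [hcd] with σ hσ
      split_ifs
      · rfl
      · exact hσ
    · refine (hd s ⟨by linarith [hΦ.pos_δ], by linarith [hs.2]⟩).congr ?_
      filter_upwards [Ioi_mem_nhds h] with σ hσ
      simp [(show s₁ < σ from hσ)]
  · filter_upwards [Iio_mem_nhds hs1s0] with σ hσ
    simp [(show σ < s₁ from hσ).le]

/-- On a complete surface, geodesics extend to all positive times. -/
theorem exists_extension_of_le [IsRiemannianManifold (𝓡 2) X] [CompleteSpace X] {c₀ : ℝ → X}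
    {a T₀ : ℝ} (ha : a < 0) (hT₀ : 0 < T₀) (hc₀ : ∀ s ∈ Ioo a T₀, IsGeodesicAt c₀ s) (b : ℝ) :
    ∃ c : ℝ → X, (∀ s ∈ Ioo a b, IsGeodesicAt c s) ∧ c =ᶠ[𝓝 0] c₀ := by
  by_contra hcon
  set S : Set ℝ := {T | ∃ c : ℝ → X, (∀ s ∈ Ioo a T, IsGeodesicAt c s) ∧ c =ᶠ[𝓝 0] c₀} with hS
  have hdown : ∀ T ∈ S, ∀ T' ≤ T, T' ∈ S := fun T ⟨c, h1, h2⟩ T' hT' =>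
    ⟨c, fun s hs => h1 s ⟨hs.1, hs.2.trans_le hT'⟩, h2⟩
  have hT₀S : T₀ ∈ S := ⟨c₀, hc₀, EventuallyEq.rfl⟩
  have hbdd : BddAbove S := ⟨b, fun T hT => le_of_not_gt fun h => hcon (hdown T hT b h.le)⟩
  set T := sSup S with hT
  have hT0 : 0 < T := hT₀.trans_le (le_csSup hbdd hT₀S)
  have hlt : ∀ T' < T, T' ∈ S := fun T' hT' => by
    obtain ⟨T'', h1, h2⟩ := exists_lt_of_lt_csSup ⟨T₀, hT₀S⟩ hT'
    exact hdown T'' h1 T' h2.le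
  have : Nonempty X := ⟨c₀ 0⟩
  choose! C hC1 hC2 using hlt
  -- Geodesics on longer and longer intervals are glued.
  let τ : ℝ → ℝ := fun σ => (max σ 0 + T) / 2
  have hτ : ∀ σ < T, σ < τ σ ∧ 0 < τ σ ∧ τ σ < T := fun σ hσ => by
    have h1 := le_max_left σ 0
    have h2 := le_max_right σ 0
    have h3 := max_lt hσ hT0
    refine ⟨?_, ?_, ?_⟩ <;> simp only [τ] <;> linarith
  let c : ℝ → X := fun σ => C (τ σ) σ
  have hagree : ∀ T₁ T₂, 0 < T₁ → T₁ < T → 0 < T₂ → T₂ < T → ∀ σ ∈ Ioo a (min T₁ T₂),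
      C T₁ σ = C T₂ σ := by
    intro T₁ T₂ h1 h1' h2 h2' σ hσ
    exact (eventuallyEq_of_isGeodesicAt isPreconnected_Ioo
      (fun s hs => hC1 T₁ h1' s ⟨hs.1, hs.2.trans_le (min_le_left _ _)⟩)
      (fun s hs => hC1 T₂ h2' s ⟨hs.1, hs.2.trans_le (min_le_right _ _)⟩)
      (s₀ := 0) ⟨ha, lt_min h1 h2⟩ ((hC2 T₁ h1').trans (hC2 T₂ h2').symm) σ hσ).eq_of_nhds
  have hceq : ∀ s ∈ Ioo a T, C (τ s) =ᶠ[𝓝 s] c := by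
    intro s hs
    obtain ⟨h1, h2, h3⟩ := hτ s hs.2
    filter_upwards [Ioo_mem_nhds hs.1 h1] with σ hσ
    obtain ⟨k1, k2, k3⟩ := hτ σ (hσ.2.trans h3)
    exact hagree _ _ h2 h3 k2 k3 σ ⟨hσ.1, lt_min hσ.2 k1⟩
  have hc : ∀ s ∈ Ioo a T, IsGeodesicAt c s := fun s hs =>
    (hC1 (τ s) (hτ s hs.2).2.2 s ⟨hs.1, (hτ s hs.2).1⟩).congr (hceq s hs)
  have hc0 : c =ᶠ[𝓝 0] c₀ := (hceq 0 ⟨ha, hT0⟩).symm.trans (hC2 _ (hτ 0 hT0).2.2)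
  obtain ⟨T', hT', c', h1, h2⟩ := exists_extension hc (s₀ := 0) ⟨ha, hT0⟩
  exact absurd (le_csSup hbdd (⟨c', h1, h2.trans hc0⟩ : T' ∈ S)) (not_le.2 hT')

/-- Every position and velocity are those of a geodesic, on a complete surface. -/
theorem exists_geodesic [IsRiemannianManifold (𝓡 2) X] [CompleteSpace X]
    {e : OpenPartialHomeomorph X Plane} (he : e ∈ IsManifold.maximalAtlas (𝓡 2) ∞ X)
    {z : Plane × Plane} (hz : z.1 ∈ e.target) (b : ℝ) :
    ∃ c : ℝ → X, (∀ s ∈ Ioo (-b) b, IsGeodesicAt c s) ∧ c 0 = e.symm z.1 ∧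
      coordState e c 0 = z := by
  -- A geodesic for positive times. The one for negative times is obtained by reversing the geodesic
  -- with the opposite velocity, and the two are joined at `0`.
  have half : ∀ z : Plane × Plane, z.1 ∈ e.target → ∃ ε > 0, ∃ c : ℝ → X,
      (∀ s ∈ Ioo (-ε) b, IsGeodesicAt c s) ∧ IsGeodesicAt c 0 ∧ c 0 = e.symm z.1 ∧
        coordState e c 0 = z := by
    intro z hz
    obtain ⟨r, δ, Φ, A, hΦ, hV⟩ := exists_isFlowBox_geodField he hz
    have hzr : z ∈ Metric.ball z r := Metric.mem_ball_self hΦ.pos_r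
    let d : ℝ → X := fun σ => e.symm (Φ z (σ - 0)).1
    have hd : ∀ s ∈ Ioo (-δ) δ, IsGeodesicAt d s := fun s hs =>
      ⟨e, he, (hΦ.isGeodesicIn hV hzr (by simpa using hs)).1⟩
    have h0 : (0 : ℝ) ∈ Ioo (-δ) δ := ⟨by linarith [hΦ.pos_δ], hΦ.pos_δ⟩
    obtain ⟨c, h1, h2⟩ := exists_extension_of_le h0.1 h0.2 hd b
    refine ⟨δ, hΦ.pos_δ, c, h1, (hd 0 h0).congr h2.symm, ?_, ?_⟩
    · rw [h2.eq_of_nhds]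
      change e.symm (Φ z (0 - 0)).1 = _
      rw [sub_zero, hΦ.zero _ hzr]
    · rw [(coordState_congr e h2).eq_of_nhds]
      have := (hΦ.isGeodesicIn hV hzr (s₁ := 0) (s := 0) (by simpa using h0)).2.eq_of_nhds
      rw [sub_zero, hΦ.zero _ hzr] at this
      exact this
  obtain ⟨ε, hε, c, hc, hc0, hcx, hcz⟩ := half z hz
  obtain ⟨ε', hε', c', hc', hc0', hcx', hcz'⟩ := half (z.1, -z.2) hz
  let d : ℝ → X := fun σ => c' (-1 * σ)
  have hsrc' : c' 0 ∈ e.source := by rw [hcx']; exact e.map_target hz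
  have hd : ∀ s, IsGeodesicAt c' (-1 * s) → IsGeodesicAt d s := fun s hs => hs.comp_mul
  have hd0 : IsGeodesicAt c' (-1 * 0) := by simpa using hc0'
  have hdz : coordState e d 0 = z := by
    have h1 := (hd0.isGeodesicIn he (by simpa using hsrc')).comp_mul.2
    rw [mul_zero, hcz'] at h1
    exact h1.trans (Prod.ext rfl (by simp))
  have hcd : c =ᶠ[𝓝 0] d := by
    refine hc0.eventuallyEq (hd 0 hd0) he (by rw [hcx]; exact e.map_target hz) ?_
      (hcz.trans hdz.symm)
    change c 0 = c' (-1 * 0)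
    rw [mul_zero, hcx, hcx']
  refine ⟨fun σ => if 0 ≤ σ then c σ else d σ, fun s hs => ?_, by simpa using hcx, ?_⟩
  · rcases lt_trichotomy s 0 with h | h | h
    · refine (hd s (hc' _ ⟨by linarith, by linarith [hs.1]⟩)).congr ?_
      filter_upwards [Iio_mem_nhds h] with σ hσ
      simp [(show σ < 0 from hσ)]
    · subst h
      refine hc0.congr ?_
      filter_upwards [hcd] with σ hσ
      split_ifs
      · rfl
      · exact hσ
    · refine (hc s ⟨by linarith, hs.2⟩).congr ?_
      filter_upwards [Ioi_mem_nhds h] with σ hσ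
      simp [(show 0 < σ from hσ).le]
  · have h1 : c =ᶠ[𝓝 0] fun σ => if 0 ≤ σ then c σ else d σ := by
      filter_upwards [hcd] with σ hσ
      split_ifs
      · rfl
      · exact hσ
    rw [← (coordState_congr e h1).eq_of_nhds, hcz]

end GeodesicExistence

/-! ### Families of geodesics from a point -/

section GeodesicFamily

variable {X : Type*} [MetricSpace X] [ChartedSpace Plane X] [IsManifold (𝓡 2) ∞ X]
  [RiemannianBundle (fun x : X => TangentSpace (𝓡 2) x)]
  [IsContMDiffRiemannianBundle (𝓡 2) ∞ Plane (fun x : X => TangentSpace (𝓡 2) x)]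

/-- The geodesics `c w` issue from the point with coordinates `x₀` in the chart `e₀`, with
coordinate velocity `L w`; they are defined on `(-2, 2)`. -/
structure IsGeodesicFamily (e₀ : OpenPartialHomeomorph X Plane) (x₀ : Plane)
    (L : Plane →L[ℝ] Plane) (c : Plane → ℝ → X) : Prop where
  mem_atlas : e₀ ∈ IsManifold.maximalAtlas (𝓡 2) ∞ X
  mem_target : x₀ ∈ e₀.target
  isGeodesicAt : ∀ w, ∀ s ∈ Ioo (-2 : ℝ) 2, IsGeodesicAt (c w) s
  zero : ∀ w, c w 0 = e₀.symm x₀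
  coordState_zero : ∀ w, coordState e₀ (c w) 0 = (x₀, L w)

/-- In the chart `e`, the state at time `s` of the geodesics `c w` is a `C¹` function of `w` near
`w₀`. -/
def IsRegularIn (c : Plane → ℝ → X) (e : OpenPartialHomeomorph X Plane) (w₀ : Plane) (s : ℝ) :
    Prop :=
  (∀ᶠ w in 𝓝 w₀, c w s ∈ e.source) ∧ ContDiffAt ℝ 1 (fun w => coordState e (c w) s) w₀

variable {e₀ : OpenPartialHomeomorph X Plane} {x₀ : Plane} {L : Plane →L[ℝ] Plane}
  {c : Plane → ℝ → X}

/-- Being regular does not depend on the chart. -/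
theorem IsRegularIn.change_chart (hc : IsGeodesicFamily e₀ x₀ L c)
    {e e' : OpenPartialHomeomorph X Plane} (he : e ∈ IsManifold.maximalAtlas (𝓡 2) ∞ X)
    (he' : e' ∈ IsManifold.maximalAtlas (𝓡 2) ∞ X) {w₀ : Plane} {s : ℝ} (hs : s ∈ Ioo (-2 : ℝ) 2)
    (h : IsRegularIn c e w₀ s) (hs' : c w₀ s ∈ e'.source) : IsRegularIn c e' w₀ s := by
  have hsrc := h.1.self_of_nhds
  have hpos : ContDiffAt ℝ 1 (fun w => e (c w s)) w₀ := h.2.fst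
  have hcont : ContinuousAt (fun w => c w s) w₀ :=
    (contMDiffAt_of_contDiffAt_chart he h.1 hpos).continuousAt
  have hev : ∀ᶠ w in 𝓝 w₀, c w s ∈ e'.source := hcont.preimage_mem_nhds
    (e'.open_source.mem_nhds hs')
  refine ⟨hev, ?_⟩
  have h1 : (fun w => coordState e' (c w) s) =ᶠ[𝓝 w₀] fun w =>
      ((fun y => e' (e.symm y)) (coordState e (c w) s).1,
        fderiv ℝ (fun y => e' (e.symm y)) (coordState e (c w) s).1 (coordState e (c w) s).2) := by
    filter_upwards [hev, h.1] with w h2 h3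
    exact coordState_comp (q := id) contMDiff_id he he'
      ((hc.isGeodesicAt w s hs).isGeodesicIn he h3) h2
  have hx : e.symm (e (c w₀ s)) = c w₀ s := e.left_inv hsrc
  have h2 : ContDiffAt ℝ ∞ (fun y => e' (e.symm y)) (coordState e (c w₀) s).1 := by
    have : ContMDiffAt (𝓡 2) (𝓡 2) ∞ (e' ∘ e.symm) (e (c w₀ s)) :=
      ContMDiffAt.comp _ (contMDiffAt_of_mem_maximalAtlas he' (by rwa [hx]))
        (contMDiffAt_symm_of_mem_maximalAtlas he (e.map_source hsrc))
    exact this.contDiffAt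
  refine ContDiffAt.congr_of_eventuallyEq ?_ h1
  refine ContDiffAt.prodMk ?_ ?_
  · exact ContDiffAt.comp (g := fun y => e' (e.symm y)) w₀ (h2.of_le (by simp)) h.2.fst
  · refine ContDiffAt.clm_apply ?_ h.2.snd
    exact ContDiffAt.comp (g := fderiv ℝ (fun y => e' (e.symm y))) w₀
      (h2.fderiv_right (m := 1) (by norm_cast)) h.2.fst

/-- Near a time `s₀`, the geodesics `c w` with `w` close to `w₀` follow the flow of the geodesic
field in a chart `e`. -/
theorem IsGeodesicFamily.exists_flow (hc : IsGeodesicFamily e₀ x₀ L c)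
    {e : OpenPartialHomeomorph X Plane} (he : e ∈ IsManifold.maximalAtlas (𝓡 2) ∞ X)
    {w₀ : Plane} {s₀ : ℝ} (hs₀ : s₀ ∈ Ioo (-2 : ℝ) 2) (hes : c w₀ s₀ ∈ e.source) :
    ∃ r δ Φ A, IsFlowBox (geodField (metricCoeff e)) (coordState e (c w₀) s₀) r δ Φ A ∧
      ∃ ρ > 0, Metric.ball s₀ ρ ⊆ Ioo (-2) 2 ∧ ∀ s₁ ∈ Metric.ball s₀ ρ,
        IsGeodesicIn e (c w₀) s₁ ∧
        coordState e (c w₀) s₁ ∈ Metric.ball (coordState e (c w₀) s₀) r ∧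
        (∀ s₂ ∈ Metric.ball s₀ ρ, s₂ - s₁ ∈ Ioo (-δ) δ) ∧
        (IsRegularIn c e w₀ s₁ → ∀ᶠ w in 𝓝 w₀, ∀ s₂ ∈ Metric.ball s₀ ρ,
          c w s₂ ∈ e.source ∧ coordState e (c w) s₂ = Φ (coordState e (c w) s₁) (s₂ - s₁)) := by
  have hin := (hc.isGeodesicAt w₀ s₀ hs₀).isGeodesicIn he hes
  obtain ⟨r, δ, Φ, A, hΦ, hV⟩ :=
    exists_isFlowBox_geodField he (z₀ := coordState e (c w₀) s₀) (e.map_source hes)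
  refine ⟨r, δ, Φ, A, hΦ, ?_⟩
  have hev : ∀ᶠ s in 𝓝 s₀, IsGeodesicIn e (c w₀) s ∧
      coordState e (c w₀) s ∈ Metric.ball (coordState e (c w₀) s₀) r ∧
      s ∈ Ioo (s₀ - δ / 2) (s₀ + δ / 2) ∧ s ∈ Ioo (-2 : ℝ) 2 :=
    hin.eventually.and ((hin.hasDerivAt.continuousAt.eventually
      (Metric.ball_mem_nhds _ hΦ.pos_r)).and ((eventually_mem_set.2
        (Ioo_mem_nhds (by linarith [hΦ.pos_δ]) (by linarith [hΦ.pos_δ]))).and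
          (eventually_mem_set.2 (isOpen_Ioo.mem_nhds hs₀))))
  obtain ⟨ρ, hρ, hball⟩ := Metric.eventually_nhds_iff_ball.1 hev
  refine ⟨ρ, hρ, fun s hs => (hball s hs).2.2.2, fun s₁ hs₁ => ?_⟩
  obtain ⟨h1, h2, h3, h4⟩ := hball s₁ hs₁
  have hdiff : ∀ s₂ ∈ Metric.ball s₀ ρ, s₂ - s₁ ∈ Ioo (-δ) δ := fun s₂ hs₂ => by
    have h5 := (hball s₂ hs₂).2.2.1
    exact ⟨by linarith [h5.1, h3.2], by linarith [h5.2, h3.1]⟩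
  refine ⟨h1, h2, hdiff, fun hreg => ?_⟩
  filter_upwards [hreg.1, hreg.2.continuousAt.eventually (Metric.isOpen_ball.mem_nhds h2)]
    with w hw1 hw2
  -- Compare `c w` with the geodesic given by the flow box.
  let d : ℝ → X := fun σ => e.symm (Φ (coordState e (c w) s₁) (σ - s₁)).1
  have hd : ∀ s ∈ Metric.ball s₀ ρ, IsGeodesicAt d s := fun s hs =>
    ⟨e, he, (hΦ.isGeodesicIn hV hw2 (hdiff s hs)).1⟩
  have hds : ∀ s ∈ Metric.ball s₀ ρ, coordState e d s = Φ (coordState e (c w) s₁) (s - s₁) :=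
    fun s hs => (hΦ.isGeodesicIn hV hw2 (hdiff s hs)).2.eq_of_nhds
  have hg : ∀ s ∈ Metric.ball s₀ ρ, IsGeodesicAt (c w) s := fun s hs =>
    hc.isGeodesicAt w s (hball s hs).2.2.2
  have hcd : c w =ᶠ[𝓝 s₁] d := by
    refine (hg s₁ hs₁).eventuallyEq (hd s₁ hs₁) he hw1 ?_ ?_
    · change c w s₁ = e.symm (Φ (coordState e (c w) s₁) (s₁ - s₁)).1
      rw [sub_self, hΦ.zero _ hw2]
      exact (e.left_inv hw1).symm
    · rw [hds s₁ hs₁, sub_self, hΦ.zero _ hw2]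
  intro s₂ hs₂
  have h6 := eventuallyEq_of_isGeodesicAt (convex_ball s₀ ρ).isPreconnected hg hd hs₁ hcd s₂ hs₂
  refine ⟨?_, ?_⟩
  · rw [h6.eq_of_nhds]
    exact e.map_target (hV _ hw2 _ (hdiff s₂ hs₂))
  · rw [(coordState_congr e h6).eq_of_nhds, hds s₂ hs₂]

theorem IsGeodesicFamily.isRegularIn_zero (hc : IsGeodesicFamily e₀ x₀ L c) (w₀ : Plane) :
    IsRegularIn c e₀ w₀ 0 := by
  refine ⟨Eventually.of_forall fun w => ?_, ?_⟩
  · rw [hc.zero]; exact e₀.map_target hc.mem_target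
  · simp only [hc.coordState_zero]
    exact contDiffAt_const.prodMk L.contDiff.contDiffAt

/-- Geodesics depend on their initial velocity in a `C¹` way. -/
theorem IsGeodesicFamily.isRegularIn (hc : IsGeodesicFamily e₀ x₀ L c) (w₀ : Plane) {s : ℝ}
    (hs : s ∈ Ioo (-2 : ℝ) 2) {e : OpenPartialHomeomorph X Plane}
    (he : e ∈ IsManifold.maximalAtlas (𝓡 2) ∞ X) (hes : c w₀ s ∈ e.source) :
    IsRegularIn c e w₀ s := by
  -- Within a flow box regularity passes from any time to any other, so it holds at all times of the
  -- connected interval `(-2, 2)` or at none; it holds at `0`.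
  let R : ℝ → Prop := fun s => ∃ e ∈ IsManifold.maximalAtlas (𝓡 2) ∞ X, IsRegularIn c e w₀ s
  have hloc : ∀ s₀ ∈ Ioo (-2 : ℝ) 2, ∀ᶠ s₁ in 𝓝[Ioo (-2 : ℝ) 2] s₀, R s₀ ↔ R s₁ := by
    intro s₀ hs₀
    have he := IsManifold.chart_mem_maximalAtlas (I := 𝓡 2) (n := ∞) (c w₀ s₀)
    obtain ⟨r, δ, Φ, A, hΦ, ρ, hρ, hsub, h⟩ := hc.exists_flow he hs₀ (mem_chart_source _ _)
    have step : ∀ s₁ ∈ Metric.ball s₀ ρ, ∀ s₂ ∈ Metric.ball s₀ ρ, R s₁ → R s₂ := by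
      rintro s₁ hs₁ s₂ hs₂ ⟨e', he', hreg'⟩
      obtain ⟨h1, h2, h3, h4⟩ := h s₁ hs₁
      have hreg := hreg'.change_chart hc he' he (hsub hs₁) h1.mem_source
      have h5 := h4 hreg
      refine ⟨_, he, h5.mono fun w hw => (hw s₂ hs₂).1, ?_⟩
      refine ContDiffAt.congr_of_eventuallyEq ?_ (h5.mono fun w hw => (hw s₂ hs₂).2)
      exact ContDiffAt.comp (g := fun z => Φ z (s₂ - s₁)) w₀
        (hΦ.contDiffAt h2 (h3 s₂ hs₂)) hreg.2
    have hs₀' : s₀ ∈ Metric.ball s₀ ρ := Metric.mem_ball_self hρ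
    filter_upwards [mem_nhdsWithin_of_mem_nhds (Metric.ball_mem_nhds s₀ hρ)] with s₁ hs₁
      using ⟨step s₀ hs₀' s₁ hs₁, step s₁ hs₁ s₀ hs₀'⟩
  have h0 : (0 : ℝ) ∈ Ioo (-2 : ℝ) 2 := by norm_num
  have hiff : R 0 ↔ R s := isPreconnected_Ioo.induction₂ (fun s t => R s ↔ R t) hloc
    (fun _ _ _ _ _ _ h1 h2 => h1.trans h2) (fun _ _ _ _ h => h.symm) h0 hs
  obtain ⟨e', he', hreg⟩ := hiff.1 ⟨e₀, hc.mem_atlas, hc.isRegularIn_zero w₀⟩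
  exact hreg.change_chart hc he' he hs hes

/-- The variation field of a family of geodesics satisfies the linearized geodesic equation. -/
theorem IsGeodesicFamily.eventually_hasDerivAt (hc : IsGeodesicFamily e₀ x₀ L c)
    {e : OpenPartialHomeomorph X Plane} (he : e ∈ IsManifold.maximalAtlas (𝓡 2) ∞ X)
    {w₀ : Plane} {s₀ : ℝ} (hs₀ : s₀ ∈ Ioo (-2 : ℝ) 2) (hes : c w₀ s₀ ∈ e.source) (ξ : Plane) :
    ∀ᶠ s in 𝓝 s₀, IsGeodesicIn e (c w₀) s ∧ s ∈ Ioo (-2 : ℝ) 2 ∧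
      HasDerivAt (fun s => fderiv ℝ (fun w => coordState e (c w) s) w₀ ξ)
        (fderiv ℝ (geodField (metricCoeff e)) (coordState e (c w₀) s)
          (fderiv ℝ (fun w => coordState e (c w) s) w₀ ξ)) s := by
  obtain ⟨r, δ, Φ, A, hΦ, ρ, hρ, hsub, h⟩ := hc.exists_flow he hs₀ hes
  have hs₀' : s₀ ∈ Metric.ball s₀ ρ := Metric.mem_ball_self hρ
  obtain ⟨h1, h2, h3, h4⟩ := h s₀ hs₀'
  have hreg := hc.isRegularIn w₀ hs₀ he hes
  have h5 := h4 hreg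
  have hd0 : HasFDerivAt (fun w => coordState e (c w) s₀)
      (fderiv ℝ (fun w => coordState e (c w) s₀) w₀) w₀ :=
    (hreg.2.differentiableAt (by norm_num)).hasFDerivAt
  have hfd : ∀ s ∈ Metric.ball s₀ ρ, fderiv ℝ (fun w => coordState e (c w) s) w₀ ξ =
      A (coordState e (c w₀) s₀) (s - s₀) (fderiv ℝ (fun w => coordState e (c w) s₀) w₀ ξ) := by
    intro s hs
    have h6 : HasFDerivAt (fun w => Φ (coordState e (c w) s₀) (s - s₀))
        ((A (coordState e (c w₀) s₀) (s - s₀)).comp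
          (fderiv ℝ (fun w => coordState e (c w) s₀) w₀)) w₀ :=
      HasFDerivAt.comp (g := fun z => Φ z (s - s₀)) w₀ (hΦ.hasFDerivAt _ h2 _ (h3 s hs)) hd0
    have h7 := h6.congr_of_eventuallyEq
      (h5.mono fun w hw => (hw s hs).2 :
        (fun w => coordState e (c w) s) =ᶠ[𝓝 w₀] fun w => Φ (coordState e (c w) s₀) (s - s₀))
    rw [h7.fderiv]; rfl
  have hopen : ∀ s ∈ Metric.ball s₀ ρ, Metric.ball s₀ ρ ∈ 𝓝 s := fun s hs =>
    Metric.isOpen_ball.mem_nhds hs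
  filter_upwards [Metric.ball_mem_nhds s₀ hρ] with s hs
  refine ⟨(h s hs).1, hsub hs, ?_⟩
  have h8 : (fun s => fderiv ℝ (fun w => coordState e (c w) s) w₀ ξ) =ᶠ[𝓝 s] fun s =>
      A (coordState e (c w₀) s₀) (s - s₀) (fderiv ℝ (fun w => coordState e (c w) s₀) w₀ ξ) := by
    filter_upwards [hopen s hs] with σ hσ using hfd σ hσ
  refine HasDerivAt.congr_of_eventuallyEq ?_ h8
  rw [hfd s hs, (h5.self_of_nhds s hs).2]
  have h9 := ((hΦ.variational _ h2 _ (h3 s hs)).comp_sub_const s s₀).clm_apply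
    (hasDerivAt_const s (fderiv ℝ (fun w => coordState e (c w) s₀) w₀ ξ))
  exact h9.congr_deriv (by simp)

end GeodesicFamily

/-! ### The exponential map of a negatively curved surface expands lengths -/

section Expanding

/-- If `h ≥ 0` satisfies `h'² ≤ 2 h h''`, then `√h` is convex; so if `h` vanishes at `0`, then
`h(s) ≤ s² h(1)`. -/
theorem le_sq_mul_of_sq_deriv_le {h h' h'' : ℝ → ℝ}
    (hd : ∀ s ∈ Icc (0 : ℝ) 1, HasDerivAt h (h' s) s)
    (hd' : ∀ s ∈ Icc (0 : ℝ) 1, HasDerivAt h' (h'' s) s) (hpos : ∀ s ∈ Icc (0 : ℝ) 1, 0 ≤ h s)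
    (hle : ∀ s ∈ Icc (0 : ℝ) 1, 0 ≤ h'' s ∧ h' s ^ 2 ≤ 2 * h s * h'' s) (h0 : h 0 = 0) {s : ℝ}
    (hs : s ∈ Icc (0 : ℝ) 1) : h s ≤ s ^ 2 * h 1 := by
  have h1mem : (1 : ℝ) ∈ Icc (0 : ℝ) 1 := right_mem_Icc.2 zero_le_one
  have h0mem : (0 : ℝ) ∈ Icc (0 : ℝ) 1 := left_mem_Icc.2 zero_le_one
  -- The square root is smoothed: `√(h + ε)` is convex for `ε > 0`.
  have hconv : ∀ ε > 0, ConvexOn ℝ (Icc (0 : ℝ) 1) fun s => √(h s + ε) := by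
    intro ε hε
    have hne : ∀ s ∈ Icc (0 : ℝ) 1, 0 < √(h s + ε) := fun s hs =>
      Real.sqrt_pos.2 (by linarith [hpos s hs])
    have hf : ∀ s ∈ Icc (0 : ℝ) 1, HasDerivAt (fun s => √(h s + ε)) (h' s / (2 * √(h s + ε))) s :=
      fun s hs => ((hd s hs).add_const ε).sqrt (Real.sqrt_pos.1 (hne s hs)).ne'
    refine convexOn_of_hasDerivWithinAt2_nonneg (convex_Icc 0 1)
      (f' := fun s => h' s / (2 * √(h s + ε)))
      (f'' := fun s => (h'' s * (2 * √(h s + ε)) - h' s * (2 * (h' s / (2 * √(h s + ε))))) /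
        (2 * √(h s + ε)) ^ 2)
      (fun s hs => (hf s hs).continuousAt.continuousWithinAt) (fun s hs => ?_) (fun s hs => ?_)
      fun s hs => ?_
    · exact (hf s (interior_subset hs)).hasDerivWithinAt
    · have hs := interior_subset hs
      exact ((hd' s hs).fun_div ((hf s hs).const_mul 2)
        (mul_pos two_pos (hne s hs)).ne').hasDerivWithinAt
    · have hs := interior_subset hs
      have h1 := hne s hs
      have h2 : √(h s + ε) ^ 2 = h s + ε := Real.sq_sqrt (by linarith [hpos s hs])
      refine div_nonneg ?_ (sq_nonneg _)
      have h3 : h'' s * (2 * √(h s + ε)) - h' s * (2 * (h' s / (2 * √(h s + ε)))) =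
          (2 * h'' s * √(h s + ε) ^ 2 - h' s ^ 2) / √(h s + ε) := by
        field_simp
      rw [h3, h2]
      refine div_nonneg ?_ h1.le
      nlinarith [(hle s hs).1, (hle s hs).2, mul_nonneg (hle s hs).1 hε.le]
  have hsqrt : √(h s) ≤ s * √(h 1) := by
    have hlim : ∀ x : ℝ, Tendsto (fun ε => √(x + ε)) (𝓝[>] 0) (𝓝 √x) := fun x => by
      have : ContinuousAt (fun ε => √(x + ε)) 0 := by fun_prop
      simpa using this.tendsto.mono_left nhdsWithin_le_nhds
    have hl : Tendsto (fun ε => (1 - s) * √(h 0 + ε) + s * √(h 1 + ε)) (𝓝[>] 0)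
        (𝓝 ((1 - s) * √(h 0) + s * √(h 1))) :=
      ((hlim _).const_mul _).add ((hlim _).const_mul _)
    have hle := le_of_tendsto_of_tendsto (hlim (h s)) hl (by
      filter_upwards [self_mem_nhdsWithin] with ε hε
      have := (hconv ε hε).2 h0mem h1mem (sub_nonneg.2 hs.2) hs.1 (by ring)
      simpa using this)
    simpa [h0] using hle
  calc h s = √(h s) ^ 2 := (Real.sq_sqrt (hpos s hs)).symm
    _ ≤ (s * √(h 1)) ^ 2 := pow_le_pow_left₀ (Real.sqrt_nonneg _) hsqrt 2
    _ = s ^ 2 * h 1 := by rw [mul_pow, Real.sq_sqrt (hpos 1 h1mem)]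

variable {X : Type*} [MetricSpace X] [ChartedSpace Plane X] [IsManifold (𝓡 2) ∞ X]
  [RiemannianBundle (fun x : X => TangentSpace (𝓡 2) x)]
  [IsContMDiffRiemannianBundle (𝓡 2) ∞ Plane (fun x : X => TangentSpace (𝓡 2) x)]
  {e₀ : OpenPartialHomeomorph X Plane} {x₀ : Plane} {L : Plane →L[ℝ] Plane} {c : Plane → ℝ → X}

/-- The norm of the variation field of a family of geodesics, read in a chart. -/
theorem IsGeodesicFamily.norm_sq_variation (hc : IsGeodesicFamily e₀ x₀ L c)
    {e : OpenPartialHomeomorph X Plane} (he : e ∈ IsManifold.maximalAtlas (𝓡 2) ∞ X)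
    {w₀ : Plane} {s : ℝ} (hs : s ∈ Ioo (-2 : ℝ) 2) (hes : c w₀ s ∈ e.source) (ξ : Plane) :
    ‖(mfderiv 𝓘(ℝ, Plane) (𝓡 2) (fun w => c w s) w₀ ξ : TangentSpace (𝓡 2) (c w₀ s))‖ ^ 2 =
      metricForm (metricCoeff e) (coordState e (c w₀) s).1
        (fderiv ℝ (fun w => coordState e (c w) s) w₀ ξ).1
        (fderiv ℝ (fun w => coordState e (c w) s) w₀ ξ).1 := by
  have hreg := hc.isRegularIn w₀ hs he hes
  have hd : HasFDerivAt (fun w => coordState e (c w) s)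
      (fderiv ℝ (fun w => coordState e (c w) s) w₀) w₀ :=
    (hreg.2.differentiableAt (by norm_num)).hasFDerivAt
  have h1 : HasFDerivAt (fun w => e (c w s)) ((ContinuousLinearMap.fst ℝ Plane Plane).comp
    (fderiv ℝ (fun w => coordState e (c w) s) w₀)) w₀ := hd.fst
  rw [norm_mfderiv_sq he hreg.1 h1.differentiableAt, h1.fderiv]
  rfl

/-- The squared norm of the variation field satisfies the hypotheses of
`le_sq_mul_of_sq_deriv_le` when the curvature is negative. -/
theorem IsGeodesicFamily.exists_hasDerivAt_norm_sq (hX : NegativelyCurved X)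
    (hc : IsGeodesicFamily e₀ x₀ L c) (w₀ ξ : Plane) {s : ℝ} (hs : s ∈ Ioo (-2 : ℝ) 2)
    {h : ℝ → ℝ} (hh : ∀ s, h s =
      ‖(mfderiv 𝓘(ℝ, Plane) (𝓡 2) (fun w => c w s) w₀ ξ : TangentSpace (𝓡 2) (c w₀ s))‖ ^ 2) :
    ∃ Q, HasDerivAt h (deriv h s) s ∧ HasDerivAt (deriv h) Q s ∧ 0 ≤ Q ∧
      deriv h s ^ 2 ≤ 2 * h s * Q := by
  set e := chartAt Plane (c w₀ s)
  have he : e ∈ IsManifold.maximalAtlas (𝓡 2) ∞ X := IsManifold.chart_mem_maximalAtlas _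
  have hes : c w₀ s ∈ e.source := mem_chart_source _ _
  have hev := hc.eventually_hasDerivAt he hs hes ξ
  have hK : ∀ y ∈ e.target, gaussCurvature (metricCoeff e) y < 0 := fun y hy => by
    have := hX e he (e.symm y) (e.map_target hy)
    rwa [e.right_inv hy] at this
  obtain ⟨P, Q, h1, h2, h3, h4⟩ := (isCoordMetric_metricCoeff he).jacobi hK
    (z := coordState e (c w₀)) (w := fun s => fderiv ℝ (fun w => coordState e (c w) s) w₀ ξ)
    (s := s) (by
      filter_upwards [hev] with σ hσ
      exact ⟨e.map_source hσ.1.mem_source, hσ.1.hasDerivAt, hσ.2.2⟩)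
  have hheq : h =ᶠ[𝓝 s] fun s => metricForm (metricCoeff e) (coordState e (c w₀) s).1
        (fderiv ℝ (fun w => coordState e (c w) s) w₀ ξ).1
        (fderiv ℝ (fun w => coordState e (c w) s) w₀ ξ).1 := by
    filter_upwards [hev] with σ hσ
    rw [hh, hc.norm_sq_variation he hσ.2.1 hσ.1.mem_source]
  have hd : ∀ᶠ σ in 𝓝 s, HasDerivAt h (2 * P σ) σ := by
    filter_upwards [hheq.eventuallyEq_nhds, h1] with σ k1 k2 using k2.congr_of_eventuallyEq k1
  have hds := hd.self_of_nhds
  refine ⟨2 * Q, ?_, ?_, by linarith, ?_⟩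
  · rwa [hds.deriv]
  · refine (h2.const_mul 2).congr_of_eventuallyEq ?_
    filter_upwards [hd] with σ hσ using hσ.deriv
  · rw [hds.deriv, hheq.eq_of_nhds]
    nlinarith

/-- The exponential map expands lengths. -/
theorem IsGeodesicFamily.norm_le_norm_mfderiv (hX : NegativelyCurved X)
    (hc : IsGeodesicFamily e₀ x₀ L c)
    (hL : ∀ ξ, metricForm (metricCoeff e₀) x₀ (L ξ) (L ξ) = ‖ξ‖ ^ 2) (w₀ ξ : Plane) :
    ‖ξ‖ ≤ ‖(mfderiv 𝓘(ℝ, Plane) (𝓡 2) (fun w => c w 1) w₀ ξ : TangentSpace (𝓡 2) (c w₀ 1))‖ := by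
  obtain ⟨h, hh⟩ : ∃ h : ℝ → ℝ, ∀ s, h s =
    ‖(mfderiv 𝓘(ℝ, Plane) (𝓡 2) (fun w => c w s) w₀ ξ : TangentSpace (𝓡 2) (c w₀ s))‖ ^ 2 :=
    ⟨_, fun s => rfl⟩
  have hsub : ∀ s ∈ Icc (0 : ℝ) 1, s ∈ Ioo (-2 : ℝ) 2 := fun s hs =>
    ⟨by linarith [hs.1], by linarith [hs.2]⟩
  have hQ := fun s hs => hc.exists_hasDerivAt_norm_sq hX w₀ ξ (hsub s hs) hh
  choose! Q hQ1 hQ2 hQ3 hQ4 using hQ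
  have h0mem : (0 : ℝ) ∈ Ioo (-2 : ℝ) 2 := by norm_num
  have hsrc0 : c w₀ 0 ∈ e₀.source := by rw [hc.zero]; exact e₀.map_target hc.mem_target
  have hev := hc.eventually_hasDerivAt hc.mem_atlas h0mem hsrc0 ξ
  -- The variation field `J`, in the chart `e₀`, with `J(0) = 0` and `J'(0) = L ξ`.
  let W : ℝ → Plane × Plane := fun s => fderiv ℝ (fun w => coordState e₀ (c w) s) w₀ ξ
  have hW0 : W 0 = (0, L ξ) := by
    simp only [W, hc.coordState_zero]
    have : HasFDerivAt (fun w => (x₀, L w)) ((0 : Plane →L[ℝ] Plane).prod L) w₀ :=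
      (hasFDerivAt_const x₀ w₀).prodMk L.hasFDerivAt
    rw [this.fderiv]; rfl
  have hform : ∀ᶠ s in 𝓝 0, h s =
      metricForm (metricCoeff e₀) (coordState e₀ (c w₀) s).1 (W s).1 (W s).1 := by
    filter_upwards [hev] with s hs
    rw [hh, hc.norm_sq_variation hc.mem_atlas hs.2.1 hs.1.mem_source]
  have hg := isCoordMetric_metricCoeff hc.mem_atlas
  have h0 : h 0 = 0 := by
    rw [hform.self_of_nhds, hW0]; simp [metricForm]
  have hle := fun s hs => le_sq_mul_of_sq_deriv_le hQ1 hQ2 (fun s _ => by rw [hh]; positivity)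
    (fun s hs => ⟨hQ3 s hs, hQ4 s hs⟩) h0 (s := s) hs
  have hJ : HasDerivAt (fun s => (W s).1) (L ξ) 0 := by
    have h1 : HasDerivAt (fun s => (W s).1)
      (fderiv ℝ (geodField (metricCoeff e₀)) (coordState e₀ (c w₀) 0) (W 0)).1 0 :=
        hev.self_of_nhds.2.2.fst
    rw [hc.coordState_zero, hg.fderiv_geodField_fst hc.mem_target, hW0] at h1
    exact h1
  have hlimJ : Tendsto (fun s : ℝ => s⁻¹ • (W s).1) (𝓝[>] 0) (𝓝 (L ξ)) := by
    have := hasDerivAt_iff_tendsto_slope_zero.1 hJ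
    simp only [zero_add, hW0, sub_zero] at this
    exact this.mono_left (nhdsWithin_mono _ fun s hs => (ne_of_gt hs : s ≠ 0))
  have hlimx : Tendsto (fun s => (coordState e₀ (c w₀) s).1) (𝓝[>] 0) (𝓝 x₀) := by
    have h1 : ContinuousAt (fun s => (coordState e₀ (c w₀) s).1) 0 :=
      hev.self_of_nhds.1.hasDerivAt.continuousAt.fst
    have h2 := h1.tendsto.mono_left (nhdsWithin_le_nhds (s := Ioi 0))
    rwa [hc.coordState_zero] at h2
  have hlim : Tendsto (fun s => metricForm (metricCoeff e₀) (coordState e₀ (c w₀) s).1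
      (s⁻¹ • (W s).1) (s⁻¹ • (W s).1)) (𝓝[>] 0) (𝓝 (‖ξ‖ ^ 2)) := by
    rw [← hL ξ]
    have hk : ∀ k, Tendsto (fun s : ℝ => (s⁻¹ • (W s).1) k) (𝓝[>] 0) (𝓝 (L ξ k)) := fun k =>
      ((EuclideanSpace.proj k : Plane →L[ℝ] ℝ).continuous.tendsto _).comp hlimJ
    refine tendsto_finsetSum _ fun i _ => tendsto_finsetSum _ fun j _ => ?_
    exact (((hg.smooth _ hc.mem_target i j).continuousAt.tendsto.comp hlimx).mul (hk i)).mul (hk j)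
  have hfin : ‖ξ‖ ^ 2 ≤ h 1 := by
    refine le_of_tendsto hlim ?_
    filter_upwards [hform.filter_mono nhdsWithin_le_nhds, Ioc_mem_nhdsGT zero_lt_one]
      with s hs1 hs2
    have h1 := hle s ⟨hs2.1.le, hs2.2⟩
    rw [hs1] at h1
    have h2 : metricForm (metricCoeff e₀) (coordState e₀ (c w₀) s).1
      (s⁻¹ • (W s).1) (s⁻¹ • (W s).1) = (s⁻¹) ^ 2 *
        metricForm (metricCoeff e₀) (coordState e₀ (c w₀) s).1 (W s).1 (W s).1 := by
      simp only [metricForm, PiLp.smul_apply, smul_eq_mul, Fin.sum_univ_two]; ring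
    rw [h2]
    calc _ ≤ (s⁻¹) ^ 2 * (s ^ 2 * h 1) := mul_le_mul_of_nonneg_left h1 (sq_nonneg _)
      _ = h 1 := by have := hs2.1.ne'; field_simp
  rw [hh] at hfin
  exact (pow_le_pow_iff_left₀ (norm_nonneg _) (norm_nonneg _) two_ne_zero).1 hfin

/-- The exponential map of a negatively curved surface is expanding. -/
theorem IsGeodesicFamily.isExpanding (hX : NegativelyCurved X) (hc : IsGeodesicFamily e₀ x₀ L c)
    (hL : ∀ ξ, metricForm (metricCoeff e₀) x₀ (L ξ) (L ξ) = ‖ξ‖ ^ 2) :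
    IsExpanding (fun w : Plane => c w 1) where
  contMDiff w := by
    have h1 : (1 : ℝ) ∈ Ioo (-2 : ℝ) 2 := by norm_num
    have hreg := hc.isRegularIn w h1 (IsManifold.chart_mem_maximalAtlas (c w 1))
      (mem_chart_source Plane (c w 1))
    exact contMDiffAt_of_contDiffAt_chart (IsManifold.chart_mem_maximalAtlas (c w 1)) hreg.1
      hreg.2.fst
  norm_le w ξ := by
    rw [norm_tangentSpace_vectorSpace]
    exact hc.norm_le_norm_mfderiv hX hL w ξ

/-- An orthonormal frame: a linear map that is an isometry from the Euclidean plane to the plane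
with the metric `g y`. -/
theorem IsCoordMetric.exists_frame {g : Plane → Matrix (Fin 2) (Fin 2) ℝ} {V : Set Plane}
    (hg : IsCoordMetric g V) {y : Plane} (hy : y ∈ V) :
    ∃ L : Plane →L[ℝ] Plane, Function.Surjective L ∧ ∀ ξ, metricForm g y (L ξ) (L ξ) = ‖ξ‖ ^ 2 := by
  have hd := hg.det_pos hy
  rw [Matrix.det_fin_two] at hd
  have hs := hg.symm y 1 0
  have h00 : 0 < g y 0 0 := by
    have := hg.pos y hy (basisVec 0) (by simp)
    simpa [Fin.sum_univ_two] using this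
  rw [hs] at hd
  -- Gram-Schmidt.
  obtain ⟨α, hα, hα2⟩ : ∃ α : ℝ, 0 < α ∧ α ^ 2 * g y 0 0 = 1 :=
    ⟨(√(g y 0 0))⁻¹, by positivity, by
      rw [inv_pow, Real.sq_sqrt h00.le]; exact inv_mul_cancel₀ h00.ne'⟩
  obtain ⟨β, hβ, hβ2⟩ : ∃ β : ℝ, 0 < β ∧
      β ^ 2 * (g y 0 0 * (g y 0 0 * g y 1 1 - g y 0 1 * g y 0 1)) = 1 := by
    have : 0 < g y 0 0 * (g y 0 0 * g y 1 1 - g y 0 1 * g y 0 1) := mul_pos h00 hd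
    exact ⟨(√(g y 0 0 * (g y 0 0 * g y 1 1 - g y 0 1 * g y 0 1)))⁻¹, by positivity, by
      rw [inv_pow, Real.sq_sqrt this.le]; exact inv_mul_cancel₀ this.ne'⟩
  let L : Plane →ₗ[ℝ] Plane :=
    { toFun := fun w => !₂[α * w 0 - β * g y 0 1 * w 1, β * g y 0 0 * w 1]
      map_add' := fun a b => by ext k; fin_cases k <;> simp <;> ring
      map_smul' := fun a b => by ext k; fin_cases k <;> simp <;> ring }
  have hL0 : ∀ w, L w 0 = α * w 0 - β * g y 0 1 * w 1 := fun w => rfl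
  have hL1 : ∀ w, L w 1 = β * g y 0 0 * w 1 := fun w => rfl
  refine ⟨LinearMap.toContinuousLinearMap L, fun b => ?_, fun ξ => ?_⟩
  · refine ⟨!₂[(b 0 + β * g y 0 1 * (b 1 / (β * g y 0 0))) / α, b 1 / (β * g y 0 0)], ?_⟩
    ext k
    rw [LinearMap.coe_toContinuousLinearMap']
    fin_cases k
    · simp only [Fin.zero_eta, hL0]; simp; field_simp; ring
    · simp only [Fin.mk_one, hL1]; simp; field_simp
  · rw [LinearMap.coe_toContinuousLinearMap', EuclideanSpace.real_norm_sq_eq]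
    simp only [metricForm, Fin.sum_univ_two, hL0, hL1, hs]
    linear_combination (ξ 0) ^ 2 * hα2 + (ξ 1) ^ 2 * hβ2

end Expanding

/-! ### The universal covering -/

section Covering

variable {M : Type*} [MetricSpace M] [ChartedSpace Plane M] [IsManifold (𝓡 2) ∞ M]
  [RiemannianBundle (fun x : M => TangentSpace (𝓡 2) x)]
  [IsContMDiffRiemannianBundle (𝓡 2) ∞ Plane (fun x : M => TangentSpace (𝓡 2) x)]
  {N : Type*} [MetricSpace N] [ChartedSpace Plane N] [IsManifold (𝓡 2) ∞ N]
  [RiemannianBundle (fun x : N => TangentSpace (𝓡 2) x)]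
  [IsContMDiffRiemannianBundle (𝓡 2) ∞ Plane (fun x : N => TangentSpace (𝓡 2) x)]

theorem isContinuousRiemannianBundle_tangent :
    IsContinuousRiemannianBundle Plane (fun x : M => TangentSpace (𝓡 2) x) := by
  obtain ⟨g, hg, hgi⟩ := IsContMDiffRiemannianBundle.exists_contMDiff (IB := 𝓡 2) (n := ∞)
    (F := Plane) (E := fun x : M => TangentSpace (𝓡 2) x)
  exact ⟨g, hg.continuous, hgi⟩

/-- The second-order geodesic equation is the first-order system of the geodesic field. -/
theorem UnitGeodesic.isGeodesicAt (u : UnitGeodesic N) (t : ℝ) : IsGeodesicAt u.curve t := by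
  set e := chartAt Plane (u.curve t)
  have he : e ∈ IsManifold.maximalAtlas (𝓡 2) ∞ N := IsManifold.chart_mem_maximalAtlas _
  have hev : ∀ᶠ σ in 𝓝 t, u.curve σ ∈ e.source :=
    u.smooth.continuous.continuousAt.preimage_mem_nhds
      (e.open_source.mem_nhds (mem_chart_source _ _))
  have hsm : ∀ σ, u.curve σ ∈ e.source → ContDiffAt ℝ ∞ (fun s => e (u.curve s)) σ := by
    intro σ hσ
    have : ContMDiffAt 𝓘(ℝ, ℝ) (𝓡 2) ∞ (e ∘ u.curve) σ :=
      ContMDiffAt.comp σ (contMDiffAt_of_mem_maximalAtlas he hσ) u.smooth.contMDiffAt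
    exact this.contDiffAt
  have hk : ∀ σ, u.curve σ ∈ e.source → ∀ k, HasDerivAt (fun s => e (u.curve s) k)
      (deriv (fun s => e (u.curve s)) σ k) σ := fun σ hσ k =>
    hasDerivAt_apply ((hsm σ hσ).differentiableAt (by simp)).hasDerivAt k
  refine ⟨e, he, ?_⟩
  filter_upwards [hev.eventually_nhds] with σ hσ
  have hσ0 := hσ.self_of_nhds
  refine ⟨hσ0, HasDerivAt.prodMk ((hsm σ hσ0).differentiableAt (by simp)).hasDerivAt
    (hasDerivAt_plane fun k => ?_)⟩
  have h1 : (fun s => deriv (fun s => e (u.curve s)) s k) =ᶠ[𝓝 σ]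
      deriv fun s => e (u.curve s) k := by
    filter_upwards [hσ] with τ hτ using (hk τ hτ k).deriv.symm
  have h2 : DifferentiableAt ℝ (deriv fun s => e (u.curve s) k) σ := by
    have h3 : ContDiffAt ℝ ∞ (fun s => e (u.curve s) k) σ := contDiffAt_euclidean.1 (hsm σ hσ0) k
    have h4 : ContDiffAt ℝ 1 (deriv fun s => e (u.curve s) k) σ :=
      (h3.fderiv_right (m := 1) (by norm_cast)).clm_apply contDiffAt_const
    exact h4.differentiableAt (by norm_num)
  refine (h2.hasDerivAt.congr_of_eventuallyEq h1).congr_deriv ?_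
  have h5 := u.geodesic e he σ hσ0 k
  simp only [(hk σ hσ0 _).deriv] at h5
  exact eq_neg_of_add_eq_zero_left h5

/-- Unit-speed geodesics are `1`-Lipschitz. -/
theorem UnitGeodesic.dist_le [IsRiemannianManifold (𝓡 2) N] (u : UnitGeodesic N) {s t : ℝ}
    (hst : s ≤ t) : dist (u.curve s) (u.curve t) ≤ t - s := by
  have := dist_le_of_norm_velocity_le hst zero_le_one (u.smooth.of_le (by simp)).contMDiffOn
    fun σ _ => (u.unit_speed σ).le
  simpa using this

theorem IsRiemannianUniversalCovering.isExpanding {p : N → M}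
    (hp : IsRiemannianUniversalCovering p) : IsExpanding p where
  contMDiff := hp.smooth.of_le (by simp)
  norm_le x ξ := (hp.isometric x ξ).ge

theorem IsRiemannianUniversalCovering.mfderiv_comp {p : N → M}
    (hp : IsRiemannianUniversalCovering p) {c : ℝ → N} {t : ℝ}
    (hc : MDifferentiableAt 𝓘(ℝ, ℝ) (𝓡 2) c t) :
    ‖velocity (p ∘ c) t‖ = ‖velocity c t‖ := by
  have h1 : HasMFDerivAt 𝓘(ℝ, ℝ) (𝓡 2) (p ∘ c) t
      ((mfderiv (𝓡 2) (𝓡 2) p (c t)).comp (mfderiv 𝓘(ℝ, ℝ) (𝓡 2) c t)) :=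
    HasMFDerivAt.comp t ((hp.smooth _).mdifferentiableAt (by simp)).hasMFDerivAt hc.hasMFDerivAt
  rw [velocity, h1.mfderiv]
  exact hp.isometric (c t) (velocity c t)

theorem IsRiemannianUniversalCovering.pathELength_comp {p : N → M}
    (hp : IsRiemannianUniversalCovering p) {c : ℝ → N} {a b : ℝ}
    (hc : ContMDiffOn 𝓘(ℝ, ℝ) (𝓡 2) 1 c (Icc a b)) :
    pathELength (𝓡 2) (p ∘ c) a b = pathELength (𝓡 2) c a b := by
  rw [pathELength_eq_lintegral_mfderiv_Ioo, pathELength_eq_lintegral_mfderiv_Ioo]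
  refine MeasureTheory.setLIntegral_congr_fun measurableSet_Ioo fun t ht => ?_
  have h1 : MDifferentiableAt 𝓘(ℝ, ℝ) (𝓡 2) c t :=
    ((hc.contMDiffAt (Icc_mem_nhds ht.1 ht.2)).mdifferentiableAt (by simp))
  have h2 := hp.mfderiv_comp h1
  change ‖velocity (p ∘ c) t‖ₑ = ‖velocity c t‖ₑ
  rw [← ofReal_norm, ← ofReal_norm, h2]

variable [IsRiemannianManifold (𝓡 2) M] [IsRiemannianManifold (𝓡 2) N]

/-- A curve of length less than `r` between points at distance less than `r`. -/
theorem exists_curve_of_dist_lt {x y : N} {r : ℝ} (h : dist x y < r) :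
    ∃ c : ℝ → N, c 0 = x ∧ c 1 = y ∧ ContMDiffOn 𝓘(ℝ, ℝ) (𝓡 2) 1 c (Icc 0 1) ∧
      pathELength (𝓡 2) c 0 1 < ENNReal.ofReal r := by
  refine exists_lt_of_riemannianEDist_lt ?_
  rw [← IsRiemannianManifold.out (I := 𝓡 2) x y, edist_dist]
  exact (ENNReal.ofReal_lt_ofReal_iff (dist_nonneg.trans_lt h)).2 h

theorem dist_lt_of_edist_lt {x y : N} {r : ℝ} (h : edist x y < ENNReal.ofReal r) :
    dist x y < r := by
  rw [edist_dist] at h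
  exact (ENNReal.ofReal_lt_ofReal_iff_of_nonneg dist_nonneg).1 h

/-- The covering map does not increase distances, since it preserves lengths of curves. -/
theorem IsRiemannianUniversalCovering.dist_le {p : N → M}
    (hp : IsRiemannianUniversalCovering p) (x y : N) : dist (p x) (p y) ≤ dist x y := by
  refine le_of_forall_gt fun r hr => ?_
  obtain ⟨c, h0, h1, hc, hlen⟩ := exists_curve_of_dist_lt hr
  refine dist_lt_of_edist_lt (lt_of_le_of_lt ?_ hlen)
  rw [← hp.pathELength_comp hc, IsRiemannianManifold.out (I := 𝓡 2) (p x) (p y)]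
  refine riemannianEDist_le_pathELength (hp.isExpanding.contMDiff.comp_contMDiffOn hc) ?_ ?_
    zero_le_one
  · simp [h0]
  · simp [h1]

/-- Deck transformations do not increase distances. -/
theorem IsRiemannianUniversalCovering.dist_deck_le {p : N → M}
    (hp : IsRiemannianUniversalCovering p) {γ : N ≃ₜ N} (hγ : γ ∈ deckGroup p) (x y : N) :
    dist (γ x) (γ y) ≤ dist x y := by
  refine le_of_forall_gt fun r hr => ?_
  obtain ⟨c, h0, h1, hc, hlen⟩ := exists_curve_of_dist_lt hr
  refine dist_lt_of_edist_lt (lt_of_le_of_lt ?_ hlen)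
  rw [← hp.pathELength_comp hc, ← h0, ← h1]
  exact hp.isExpanding.edist_lift_le (Γ := γ ∘ c) zero_le_one
    (hp.isExpanding.contMDiff.comp_contMDiffOn hc)
    (γ.continuous.comp_continuousOn hc.continuousOn) fun t _ => hγ (c t)

/-- The deck group acts transitively on the fibres of the universal covering. -/
theorem IsRiemannianUniversalCovering.exists_deck {p : N → M}
    (hp : IsRiemannianUniversalCovering p) {y y' : N} (h : p y = p y') :
    ∃ γ ∈ deckGroup p, γ y = y' := by
  have := hp.simplyConnected
  have : LocallyPathConnectedSpace N := ChartedSpace.locallyPathConnectedSpace Plane N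
  let P : C(N, M) := ⟨p, hp.smooth.continuous⟩
  obtain ⟨F, ⟨hF0, hF⟩, -⟩ := hp.isCoveringMap.existsUnique_continuousMap_lifts P y y' h.symm
  obtain ⟨G, ⟨hG0, hG⟩, -⟩ := hp.isCoveringMap.existsUnique_continuousMap_lifts P y' y h
  have hFp : ∀ x, p (F x) = p x := fun x => congrFun hF x
  have hGp : ∀ x, p (G x) = p x := fun x => congrFun hG x
  have hGF : G ∘ F = id := hp.isCoveringMap.eq_of_comp_eq (G.continuous.comp F.continuous)
    continuous_id (funext fun x => (hGp _).trans (hFp x)) y (by simp [hF0, hG0])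
  have hFG : F ∘ G = id := hp.isCoveringMap.eq_of_comp_eq (F.continuous.comp G.continuous)
    continuous_id (funext fun x => (hFp _).trans (hGp x)) y' (by simp [hF0, hG0])
  exact ⟨⟨⟨F, G, congrFun hGF, congrFun hFG⟩, F.continuous, G.continuous⟩, hFp, hF0⟩

/-- The distance in the base is the infimum of the distances of lifts. -/
theorem IsRiemannianUniversalCovering.exists_deck_dist_lt {p : N → M}
    (hp : IsRiemannianUniversalCovering p) {x y : N} {r : ℝ} (h : dist (p x) (p y) < r) :
    ∃ γ ∈ deckGroup p, dist x (γ y) < r := by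
  obtain ⟨c, h0, h1, hc, hlen⟩ := exists_curve_of_dist_lt h
  let C : C(unitInterval, M) := ⟨fun t => c t, hc.continuousOn.comp_continuous
    continuous_subtype_val fun t => t.2⟩
  obtain ⟨Γ, hΓ, hΓ0⟩ := hp.isCoveringMap.exists_path_lifts C x (by simpa [C] using h0)
  have hΓp : ∀ t : unitInterval, p (Γ t) = c t := fun t => congrFun hΓ t
  obtain ⟨γ, hγ, hγy⟩ := hp.exists_deck (y := y) (y' := Γ 1) (by rw [hΓp]; simp [h1])
  refine ⟨γ, hγ, dist_lt_of_edist_lt (lt_of_le_of_lt ?_ hlen)⟩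
  have h2 := hp.isExpanding.edist_lift_le (γ := c) (Γ := fun t => Γ (projIcc 0 1 zero_le_one t))
    zero_le_one hc (Γ.continuous.comp continuous_projIcc).continuousOn fun t ht => by
      simp only [Function.comp, hΓp, projIcc_of_mem _ ht]
  have e0 : projIcc (0 : ℝ) 1 zero_le_one 0 = 0 := projIcc_left _
  have e1 : projIcc (0 : ℝ) 1 zero_le_one 1 = 1 := projIcc_right _
  rw [e0, e1, hΓ0, ← hγy] at h2
  exact h2

end Covering

/-! ### Geodesics of the universal covering are minimizing -/

section Minimizing

variable {M : Type*} [MetricSpace M] [ChartedSpace Plane M] [IsManifold (𝓡 2) ∞ M]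
  [RiemannianBundle (fun x : M => TangentSpace (𝓡 2) x)]
  [IsContMDiffRiemannianBundle (𝓡 2) ∞ Plane (fun x : M => TangentSpace (𝓡 2) x)]
  [IsRiemannianManifold (𝓡 2) M] [CompleteSpace M]
  {N : Type*} [MetricSpace N] [ChartedSpace Plane N] [IsManifold (𝓡 2) ∞ N]
  [RiemannianBundle (fun x : N => TangentSpace (𝓡 2) x)]
  [IsContMDiffRiemannianBundle (𝓡 2) ∞ Plane (fun x : N => TangentSpace (𝓡 2) x)]
  [IsRiemannianManifold (𝓡 2) N]

/-- The exponential map: an expanding map from the Euclidean plane that sends the rays from the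
origin to the geodesics from a given point. -/
theorem exists_exponential (hM : NegativelyCurved M) {c : ℝ → M} (hc : ∀ s, IsGeodesicAt c s)
    (hc1 : ‖velocity c 0‖ = 1) :
    ∃ (q : Plane → M) (w : Plane), IsExpanding q ∧ ‖w‖ = 1 ∧ ∀ s, q (s • w) = c s := by
  set e := chartAt Plane (c 0)
  have he : e ∈ IsManifold.maximalAtlas (𝓡 2) ∞ M := IsManifold.chart_mem_maximalAtlas _
  have hsrc : c 0 ∈ e.source := mem_chart_source _ _
  have htgt : e (c 0) ∈ e.target := e.map_source hsrc
  obtain ⟨L, hLs, hL⟩ := (isCoordMetric_metricCoeff he).exists_frame htgt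
  have hex : ∀ w : Plane, ∃ d : ℝ → M, (∀ s ∈ Ioo (-2 : ℝ) 2, IsGeodesicAt d s) ∧
      d 0 = e.symm (e (c 0)) ∧ coordState e d 0 = (e (c 0), L w) := fun w =>
    exists_geodesic he (z := (e (c 0), L w)) htgt 2
  choose d hd1 hd2 hd3 using hex
  have hfam : IsGeodesicFamily e (e (c 0)) L d := ⟨he, htgt, hd1, hd2, hd3⟩
  obtain ⟨w, hw⟩ := hLs (coordState e c 0).2
  refine ⟨fun w => d w 1, w, hfam.isExpanding hM hL, ?_, fun s => ?_⟩
  · have h1 := ((hc 0).isGeodesicIn he hsrc).norm_velocity_sq he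
    have h2 := hL w
    rw [hw] at h2
    rw [hc1, one_pow] at h1
    have h3 : ‖w‖ ^ 2 = 1 := h2.symm.trans h1.symm
    exact (pow_eq_one_iff_of_nonneg (norm_nonneg w) two_ne_zero).1 h3
  · -- Both sides are at time `1` on the geodesic with initial velocity `s w`.
    have h0 : IsGeodesicIn e c (s * 0) := by
      rw [mul_zero]; exact (hc 0).isGeodesicIn he hsrc
    have hgeo : ∀ σ, IsGeodesicAt (fun σ => c (s * σ)) σ := fun σ => (hc (s * σ)).comp_mul
    have hst : coordState e (fun σ => c (s * σ)) 0 = (e (c 0), L (s • w)) := by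
      rw [h0.comp_mul.2, map_smul, hw, mul_zero]; rfl
    have hdc : d (s • w) =ᶠ[𝓝 0] fun σ => c (s * σ) := by
      refine (hd1 (s • w) 0 (by norm_num)).eventuallyEq (hgeo 0) he ?_ ?_
        ((hd3 (s • w)).trans hst.symm)
      · rw [hd2, e.left_inv hsrc]; exact hsrc
      · rw [hd2, e.left_inv hsrc, mul_zero]
    have h1 := (eventuallyEq_of_isGeodesicAt isPreconnected_Ioo (hd1 (s • w)) (fun σ _ => hgeo σ)
      (s₀ := 0) (by norm_num) hdc 1 (by norm_num)).eq_of_nhds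
    simpa using h1

/-- Geodesic rays of the universal covering of a complete surface of negative curvature are
minimizing. A shorter curve with the same endpoints would be homotopic to the geodesic; its image
in the surface would then lift, through the exponential map, to a curve in the Euclidean plane that
joins the ends of a segment and is shorter than this segment. -/
theorem IsRiemannianUniversalCovering.le_dist (hM : NegativelyCurved M) {p : N → M}
    (hp : IsRiemannianUniversalCovering p) (u : UnitGeodesic N) {T : ℝ} (hT : 0 ≤ T) :
    T ≤ dist (u.curve 0) (u.curve T) := by
  by_contra! hlt
  have hpu : ∀ s, IsGeodesicAt (p ∘ u.curve) s := fun s =>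
    (u.isGeodesicAt s).comp_isometric hp.smooth hp.isometric
  have hv : ‖velocity (p ∘ u.curve) 0‖ = 1 := by
    rw [hp.mfderiv_comp ((u.smooth 0).mdifferentiableAt (by simp)), u.unit_speed]
  have := isContinuousRiemannianBundle_tangent (M := M)
  obtain ⟨q, w, hq, hw, hqw⟩ := exists_exponential hM hpu hv
  obtain ⟨c, h0, h1, hc, hlen⟩ := exists_curve_of_dist_lt hlt
  have hpc : ContMDiffOn 𝓘(ℝ, ℝ) (𝓡 2) 1 (p ∘ c) (Icc 0 1) :=
    hp.isExpanding.contMDiff.comp_contMDiffOn hc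
  have hq0 : q 0 = p (u.curve 0) := by simpa using hqw 0
  obtain ⟨Γ, hΓ⟩ := hq.exists_isLiftOn hpc (x₀ := 0) (by simp [hq0, h0])
  -- The two homotopic paths.
  let P : Path (u.curve 0) (u.curve T) :=
    { toFun := fun t => c t
      continuous_toFun := hc.continuousOn.comp_continuous continuous_subtype_val fun t => t.2
      source' := by simp [h0]
      target' := by simp [h1] }
  let Q : Path (u.curve 0) (u.curve T) :=
    { toFun := fun t => u.curve (t * T)
      continuous_toFun := u.smooth.continuous.comp (by fun_prop)
      source' := by simp
      target' := by simp }
  have := hp.simplyConnected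
  obtain ⟨H⟩ := (SimplyConnectedSpace.paths_homotopic P Q).map ⟨p, hp.smooth.continuous⟩
  have hend : Γ 1 = (1 * T) • w := by
    refine hq.hasUniformSections.lift_one_eq hq.isLocalHomeomorph H (x₀ := 0)
      (Γ₁ := fun t => (t * T) • w) ⟨hΓ.1, hΓ.2.1, fun t ht => ?_⟩ ⟨?_, ?_, fun t ht => ?_⟩
    · rw [hΓ.2.2 ht]
      simp [P, projIcc_of_mem _ ht]
    · exact Continuous.continuousOn (by fun_prop)
    · simp
    · simp [Q, projIcc_of_mem _ ht, hqw]
  have h2 := hq.edist_lift_le zero_le_one hpc hΓ.1 hΓ.2.2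
  rw [hp.pathELength_comp hc, hΓ.2.1, hend, one_mul] at h2
  have h3 := dist_lt_of_edist_lt (h2.trans_lt hlen)
  rw [dist_zero_left, norm_smul, hw, mul_one, Real.norm_of_nonneg hT] at h3
  exact lt_irrefl _ h3

end Minimizing

/-! ### Busemann functions and almost minimizing rays -/

section Busemann

variable {N : Type*} [MetricSpace N] [ChartedSpace Plane N] [IsManifold (𝓡 2) ∞ N]
  [RiemannianBundle (fun x : N => TangentSpace (𝓡 2) x)]
  [IsContMDiffRiemannianBundle (𝓡 2) ∞ Plane (fun x : N => TangentSpace (𝓡 2) x)]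
  [IsRiemannianManifold (𝓡 2) N]

/-- The function `t ↦ d(w(t), y) - t` is nonincreasing. -/
theorem UnitGeodesic.antitone_dist_sub (w : UnitGeodesic N) (y : N) :
    Antitone fun t => dist (w.curve t) y - t := fun s t hst => by
  have h1 := w.dist_le hst
  have h2 := dist_triangle (w.curve t) (w.curve s) y
  rw [dist_comm (w.curve t) (w.curve s)] at h2
  simp only
  linarith

/-- If the ray `w` is almost minimizing, then `d(w(t), y) - t` converges for every `y`. -/
theorem UnitGeodesic.exists_tendsto_dist_sub (w : UnitGeodesic N) {x : N} {K : ℝ}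
    (hw : ∀ t > 0, t - K ≤ dist (w.curve t) x) (y : N) :
    ∃ β, Tendsto (fun t => dist (w.curve t) y - t) atTop (𝓝 β) ∧
      ∀ t, β ≤ dist (w.curve t) y - t := by
  have hanti := w.antitone_dist_sub y
  have hbdd : BddBelow (range fun t => dist (w.curve t) y - t) := by
    refine ⟨-K - dist x y, ?_⟩
    rintro _ ⟨t, rfl⟩
    have h1 := hanti (le_max_left t 1)
    have h2 := hw (max t 1) (lt_max_of_lt_right one_pos)
    have h3 := dist_triangle (w.curve (max t 1)) y x
    rw [dist_comm y x] at h3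
    simp only at h1 ⊢
    linarith
  exact ⟨_, tendsto_atTop_ciInf hanti hbdd, fun t => ciInf_le hbdd t⟩

/-- The Busemann function in terms of the limits of `d(w(t), y) - t`. -/
theorem busemann_eq_sub {ξ : Boundary N} {y z : N} {β β' : ℝ}
    (hy : Tendsto (fun t => dist (ξ.ray.curve t) y - t) atTop (𝓝 β))
    (hz : Tendsto (fun t => dist (ξ.ray.curve t) z - t) atTop (𝓝 β')) :
    busemann ξ y z = β - β' := by
  refine Tendsto.limUnder_eq ?_
  refine (hy.sub hz).congr fun t => ?_
  ring

theorem UnitGeodesic.exists_dist_ray_le {v : UnitGeodesic N} {ξ : Boundary N}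
    (hv : v.endpoint = ξ) : ∃ C : ℝ, ∀ t > 0, dist (v.curve t) (ξ.ray.curve t) ≤ C := by
  have h1 : ξ.ray.endpoint = ξ := Quotient.out_eq ξ
  have h2 : (endpointSetoid N).r v ξ.ray := Quotient.exact (hv.trans h1.symm)
  exact h2

variable {M : Type*} [MetricSpace M] [ChartedSpace Plane M] [IsManifold (𝓡 2) ∞ M]
  [RiemannianBundle (fun x : M => TangentSpace (𝓡 2) x)]
  [IsContMDiffRiemannianBundle (𝓡 2) ∞ Plane (fun x : M => TangentSpace (𝓡 2) x)]
  [IsRiemannianManifold (𝓡 2) M]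

/-- If the projection of `v` is almost minimizing, then the Busemann function centred at the
endpoint of `v` is bounded above on the orbit of `v(0)`. -/
theorem AlmostMinimizing.exists_busemann_le {p : N → M} (hp : IsRiemannianUniversalCovering p)
    {v : UnitGeodesic N} (h : AlmostMinimizing fun t => p (v.curve t)) {ξ : Boundary N}
    (hv : v.endpoint = ξ) (o : N) :
    ∃ B : ℝ, ∀ γ ∈ deckGroup p, busemann ξ o (γ (v.curve 0)) ≤ B := by
  obtain ⟨c, -, hc⟩ := h
  obtain ⟨C, hC⟩ := v.exists_dist_ray_le hv
  have hlow : ∀ γ ∈ deckGroup p, ∀ t > 0, t - (c + C) ≤ dist (ξ.ray.curve t) (γ (v.curve 0)) := by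
    intro γ hγ t ht
    have h1 := hc t (le_of_lt ht)
    have h2 := hp.dist_le (v.curve t) (γ (v.curve 0))
    rw [hγ] at h2
    have h3 := dist_triangle (v.curve t) (ξ.ray.curve t) (γ (v.curve 0))
    have h4 := hC t ht
    linarith
  refine ⟨dist (ξ.ray.curve 0) o + (c + C), fun γ hγ => ?_⟩
  obtain ⟨β, hβ, hβle⟩ := ξ.ray.exists_tendsto_dist_sub (hlow 1 (one_mem _)) o
  obtain ⟨β', hβ', -⟩ := ξ.ray.exists_tendsto_dist_sub (hlow 1 (one_mem _)) (γ (v.curve 0))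
  rw [busemann_eq_sub hβ hβ']
  have h1 : β ≤ dist (ξ.ray.curve 0) o := by simpa using hβle 0
  have h2 : -(c + C) ≤ β' := by
    refine ge_of_tendsto hβ' ?_
    filter_upwards [eventually_gt_atTop 0] with t ht
    linarith [hlow γ hγ t ht]
  linarith

/-- If the Busemann function centred at the endpoint of `v` is bounded above on some orbit, then
the projection of `v` is almost minimizing. -/
theorem almostMinimizing_of_busemann_le [CompleteSpace M] (hM : NegativelyCurved M) {p : N → M}
    (hp : IsRiemannianUniversalCovering p) {v : UnitGeodesic N} {ξ : Boundary N}
    (hv : v.endpoint = ξ) {o z : N} {B : ℝ}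
    (hB : ∀ γ ∈ deckGroup p, busemann ξ o (γ z) ≤ B) :
    AlmostMinimizing fun t => p (v.curve t) := by
  obtain ⟨C, hC⟩ := v.exists_dist_ray_le hv
  have hmin : ∀ t > 0, t - 0 ≤ dist (ξ.ray.curve t) (ξ.ray.curve 0) := fun t ht => by
    rw [sub_zero, dist_comm]; exact hp.le_dist hM ξ.ray (le_of_lt ht)
  obtain ⟨β, hβ, -⟩ := ξ.ray.exists_tendsto_dist_sub hmin o
  have hlow : ∀ γ ∈ deckGroup p, ∀ t > 0,
      t - (B - β + C + dist z (v.curve 0)) ≤ dist (v.curve t) (γ (v.curve 0)) := by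
    intro γ hγ t ht
    obtain ⟨β', hβ', hle⟩ := ξ.ray.exists_tendsto_dist_sub hmin (γ z)
    have h1 := hB γ hγ
    rw [busemann_eq_sub hβ hβ'] at h1
    have h2 := hle t
    have h3 := dist_triangle4 (ξ.ray.curve t) (v.curve t) (γ (v.curve 0)) (γ z)
    have h4 := hC t ht
    rw [dist_comm] at h4
    have h5 := hp.dist_deck_le hγ (v.curve 0) z
    rw [dist_comm (v.curve 0) z] at h5
    linarith
  refine ⟨max 1 (B - β + C + dist z (v.curve 0)), lt_max_of_lt_left one_pos, fun t ht => ?_⟩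
  rcases ht.eq_or_lt with rfl | ht
  · rw [dist_self, zero_sub]
    linarith [le_max_left 1 (B - β + C + dist z (v.curve 0))]
  · refine le_of_forall_gt fun r hr => ?_
    obtain ⟨γ, hγ, hlt⟩ := hp.exists_deck_dist_lt hr
    have h1 := hlow γ hγ t ht
    linarith [le_max_right 1 (B - β + C + dist z (v.curve 0))]

end Busemann

end NegSurface

end

theorem mainTheorem4
    {M : Type*} [MetricSpace M] [ChartedSpace (EuclideanSpace ℝ (Fin 2)) M]
    [IsManifold (𝓡 2) ∞ M]
    [RiemannianBundle (fun x : M => TangentSpace (𝓡 2) x)]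
    [IsContMDiffRiemannianBundle (𝓡 2) ∞ (EuclideanSpace ℝ (Fin 2))
      (fun x : M => TangentSpace (𝓡 2) x)]
    [IsRiemannianManifold (𝓡 2) M] [CompleteSpace M]
    {N : Type*} [MetricSpace N] [ChartedSpace (EuclideanSpace ℝ (Fin 2)) N]
    [IsManifold (𝓡 2) ∞ N]
    [RiemannianBundle (fun x : N => TangentSpace (𝓡 2) x)]
    [IsContMDiffRiemannianBundle (𝓡 2) ∞ (EuclideanSpace ℝ (Fin 2))
      (fun x : N => TangentSpace (𝓡 2) x)]
    [IsRiemannianManifold (𝓡 2) N]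
    (hM : NegSurface.NegativelyCurved M)
    (p : N → M) (hp : NegSurface.IsRiemannianUniversalCovering p)
    (o : N) (ξ : NegSurface.Boundary N) (hξ : ξ ∈ NegSurface.limitSet p)
    (v : NegSurface.UnitGeodesic N) (hv : v.endpoint = ξ) :
    NegSurface.AlmostMinimizing (fun t : ℝ => p (v.curve t)) ↔
      NegSurface.IsNonhorocyclicLimitPoint p o ξ := by
  refine ⟨fun h => ⟨hξ, fun hh => ?_⟩, fun h => ?_⟩
  · obtain ⟨B, hB⟩ := h.exists_busemann_le hp hv o
    obtain ⟨γ, hγ, hlt⟩ := hh.2 (v.curve 0) B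
    exact absurd (hB γ hγ) (not_le.2 hlt)
  · have h1 : ¬ ∀ (z : N) (t : ℝ), ∃ γ ∈ NegSurface.deckGroup p,
        t < NegSurface.busemann ξ o (γ z) := fun h2 => h.2 ⟨hξ, h2⟩
    push Not at h1
    obtain ⟨z, B, hB⟩ := h1
    exact NegSurface.almostMinimizing_of_busemann_le hM hp hv hB
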